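/- Let $m>0$, $\mu=\frac{2}{m+1}$, $\nu=1-\frac{\mu^2}{4}=\frac{m(m+2)}{(m+1)^2}$, $\lambda>0$, $\alpha\in\mathbb R$. Let $m^*>0$ be the root of $\Lambda(m^*)=1$, where $\Lambda(m)=\frac2\pi(m+1)^2\big(\frac1{\sqrt{m(m+2)}}-\arcsin\frac1{m+1}\big)$. For $s\in\mathbb R$ and $\ell\in\mathbb N_0$ let $H^s_\ell(\mathbb R^3)$ be the sector of $\ell$-th angular symmetry of $H^s(\mathbb R^3)$, i.e. the $\xi\in H^s(\mathbb R^3)$ whose Fourier transform $\widehat\xi(p)$ is a finite sum of functions $g(|p|)\,Y(p/|p|)$ with $Y\in\mathrm{span}\{Y_{\ell,-\ell},\dots,Y_{\ell,\ell}\}$. Set $$\widehat{(T_\lambda\xi)}(p)=2\pi^2\sqrt{\nu p^2+\lambda}\;\widehat\xi(p)+\int_{\mathbb R^3}\frac{\widehat\xi(q)}{p^2+q^2+\mu\,p\cdot q+\lambda}\,dq,$$ $$\widehat{(W_\lambda\xi)}(p)=\frac{2\pi^2}{\sqrt{\nu p^2+\lambda}}\,\widehat\xi(p)-2\int_{\mathbb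 R^3}\frac{\widehat\xi(q)}{(p^2+q^2+\mu\,p\cdot q+\lambda)^2}\,dq .$$ Let $H^{-1/2}_{W_\lambda,\ell}$ be $H^{-1/2}_\ell(\mathbb R^3)$ with the scalar product $\langle\xi,\eta\rangle_{W_\lambda}=\int\overline{\widehat\xi(p)}\,\widehat{(W_\lambda\eta)}(p)\,dp$, and let $\mathcal A^{(\ell)}_{\lambda,\alpha}=2W_\lambda^{-1}(T_\lambda+\alpha)$ with domain $H^{3/2}_\ell(\mathbb R^3)$. Let $m>m^*$, $\ell\ge1$, and let $\lambda>0$ be large enough (depending on $\alpha$) that $\mathcal A^{(\ell)}_{\lambda,\alpha}$ has strictly positive bottom in $H^{-1/2}_{W_\lambda,\ell}$. Then $\mathcal A^{(\ell)}_{\lambda,\alpha}$ is well defined (for every $\xi\in H^{3/2}_\ell$ there is exactly one $\zeta\in H^{-1/2}_\ell$ with $W_\lambda\zeta=2(T_\lambda+\alpha)\xi$). The expression $T_\lambda$, given by an absolutely convergent integral on those elements of $H^{-1/2}_\ell$ that belong to $H^s$ for some $s>-\frac12$, extends in exactly one way to a continuous linear operator $T_\lambda:H^{-1/2}_\ell(\mathbb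 R^3)\to H^{-3/2}(\mathbb R^3)$. The kernel of the adjoint of $\mathcal A^{(\ell)}_{\lambda,\alpha}$ in the Hilbert space $H^{-1/2}_{W_\lambda,\ell}$ is $$\ker\big(\mathcal A^{(\ell)}_{\lambda,\alpha}\big)^\star=\big\{\Xi\in H^{-1/2}_\ell(\mathbb R^3)\;:\;(T_\lambda+\alpha)\,\Xi=0\ \text{ in } H^{-3/2}(\mathbb R^3)\big\}.$$ Moreover every $\Xi$ in this kernel satisfies, for almost every $p\in\mathbb R^3$, $$2\pi^2\sqrt{\nu p^2+\lambda}\;\widehat\Xi(p)+\lim_{R\to\infty}\int_{|q|<R}\frac{\widehat\Xi(q)}{p^2+q^2+\mu\,p\cdot q+\lambda}\,dq+\alpha\,\widehat\Xi(p)=0 .$$ -/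

import Mathlib

open MeasureTheory Filter Topology
open scoped ComplexConjugate ENNReal

noncomputable section

namespace TMS

/-! Everything is written in momentum space: a charge is represented by its (unitary) Fourier
transform, a function of `p ∈ ℝ³`, and the hats of the position-space notation are dropped. -/

/-- Momentum space `ℝ³` with its Euclidean norm. -/
abbrev Mom : Type := EuclideanSpace ℝ (Fin 3)

/-- The measure `(1 + p²)^s dp` on momentum space. -/
def sobolevMeasure (s : ℝ) : Measure Mom :=
  volume.withDensity (fun p => ENNReal.ofReal ((1 + ‖p‖ ^ 2) ^ s))

/-- The Sobolev space `H^s(ℝ³)`, seen through the Fourier transform: the Hilbert space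
`L²(ℝ³, (1 + p²)^s dp)`. -/
abbrev Sob (s : ℝ) : Type := Lp ℂ 2 (sobolevMeasure s)

theorem sobolevMeasure_mono {s t : ℝ} (h : s ≤ t) : sobolevMeasure s ≤ sobolevMeasure t := by
  refine withDensity_mono (ae_of_all _ fun p => ?_)
  refine ENNReal.ofReal_le_ofReal (Real.rpow_le_rpow_of_exponent_le ?_ h)
  have : 0 ≤ ‖p‖ ^ 2 := by positivity
  linarith

/-- The inclusion `H^t ⊂ H^s` for `s ≤ t`: the same function of `p`, seen in the larger space. -/
def sobIncl {s t : ℝ} (h : s ≤ t) (f : Sob t) : Sob s :=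
  ((Lp.memLp f).mono_measure (sobolevMeasure_mono h)).toLp f

/-- Solid harmonics of degree `ℓ` in three variables: homogeneous harmonic polynomials. Their
restrictions to the unit sphere form the span of the spherical harmonics
`Y_{ℓ,-ℓ}, …, Y_{ℓ,ℓ}`. -/
def IsSolidHarmonic (ℓ : ℕ) (P : MvPolynomial (Fin 3) ℂ) : Prop :=
  P.IsHomogeneous ℓ ∧ ∑ i, MvPolynomial.pderiv i (MvPolynomial.pderiv i P) = 0

/-- The sector `H^s_ℓ(ℝ³)` of `ℓ`-th angular symmetry: the finite sums of elements of `H^s` of the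
form `p ↦ g(|p|) Y(p/|p|)`, with `g` a function of the radius and `Y` in the span of the spherical
harmonics of degree `ℓ`. -/
def sector (ℓ : ℕ) (s : ℝ) : Submodule ℂ (Sob s) :=
  Submodule.span ℂ {f | ∃ (g : ℝ → ℂ) (P : MvPolynomial (Fin 3) ℂ),
    Measurable g ∧ IsSolidHarmonic ℓ P ∧
    ∀ᵐ p : Mom, f p = g ‖p‖ * MvPolynomial.eval (fun i => ((p i / ‖p‖ : ℝ) : ℂ)) P}

/-- `μ = 2 / (m + 1)`. -/
def mu (m : ℝ) : ℝ := 2 / (m + 1)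

/-- `ν = 1 - μ² / 4 = m (m + 2) / (m + 1)²`. -/
def nu (m : ℝ) : ℝ := 1 - mu m ^ 2 / 4

/-- The Efimov function `Λ(m)`. -/
def efimov (m : ℝ) : ℝ :=
  2 / Real.pi * (m + 1) ^ 2 * (1 / Real.sqrt (m * (m + 2)) - Real.arcsin (1 / (m + 1)))

/-- `p² + q² + μ p·q + λ`. -/
def den (m lam : ℝ) (p q : Mom) : ℝ := ‖p‖ ^ 2 + ‖q‖ ^ 2 + mu m * inner ℝ p q + lam

/-- The explicit expression of `T_λ ξ` at the momentum `p`. -/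
def formT (m lam : ℝ) (f : Mom → ℂ) (p : Mom) : ℂ :=
  ((2 * Real.pi ^ 2 * Real.sqrt (nu m * ‖p‖ ^ 2 + lam) : ℝ) : ℂ) * f p
    + ∫ q, f q / (den m lam p q : ℂ)

/-- The explicit expression of `W_λ ξ` at the momentum `p`. -/
def formW (m lam : ℝ) (f : Mom → ℂ) (p : Mom) : ℂ :=
  ((2 * Real.pi ^ 2 / Real.sqrt (nu m * ‖p‖ ^ 2 + lam) : ℝ) : ℂ) * f p
    - 2 * ∫ q, f q / (den m lam p q : ℂ) ^ 2

/-- The twisted scalar product `⟨ξ, η⟩_{W_λ} = ⟨ξ, W_λ η⟩_{H^{-1/2}, H^{1/2}}` on `H^{-1/2}`,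
antilinear in the first entry. -/
def innerW (m lam : ℝ) (ξ η : Sob (-1 / 2)) : ℂ :=
  ∫ p, conj (ξ p) * formW m lam η p

/-- The relation `ζ = 2 W_λ⁻¹ (T_λ + α) ξ` between `ξ ∈ H^{3/2}` and `ζ ∈ H^{-1/2}`, i.e.
`W_λ ζ = 2 (T_λ + α) ξ`. -/
def IsAction (m lam α : ℝ) (ξ : Sob (3 / 2)) (ζ : Sob (-1 / 2)) : Prop :=
  ∀ᵐ p : Mom, formW m lam ζ p = 2 * (formT m lam ξ p + (α : ℂ) * ξ p)

/-- The graph, in `H^{-1/2}_ℓ × H^{-1/2}_ℓ`, of the operator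
`𝒜^{(ℓ)}_{λ,α} = 2 W_λ⁻¹ (T_λ^{(ℓ)} + α)` with domain `H^{3/2}_ℓ`. -/
def auxGraph (m lam α : ℝ) (ℓ : ℕ) : Set (Sob (-1 / 2) × Sob (-1 / 2)) :=
  {x | (∃ ξ ∈ sector ℓ (3 / 2), x.1 = sobIncl (by norm_num) ξ ∧ IsAction m lam α ξ x.2) ∧
    x.2 ∈ sector ℓ (-1 / 2)}

/-- The bottom of `𝒜^{(ℓ)}_{λ,α}` in the Hilbert space `H^{-1/2}_{W_λ,ℓ}` is strictly positive. -/
def HasPositiveBottom (m lam α : ℝ) (ℓ : ℕ) : Prop :=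
  ∃ c : ℝ, 0 < c ∧ ∀ x ∈ auxGraph m lam α ℓ,
    c * (innerW m lam x.1 x.1).re ≤ (innerW m lam x.1 x.2).re

/-- The graph of the adjoint of `𝒜^{(ℓ)}_{λ,α}` in the Hilbert space `H^{-1/2}_{W_λ,ℓ}`: the
pairs `(η, θ)` with `⟨η, 𝒜 ξ⟩_{W_λ} = ⟨θ, ξ⟩_{W_λ}` for every `ξ` in the domain of `𝒜`. -/
def auxAdjointGraph (m lam α : ℝ) (ℓ : ℕ) : Set (Sob (-1 / 2) × Sob (-1 / 2)) :=
  {y | y.1 ∈ sector ℓ (-1 / 2) ∧ y.2 ∈ sector ℓ (-1 / 2) ∧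
    ∀ x ∈ auxGraph m lam α ℓ, innerW m lam y.1 x.2 = innerW m lam y.2 x.1}

/-- The kernel of the adjoint of `𝒜^{(ℓ)}_{λ,α}` in `H^{-1/2}_{W_λ,ℓ}`. -/
def auxAdjointKer (m lam α : ℝ) (ℓ : ℕ) : Set (Sob (-1 / 2)) :=
  {Ξ | (Ξ, 0) ∈ auxAdjointGraph m lam α ℓ}

/-- `S` is the operator `T_λ^{(ℓ)} : H^{-1/2}_ℓ → H^{-3/2}`: it is linear and continuous, and it is
given by the explicit expression of `T_λ` on those charges of `H^{-1/2}_ℓ` that belong to `H^s` for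
some `s > -1/2` (for these the integral converges absolutely; in general it does not, and `T_λ^{(ℓ)}`
is defined by continuity). -/
def IsTOperator (m lam : ℝ) (ℓ : ℕ) (S : sector ℓ (-1 / 2) →L[ℂ] Sob (-3 / 2)) : Prop :=
  ∀ Ξ : sector ℓ (-1 / 2),
    (∃ s : ℝ, -1 / 2 < s ∧ MemLp (Ξ : Sob (-1 / 2)) 2 (sobolevMeasure s)) →
    ∀ᵐ p : Mom, S Ξ p = formT m lam (Ξ : Sob (-1 / 2)) p

/-- The equation `(T_λ + α) Ξ = 0` holds at the momentum `p`, the integral over `q ∈ ℝ³` being the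
limit as `R → ∞` of the integrals over the balls `|q| < R`. -/
def SolvesAt (m lam α : ℝ) (f : Mom → ℂ) (p : Mom) : Prop :=
  Tendsto (fun R : ℝ =>
    ((2 * Real.pi ^ 2 * Real.sqrt (nu m * ‖p‖ ^ 2 + lam) : ℝ) : ℂ) * f p
      + (∫ q in Metric.ball (0 : Mom) R, f q / (den m lam p q : ℂ)) + (α : ℂ) * f p)
    atTop (𝓝 0)

end TMS

end

open TMS

/-!
The integral kernels of `T_λ` and `W_λ` are invariant under simultaneous rotations of `p` and `q`,
and everything rests on what such kernels do on a sector of angular momentum `ℓ ≥ 1`.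

*Rotation invariance.* By the Funk–Hecke theorem (`funkHecke`) a zonal kernel on the sphere maps
solid harmonics of degree `ℓ` to multiples of themselves, so the kernels preserve the sectors. It is
proved for the powers of the zonal variable by turning spherical integrals into Gaussian moments,
where integration by parts gives a recursion on the exponent and the degree, and then for continuous
zonal functions by the Weierstrass theorem. For `ℓ ≥ 1` the elements of a sector have vanishing
spherical means, so a kernel that depends on `|q|` only integrates to zero against them
(`integral_radial_mul_sector_eq_zero`). A radial kernel may therefore be subtracted at no cost.

*The operator `W_λ`.* Subtracting a multiple of `1 / (p² + q² + λ)²` from the kernel of `W_λ`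
leaves `W_λ = 2π² (ν p² + λ)^{-1/2} (1 - M)` on the sector, and the Schur test
(`isBoundedKernel_of_schur`) gives `M` a norm less than one (`isBoundedKernel_kerM`). The Neumann
series then inverts `W_λ` (`existsUnique_isAction`).

*The operator `T_λ`.* Its kernel decays too slowly to be applied on `H^{-1/2}`. Subtracting
`1 / (p² + q² + λ)` improves the decay enough for the Schur test to give a bounded operator
`H^{-1/2} → H^{-3/2}` (`exists_extension`), which agrees with `T_λ` on the sector wherever the
integral converges absolutely. Uniqueness of the extension (`isTOperator_unique`) follows by
density, through truncation to balls.

*The adjoint.* By Fubini, `T_λ + α` is symmetric for the pairing of `H^{-1/2}_ℓ` with `H^{3/2}_ℓ`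
(`integral_conj_mul_formT`). Hence `Ξ` annihilates the range of `T_λ + α` exactly when
`(T_λ + α) Ξ`, which lies in `H^{-3/2}_ℓ`, pairs to zero with all of `H^{3/2}_ℓ`, that is, when it
vanishes (`auxAdjointKer_eq`). On a ball the subtracted kernel again integrates to zero, and the
remaining integral converges absolutely, so that the integrals over balls converge to the value of
the extended operator (`tendsto_integral_ball`); this turns the equation in `H^{-3/2}` into one for
almost every momentum.
-/

noncomputable section

namespace TMS

/-! ### Spherical harmonics against zonal functions -/

/-- The value at a real point of a polynomial with complex coefficients. -/
def polyVal (P : MvPolynomial (Fin 3) ℂ) (x : Mom) : ℂ :=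
  MvPolynomial.eval (fun i => ((x i : ℝ) : ℂ)) P

/-- The linear form `x ↦ ⟨v, x⟩` as a polynomial. -/
def linForm (v : Mom) : MvPolynomial (Fin 3) ℂ :=
  ∑ i, MvPolynomial.C ((v i : ℝ) : ℂ) * MvPolynomial.X i

/-- The derivative of a polynomial in the direction `v`. -/
def dirDeriv (v : Mom) (P : MvPolynomial (Fin 3) ℂ) : MvPolynomial (Fin 3) ℂ :=
  ∑ i, MvPolynomial.C ((v i : ℝ) : ℂ) * MvPolynomial.pderiv i P

/-- The Gaussian moment functional `P ↦ ∫ P(x) exp(-|x|²/2) dx`. -/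
def gaussMoment (P : MvPolynomial (Fin 3) ℂ) : ℂ :=
  ∫ x : Mom, polyVal P x * (Real.exp (-(1 / 2) * ‖x‖ ^ 2) : ℂ)

@[simp] lemma polyVal_add (P Q : MvPolynomial (Fin 3) ℂ) (x : Mom) :
    polyVal (P + Q) x = polyVal P x + polyVal Q x := by simp [polyVal]

@[simp] lemma polyVal_mul (P Q : MvPolynomial (Fin 3) ℂ) (x : Mom) :
    polyVal (P * Q) x = polyVal P x * polyVal Q x := by simp [polyVal]

@[simp] lemma polyVal_C (a : ℂ) (x : Mom) : polyVal (MvPolynomial.C a) x = a := by simp [polyVal]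

@[simp] lemma polyVal_linForm (v x : Mom) : polyVal (linForm v) x = ((inner ℝ v x : ℝ) : ℂ) := by
  simp [polyVal, linForm, PiLp.inner_apply, Fin.sum_univ_three, mul_comm]

lemma polyVal_pow (P : MvPolynomial (Fin 3) ℂ) (n : ℕ) (x : Mom) :
    polyVal (P ^ n) x = polyVal P x ^ n := by simp [polyVal]

lemma continuous_polyVal (P : MvPolynomial (Fin 3) ℂ) : Continuous (polyVal P) := by
  unfold polyVal
  induction P using MvPolynomial.induction_on with
  | C a => simpa using continuous_const
  | add p q hp hq =>
    simp only [map_add]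
    exact hp.add hq
  | mul_X p i hp =>
    simp only [map_mul, MvPolynomial.eval_X]
    exact hp.mul (by fun_prop)

lemma polyVal_smul {ℓ : ℕ} {P : MvPolynomial (Fin 3) ℂ} (hP : P.IsHomogeneous ℓ) (r : ℝ) (x : Mom) :
    polyVal P (r • x) = (r : ℂ) ^ ℓ * polyVal P x := by
  unfold polyVal
  rw [show (fun i => (((r • x) i : ℝ) : ℂ)) = (r : ℂ) • (fun i => ((x i : ℝ) : ℂ)) by
    ext i; simp]
  rw [MvPolynomial.eval_eq, MvPolynomial.eval_eq, Finset.mul_sum]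
  refine Finset.sum_congr rfl fun d hd => ?_
  have h : d.degree = ℓ := by
    have := hP (MvPolynomial.mem_support_iff.1 hd)
    rwa [Finsupp.degree_eq_weight_one]
  simp only [Pi.smul_apply, smul_eq_mul, mul_pow, Finset.prod_mul_distrib,
    Finset.prod_pow_eq_pow_sum]
  rw [← h, Finsupp.degree_apply]
  ring

lemma exists_norm_polyVal_le (P : MvPolynomial (Fin 3) ℂ) :
    ∃ (C : ℝ) (N : ℕ), 0 ≤ C ∧ ∀ x, ‖polyVal P x‖ ≤ C * (1 + ‖x‖) ^ N := by
  induction P using MvPolynomial.induction_on with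
  | C a => exact ⟨‖a‖, 0, norm_nonneg _, fun x => by simp⟩
  | add p q hp hq =>
    obtain ⟨C, N, hC, h⟩ := hp
    obtain ⟨C', N', hC', h'⟩ := hq
    refine ⟨C + C', max N N', by positivity, fun x => ?_⟩
    have hx : 1 ≤ 1 + ‖x‖ := by linarith [norm_nonneg x]
    rw [polyVal_add, add_mul]
    refine (norm_add_le _ _).trans (add_le_add ((h x).trans ?_) ((h' x).trans ?_))
    · gcongr
      · exact le_max_left _ _
    · gcongr
      · exact le_max_right _ _
  | mul_X p i hp =>
    obtain ⟨C, N, hC, h⟩ := hp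
    refine ⟨C, N + 1, hC, fun x => ?_⟩
    have hx : ‖polyVal (MvPolynomial.X i) x‖ ≤ 1 + ‖x‖ := by
      have := PiLp.norm_apply_le x i
      simp only [polyVal, MvPolynomial.eval_X, Complex.norm_real]
      linarith
    rw [polyVal_mul, norm_mul, pow_succ, ← mul_assoc]
    exact mul_le_mul (h x) hx (norm_nonneg _) (by positivity)

lemma integrable_exp_neg_mul_norm_sq {b : ℝ} (hb : 0 < b) :
    Integrable (fun x : Mom => Real.exp (-b * ‖x‖ ^ 2)) := by
  have := (integrable_fun_norm_addHaar (volume : Measure Mom)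
    (f := fun r => Real.exp (-b * r ^ 2))).2
  refine this ?_
  have := integrableOn_rpow_mul_exp_neg_mul_sq hb (s := 2) (by norm_num)
  simpa using this

lemma integrable_polyVal_mul_gauss (P : MvPolynomial (Fin 3) ℂ) :
    Integrable (fun x : Mom => polyVal P x * (Real.exp (-(1 / 2) * ‖x‖ ^ 2) : ℂ)) := by
  obtain ⟨C, N, hC, h⟩ := exists_norm_polyVal_le P
  refine ((integrable_exp_neg_mul_norm_sq (b := 1 / 4) (by norm_num)).const_mul
    (C * N.factorial * Real.exp 2)).mono' ?_ (ae_of_all _ fun x => ?_)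
  · refine ((continuous_polyVal P).mul ?_).aestronglyMeasurable
    fun_prop
  · have h1 : (1 + ‖x‖) ^ N ≤ N.factorial * Real.exp (1 + ‖x‖) := by
      have := Real.pow_div_factorial_le_exp (x := 1 + ‖x‖) (by positivity) N
      rwa [div_le_iff₀' (by positivity)] at this
    have h2 : Real.exp (1 + ‖x‖) * Real.exp (-(1 / 2) * ‖x‖ ^ 2) ≤
        Real.exp 2 * Real.exp (-(1 / 4) * ‖x‖ ^ 2) := by
      rw [← Real.exp_add, ← Real.exp_add]
      refine Real.exp_le_exp.2 ?_
      nlinarith [sq_nonneg (‖x‖ - 2)]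
    rw [norm_mul, Complex.norm_real, Real.norm_of_nonneg (Real.exp_pos _).le]
    calc ‖polyVal P x‖ * Real.exp (-(1 / 2) * ‖x‖ ^ 2)
        ≤ C * (N.factorial * Real.exp (1 + ‖x‖)) * Real.exp (-(1 / 2) * ‖x‖ ^ 2) := by
          gcongr
          exact (h x).trans (by gcongr)
      _ = C * N.factorial * (Real.exp (1 + ‖x‖) * Real.exp (-(1 / 2) * ‖x‖ ^ 2)) := by ring
      _ ≤ C * N.factorial * (Real.exp 2 * Real.exp (-(1 / 4) * ‖x‖ ^ 2)) := by gcongr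
      _ = _ := by ring

@[simp] lemma polyVal_dirDeriv (v : Mom) (P : MvPolynomial (Fin 3) ℂ) (x : Mom) :
    polyVal (dirDeriv v P) x = ∑ i, ((v i : ℝ) : ℂ) * polyVal (MvPolynomial.pderiv i P) x := by
  simp [polyVal, dirDeriv]

lemma dirDeriv_add (v : Mom) (P Q : MvPolynomial (Fin 3) ℂ) :
    dirDeriv v (P + Q) = dirDeriv v P + dirDeriv v Q := by
  simp [dirDeriv, mul_add, Finset.sum_add_distrib]

lemma dirDeriv_mul (v : Mom) (P Q : MvPolynomial (Fin 3) ℂ) :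
    dirDeriv v (P * Q) = dirDeriv v P * Q + P * dirDeriv v Q := by
  simp only [dirDeriv, Derivation.leibniz, smul_eq_mul, Finset.sum_mul, Finset.mul_sum,
    ← Finset.sum_add_distrib]
  exact Finset.sum_congr rfl fun i _ => by ring

lemma hasLineDerivAt_polyVal (P : MvPolynomial (Fin 3) ℂ) (v x : Mom) :
    HasLineDerivAt ℝ (polyVal P) (polyVal (dirDeriv v P) x) x v := by
  unfold HasLineDerivAt
  induction P using MvPolynomial.induction_on with
  | C a => simpa [dirDeriv, polyVal] using hasDerivAt_const (0 : ℝ) a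
  | add p q hp hq =>
    rw [dirDeriv_add, polyVal_add]
    simp only [polyVal_add]
    exact hp.add hq
  | mul_X p i hp =>
    have hX : HasDerivAt (fun t : ℝ => polyVal (MvPolynomial.X i) (x + t • v))
        (polyVal (dirDeriv v (MvPolynomial.X i)) x) 0 := by
      have h0 : HasDerivAt (fun t : ℝ => x i + t * v i) (v i) 0 := by
        simpa using ((hasDerivAt_id (0 : ℝ)).mul_const (v i)).const_add (x i)
      have h1 := h0.ofReal_comp
      have e : polyVal (dirDeriv v (MvPolynomial.X i)) x = (v i : ℂ) := by
        simp only [polyVal_dirDeriv, MvPolynomial.pderiv_X, Pi.single_apply]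
        simp [polyVal, apply_ite, Finset.sum_ite_eq]
      rw [e]
      simpa [polyVal] using h1
    rw [dirDeriv_mul, polyVal_add, polyVal_mul, polyVal_mul]
    simp only [polyVal_mul]
    convert! hp.mul hX using 1
    simp

lemma hasLineDerivAt_gauss (v x : Mom) :
    HasLineDerivAt ℝ (fun x : Mom => (Real.exp (-(1 / 2) * ‖x‖ ^ 2) : ℂ))
      (-(polyVal (linForm v) x) * (Real.exp (-(1 / 2) * ‖x‖ ^ 2) : ℂ)) x v := by
  have h0 : HasDerivAt (fun t : ℝ => ‖x + t • v‖ ^ 2) (2 * inner ℝ v x) 0 := by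
    have e : (fun t : ℝ => ‖x + t • v‖ ^ 2) =
        fun t => ‖x‖ ^ 2 + t * (2 * inner ℝ v x) + t ^ 2 * ‖v‖ ^ 2 := by
      ext t
      rw [norm_add_sq_real, norm_smul, inner_smul_right, real_inner_comm, mul_pow,
        Real.norm_eq_abs, sq_abs]
      ring
    rw [e]
    have := (((hasDerivAt_id (0 : ℝ)).mul_const (2 * inner ℝ v x)).const_add (‖x‖ ^ 2)).add
      (((hasDerivAt_id (0 : ℝ)).pow 2).mul_const (‖v‖ ^ 2))
    convert! this using 1
    simp
  have h1 := ((h0.const_mul (-(1 / 2))).exp).ofReal_comp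
  unfold HasLineDerivAt
  convert! h1 using 1
  · simp
    ring

/-- Integration by parts against the Gaussian. -/
lemma gaussMoment_linForm_mul (v : Mom) (Q : MvPolynomial (Fin 3) ℂ) :
    gaussMoment (linForm v * Q) = gaussMoment (dirDeriv v Q) := by
  have key := integral_bilinear_hasLineDerivAt_right_eq_neg_left_of_integrable
    (μ := (volume : Measure Mom)) (B := ContinuousLinearMap.mul ℝ ℂ) (v := v)
    (f := polyVal Q) (f' := polyVal (dirDeriv v Q))
    (g := fun x : Mom => (Real.exp (-(1 / 2) * ‖x‖ ^ 2) : ℂ))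
    (g' := fun x => -(polyVal (linForm v) x) * (Real.exp (-(1 / 2) * ‖x‖ ^ 2) : ℂ))
    (by simpa only [ContinuousLinearMap.mul_apply'] using
      integrable_polyVal_mul_gauss (dirDeriv v Q))
    (by
      have := (integrable_polyVal_mul_gauss (linForm v * Q)).neg
      refine this.congr (ae_of_all _ fun x => ?_)
      simp only [Pi.neg_apply, polyVal_mul, ContinuousLinearMap.mul_apply']
      ring)
    (by simpa using integrable_polyVal_mul_gauss Q)
    (fun x _ => hasLineDerivAt_polyVal Q v x) (fun x _ => hasLineDerivAt_gauss v x)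
  simp only [ContinuousLinearMap.mul_apply'] at key
  unfold gaussMoment
  rw [← neg_inj, ← key, ← integral_neg]
  refine integral_congr_ae (ae_of_all _ fun x => ?_)
  simp only [polyVal_mul]
  ring

lemma gaussMoment_sum {ι : Type*} (s : Finset ι) (P : ι → MvPolynomial (Fin 3) ℂ) :
    gaussMoment (∑ i ∈ s, P i) = ∑ i ∈ s, gaussMoment (P i) := by
  unfold gaussMoment
  rw [← integral_finsetSum s fun i _ => integrable_polyVal_mul_gauss (P i)]
  refine integral_congr_ae (ae_of_all _ fun x => ?_)
  simp [polyVal, Finset.sum_mul]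

lemma gaussMoment_C_mul (a : ℂ) (P : MvPolynomial (Fin 3) ℂ) :
    gaussMoment (MvPolynomial.C a * P) = a * gaussMoment P := by
  unfold gaussMoment
  rw [← integral_const_mul]
  refine integral_congr_ae (ae_of_all _ fun x => ?_)
  simp [mul_assoc]

lemma gaussMoment_add (P Q : MvPolynomial (Fin 3) ℂ) :
    gaussMoment (P + Q) = gaussMoment P + gaussMoment Q := by
  have := gaussMoment_sum Finset.univ ![P, Q]
  simpa using this

lemma pderiv_pderiv_comm (i j : Fin 3) (P : MvPolynomial (Fin 3) ℂ) :
    MvPolynomial.pderiv i (MvPolynomial.pderiv j P) =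
      MvPolynomial.pderiv j (MvPolynomial.pderiv i P) := by
  have h : ⁅MvPolynomial.pderiv (R := ℂ) i, MvPolynomial.pderiv (R := ℂ) j⁆ = 0 := by
    refine MvPolynomial.derivation_ext fun k => ?_
    simp [Derivation.commutator_apply, MvPolynomial.pderiv_X, Pi.single_apply, apply_ite]
  have := congrArg (fun D => D P) h
  simpa [Derivation.commutator_apply, sub_eq_zero] using this

lemma map_dirDeriv_sum (v : Mom) (P : Fin 3 → MvPolynomial (Fin 3) ℂ) :
    dirDeriv v (∑ j, P j) = ∑ j, dirDeriv v (P j) := by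
  simp only [dirDeriv, map_sum, Finset.mul_sum]
  exact Finset.sum_comm

lemma IsSolidHarmonic.dirDeriv {ℓ : ℕ} {P : MvPolynomial (Fin 3) ℂ} (hP : IsSolidHarmonic ℓ P)
    (v : Mom) : IsSolidHarmonic (ℓ - 1) (dirDeriv v P) := by
  refine ⟨MvPolynomial.IsHomogeneous.sum _ _ _ fun i _ => ?_, ?_⟩
  · simpa using (MvPolynomial.isHomogeneous_C (Fin 3) ((v i : ℝ) : ℂ)).mul (hP.1.pderiv (i := i))
  · have h : ∀ j, MvPolynomial.pderiv j (MvPolynomial.pderiv j (TMS.dirDeriv v P)) =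
        TMS.dirDeriv v (MvPolynomial.pderiv j (MvPolynomial.pderiv j P)) := by
      intro j
      simp only [TMS.dirDeriv, map_sum, MvPolynomial.pderiv_C_mul]
      refine Finset.sum_congr rfl fun i _ => ?_
      rw [pderiv_pderiv_comm j i, pderiv_pderiv_comm j i]
    rw [Finset.sum_congr rfl fun j _ => h j, ← map_dirDeriv_sum, hP.2]
    simp [TMS.dirDeriv]

/-- Spherical harmonics of positive degree have mean zero: Euler's identity and an integration
by parts turn the moment into the moment of the Laplacian. -/
lemma gaussMoment_eq_zero {ℓ : ℕ} (hℓ : 1 ≤ ℓ) {P : MvPolynomial (Fin 3) ℂ}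
    (hP : IsSolidHarmonic ℓ P) : gaussMoment P = 0 := by
  have e : ∀ i : Fin 3, linForm (EuclideanSpace.single i 1) = MvPolynomial.X i := by
    intro i
    simp [linForm, apply_ite, ite_mul]
  have e' : ∀ (i : Fin 3) Q, dirDeriv (EuclideanSpace.single i 1) Q = MvPolynomial.pderiv i Q := by
    intro i Q
    simp [dirDeriv, apply_ite, ite_mul]
  have h1 : gaussMoment (∑ i, MvPolynomial.X i * MvPolynomial.pderiv i P) = 0 := by
    rw [gaussMoment_sum]
    simp_rw [← e, gaussMoment_linForm_mul, e']
    rw [← gaussMoment_sum, hP.2]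
    simp [gaussMoment, polyVal]
  rw [hP.1.sum_X_mul_pderiv, nsmul_eq_mul, ← map_natCast MvPolynomial.C, gaussMoment_C_mul] at h1
  have : (ℓ : ℂ) ≠ 0 := by exact_mod_cast (by omega : ℓ ≠ 0)
  simpa [this] using h1

/-- The Funk–Hecke formula for the powers `⟨v, x⟩^j`, in Gaussian form. Integrating one factor
`⟨v, x⟩` by parts lowers either the exponent by two or the exponent and the degree by one. -/
lemma exists_gaussMoment_linForm_pow_mul (j : ℕ) : ∀ ℓ : ℕ, ∃ c : ℂ, ∀ v : Mom, ‖v‖ = 1 →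
    ∀ P, IsSolidHarmonic ℓ P → gaussMoment (linForm v ^ j * P) = c * polyVal P v := by
  induction j using Nat.strong_induction_on with
  | _ j ih =>
  intro ℓ
  rcases j with _ | j
  · rcases ℓ with _ | ℓ
    · refine ⟨gaussMoment 1, fun v _ P hP => ?_⟩
      have h := hP.1
      rw [← MvPolynomial.totalDegree_zero_iff_isHomogeneous,
        MvPolynomial.totalDegree_eq_zero_iff_eq_C] at h
      rw [h, polyVal_C, pow_zero, one_mul, ← mul_one (MvPolynomial.C _), gaussMoment_C_mul,
        mul_comm]
    · exact ⟨0, fun v _ P hP => by simpa using gaussMoment_eq_zero (by omega) hP⟩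
  · obtain ⟨c₁, h₁⟩ := ih j (by omega) (ℓ - 1)
    obtain ⟨c₂, h₂⟩ := ih (j - 1) (by omega) ℓ
    refine ⟨j * c₂ + c₁ * ℓ, fun v hv P hP => ?_⟩
    have hlin : dirDeriv v (linForm v ^ j) = MvPolynomial.C (j : ℂ) * linForm v ^ (j - 1) := by
      have h0 : ∀ i, MvPolynomial.pderiv i (linForm v) = MvPolynomial.C ((v i : ℝ) : ℂ) := by
        intro i
        simp [linForm, MvPolynomial.pderiv_X, Pi.single_apply]
      have h1 : ∑ i, MvPolynomial.C (σ := Fin 3) ((v i : ℝ) : ℂ) *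
          MvPolynomial.C ((v i : ℝ) : ℂ) = 1 := by
        have : ∑ i, v i * v i = 1 := by
          have := EuclideanSpace.real_norm_sq_eq v
          rw [hv] at this
          simpa [pow_two] using this.symm
        simp_rw [← map_mul, ← map_sum]
        rw [← map_one MvPolynomial.C]
        congr 1
        exact_mod_cast this
      simp only [dirDeriv, Derivation.leibniz_pow, h0]
      calc _ = MvPolynomial.C (j : ℂ) * linForm v ^ (j - 1) *
            ∑ i, MvPolynomial.C (σ := Fin 3) ((v i : ℝ) : ℂ) *
              MvPolynomial.C ((v i : ℝ) : ℂ) := by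
            rw [Finset.mul_sum]
            refine Finset.sum_congr rfl fun i _ => ?_
            simp
            ring
        _ = _ := by rw [h1, mul_one]
    have heuler : polyVal (dirDeriv v P) v = ℓ * polyVal P v := by
      have := congrArg (fun Q => polyVal Q v) hP.1.sum_X_mul_pderiv
      rw [polyVal_dirDeriv]
      simpa [polyVal] using this
    rw [pow_succ', mul_assoc, gaussMoment_linForm_mul, dirDeriv_mul, gaussMoment_add, hlin,
      mul_assoc, gaussMoment_C_mul, h₂ v hv P hP, h₁ v hv _ (hP.dirDeriv v), heuler]
    ring

/-- The surface measure of the unit sphere in momentum space. -/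
abbrev sphereMeasure : Measure (Metric.sphere (0 : Mom) 1) := (volume : Measure Mom).toSphere

/-- The measure `r² dr` on the half-line, the radial part of Lebesgue measure. -/
abbrev radialMeasure : Measure (Set.Ioi (0 : ℝ)) :=
  Measure.volumeIoiPow (Module.finrank ℝ Mom - 1)

lemma norm_sphere (θ : Metric.sphere (0 : Mom) 1) : ‖(θ : Mom)‖ = 1 := by
  simp

lemma polar_symm_apply (x : ({0}ᶜ : Set Mom)) :
    ((homeomorphUnitSphereProd Mom x).2 : ℝ) • ((homeomorphUnitSphereProd Mom x).1 : Mom) = x := by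
  have hx' : ‖(x : Mom)‖ ≠ 0 := norm_ne_zero_iff.2 x.2
  simp [smul_smul, hx']

lemma integral_polar (F : Mom → ℂ) :
    ∫ x, F x = ∫ z, F ((z.2 : ℝ) • (z.1 : Mom)) ∂(sphereMeasure.prod radialMeasure) := by
  rw [← (volume : Measure Mom).measurePreserving_homeomorphUnitSphereProd.integral_comp
    (Homeomorph.measurableEmbedding _)]
  simp only [polar_symm_apply]
  rw [integral_subtype_comap (measurableSet_singleton _).compl, restrict_compl_singleton]

lemma integrable_polar {F : Mom → ℂ} (hF : Integrable F) :
    Integrable (fun z : Metric.sphere (0 : Mom) 1 × Set.Ioi (0 : ℝ) =>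
      F ((z.2 : ℝ) • (z.1 : Mom))) (sphereMeasure.prod radialMeasure) := by
  rw [← (volume : Measure Mom).measurePreserving_homeomorphUnitSphereProd.integrable_comp_emb
    (Homeomorph.measurableEmbedding _)]
  have h : IntegrableOn F ({0}ᶜ : Set Mom) := hF.integrableOn
  rw [integrableOn_iff_comap_subtypeVal (measurableSet_singleton _).compl] at h
  refine h.congr (ae_of_all _ fun x => ?_)
  simp only [Function.comp_apply]
  rw [polar_symm_apply]

lemma integrable_sphere {φ : Metric.sphere (0 : Mom) 1 → ℂ} (hφ : Continuous φ) :
    Integrable φ sphereMeasure := by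
  simpa using hφ.integrable_of_hasCompactSupport (HasCompactSupport.of_compactSpace φ)
    (μ := sphereMeasure)

/-- The Gaussian moment of a homogeneous polynomial is a fixed multiple of its spherical
integral. -/
lemma exists_sphere_integral_eq (d : ℕ) : ∃ c : ℂ, ∀ Q : MvPolynomial (Fin 3) ℂ,
    Q.IsHomogeneous d → ∫ θ, polyVal Q (θ : Mom) ∂sphereMeasure = c * gaussMoment Q := by
  set R : ℂ := ∫ r : Set.Ioi (0 : ℝ), (((r : ℝ) ^ d * Real.exp (-(1 / 2) * (r : ℝ) ^ 2) : ℝ) : ℂ)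
    ∂radialMeasure with hR
  have hn : ∀ z : Metric.sphere (0 : Mom) 1 × Set.Ioi (0 : ℝ),
      ‖((z.2 : ℝ) • (z.1 : Mom))‖ = z.2 := fun z => by
    rw [norm_smul, norm_sphere, mul_one, Real.norm_of_nonneg z.2.2.le]
  have hR0 : R ≠ 0 := by
    have hi : Integrable fun x : Mom => ‖x‖ ^ d * Real.exp (-(1 / 2) * ‖x‖ ^ 2) := by
      rw [integrable_fun_norm_addHaar (volume : Measure Mom)
        (f := fun r => r ^ d * Real.exp (-(1 / 2) * r ^ 2))]
      have := integrableOn_rpow_mul_exp_neg_mul_sq (b := 1 / 2) (by norm_num)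
        (s := ((2 + d : ℕ) : ℝ)) (by have : (0 : ℝ) ≤ ((2 + d : ℕ) : ℝ) := by positivity
                                     linarith)
      simp only [Real.rpow_natCast] at this
      refine this.congr_fun (fun r _ => ?_) measurableSet_Ioi
      simp [pow_add]
      ring
    have hpos : 0 < ∫ x : Mom, ‖x‖ ^ d * Real.exp (-(1 / 2) * ‖x‖ ^ 2) := by
      refine integral_pos_of_integrable_nonneg_nonzero (x := EuclideanSpace.single 0 1)
        (by fun_prop) hi (fun x => by positivity) ?_
      simp
    have hc : ∫ x : Mom, ((‖x‖ ^ d * Real.exp (-(1 / 2) * ‖x‖ ^ 2) : ℝ) : ℂ) =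
        (∫ _θ, (1 : ℂ) ∂sphereMeasure) * R := by
      rw [integral_polar, hR, ← integral_prod_mul]
      exact integral_congr_ae (ae_of_all _ fun z => by simp only [hn, one_mul])
    intro h
    rw [h, mul_zero, integral_complex_ofReal, Complex.ofReal_eq_zero] at hc
    exact hpos.ne' hc
  refine ⟨R⁻¹, fun Q hQ => ?_⟩
  have : gaussMoment Q = (∫ θ, polyVal Q (θ : Mom) ∂sphereMeasure) * R := by
    rw [gaussMoment, integral_polar, hR, ← integral_prod_mul]
    refine integral_congr_ae (ae_of_all _ fun z => ?_)
    simp only [hn, polyVal_smul hQ]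
    push_cast
    ring
  rw [this]
  field_simp

lemma isHomogeneous_linForm (v : Mom) : (linForm v).IsHomogeneous 1 := by
  refine MvPolynomial.IsHomogeneous.sum _ _ _ fun i _ => ?_
  simpa using (MvPolynomial.isHomogeneous_C (Fin 3) ((v i : ℝ) : ℂ)).mul
    (MvPolynomial.isHomogeneous_X ℂ i)

lemma abs_inner_sphere_le {v : Mom} (hv : ‖v‖ = 1) (θ : Metric.sphere (0 : Mom) 1) :
    inner ℝ v (θ : Mom) ∈ Set.Icc (-1 : ℝ) 1 := by
  have := abs_real_inner_le_norm v (θ : Mom)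
  rw [hv, norm_sphere, mul_one] at this
  exact abs_le.1 this

lemma continuous_sphere_mul {φ : ℝ → ℝ} (hφ : ContinuousOn φ (Set.Icc (-1) 1)) {v : Mom}
    (hv : ‖v‖ = 1) (P : MvPolynomial (Fin 3) ℂ) :
    Continuous (fun θ : Metric.sphere (0 : Mom) 1 =>
      ((φ (inner ℝ v (θ : Mom)) : ℝ) : ℂ) * polyVal P (θ : Mom)) := by
  refine (Complex.continuous_ofReal.comp ?_).mul
    ((continuous_polyVal P).comp continuous_subtype_val)
  exact hφ.comp_continuous (by fun_prop) fun θ => abs_inner_sphere_le hv θ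

/-- Zonal functions act on the spherical harmonics of a given degree as a scalar. -/
lemma funkHecke_sphere {ℓ : ℕ} {P : MvPolynomial (Fin 3) ℂ} (hP : IsSolidHarmonic ℓ P)
    {v w : Mom} (hv : ‖v‖ = 1) (hw : ‖w‖ = 1) {φ : ℝ → ℝ}
    (hφ : ContinuousOn φ (Set.Icc (-1) 1)) :
    polyVal P w * ∫ θ, ((φ (inner ℝ v (θ : Mom)) : ℝ) : ℂ) * polyVal P (θ : Mom) ∂sphereMeasure =
    polyVal P v *
      ∫ θ, ((φ (inner ℝ w (θ : Mom)) : ℝ) : ℂ) * polyVal P (θ : Mom) ∂sphereMeasure := by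
  -- the powers of `t`
  have hmono : ∀ j : ℕ, ∃ c : ℂ, ∀ v : Mom, ‖v‖ = 1 →
      ∫ θ, (inner ℝ v (θ : Mom) : ℂ) ^ j * polyVal P (θ : Mom) ∂sphereMeasure =
        c * polyVal P v := by
    intro j
    obtain ⟨c, hc⟩ := exists_gaussMoment_linForm_pow_mul j ℓ
    obtain ⟨R, hR⟩ := exists_sphere_integral_eq (j + ℓ)
    refine ⟨R * c, fun v hv => ?_⟩
    have hom : (linForm v ^ j * P).IsHomogeneous (j + ℓ) := by
      simpa using ((isHomogeneous_linForm v).pow j).mul hP.1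
    rw [mul_assoc, ← hc v hv P hP, ← hR _ hom]
    simp [polyVal_pow]
  choose c hc using hmono
  -- the polynomials in `t`
  have hpoly : ∀ (q : Polynomial ℝ) (v : Mom), ‖v‖ = 1 →
      ∫ θ, ((q.eval (inner ℝ v (θ : Mom)) : ℝ) : ℂ) * polyVal P (θ : Mom) ∂sphereMeasure =
        (∑ j ∈ Finset.range (q.natDegree + 1), (q.coeff j : ℂ) * c j) * polyVal P v := by
    intro q v hv
    rw [Finset.sum_mul]
    simp_rw [mul_assoc, ← hc _ v hv, ← integral_const_mul]
    rw [← integral_finsetSum]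
    · refine integral_congr_ae (ae_of_all _ fun θ => ?_)
      simp only [Polynomial.eval_eq_sum_range, Complex.ofReal_sum, Finset.sum_mul]
      push_cast
      exact Finset.sum_congr rfl fun _ _ => by ring
    · intro j _
      refine (integrable_sphere ?_).const_mul _
      have := (continuous_polyVal P).comp
        (continuous_subtype_val (p := fun x => x ∈ Metric.sphere (0 : Mom) 1))
      fun_prop
  -- the general case, by the Weierstrass theorem
  obtain ⟨M, hM⟩ : ∃ M : ℝ, ∀ x ∈ Metric.sphere (0 : Mom) 1, ‖polyVal P x‖ ≤ M :=
    (isCompact_sphere (0 : Mom) 1).exists_bound_of_continuousOn (continuous_polyVal P).continuousOn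
  have hM0 : 0 ≤ M := (norm_nonneg _).trans (hM v (by simpa using hv))
  set A := sphereMeasure.real Set.univ with hA
  set I : (ℝ → ℝ) → Mom → ℂ := fun φ v =>
    ∫ θ, ((φ (inner ℝ v (θ : Mom)) : ℝ) : ℂ) * polyVal P (θ : Mom) ∂sphereMeasure with hI
  have happ : ∀ ε > 0, ∀ q : Polynomial ℝ, (∀ x ∈ Set.Icc (-1 : ℝ) 1, |q.eval x - φ x| < ε) →
      ∀ v : Mom, ‖v‖ = 1 → ‖I φ v - I (fun t => q.eval t) v‖ ≤ ε * M * A := by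
    intro ε hε q hq v hv
    simp only [hI]
    rw [← integral_sub (integrable_sphere (continuous_sphere_mul hφ hv P))
      (integrable_sphere (continuous_sphere_mul q.continuous.continuousOn hv P))]
    refine norm_integral_le_of_norm_le_const (ae_of_all _ fun θ => ?_)
    rw [← sub_mul, norm_mul, ← Complex.ofReal_sub, Complex.norm_real, Real.norm_eq_abs,
      abs_sub_comm]
    exact mul_le_mul (hq _ (abs_inner_sphere_le hv θ)).le (hM _ θ.2) (norm_nonneg _) hε.le
  rw [← sub_eq_zero, ← norm_le_zero_iff]
  refine le_of_forall_pos_le_add fun δ hδ => ?_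
  obtain ⟨q, hq⟩ := exists_polynomial_near_of_continuousOn (-1) 1 φ hφ
    (δ / (2 * M * M * A + 1)) (by positivity)
  set ε := δ / (2 * M * M * A + 1) with hε
  have hε0 : 0 < ε := by positivity
  have e : polyVal P w * I φ v - polyVal P v * I φ w =
      polyVal P w * (I φ v - I (fun t => q.eval t) v) -
        polyVal P v * (I φ w - I (fun t => q.eval t) w) := by
    have h1 := hpoly q v hv
    have h2 := hpoly q w hw
    simp only [hI] at h1 h2 ⊢
    rw [h1, h2]
    ring
  change ‖polyVal P w * I φ v - polyVal P v * I φ w‖ ≤ 0 + δ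
  rw [e]
  have b1 : ‖polyVal P w * (I φ v - I (fun t => q.eval t) v)‖ ≤ M * (ε * M * A) := by
    rw [norm_mul]
    exact mul_le_mul (hM w (by simpa using hw)) (happ ε hε0 q hq v hv) (norm_nonneg _) hM0
  have b2 : ‖polyVal P v * (I φ w - I (fun t => q.eval t) w)‖ ≤ M * (ε * M * A) := by
    rw [norm_mul]
    exact mul_le_mul (hM v (by simpa using hv)) (happ ε hε0 q hq w hw) (norm_nonneg _) hM0
  have b3 : ε * (2 * M * M * A + 1) = δ := by
    exact div_mul_cancel₀ _ (by positivity)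
  refine (norm_sub_le _ _).trans ?_
  nlinarith

/-- The angular factor `Y(p/|p|)` of a solid harmonic. -/
def angular (P : MvPolynomial (Fin 3) ℂ) (p : Mom) : ℂ :=
  MvPolynomial.eval (fun i => ((p i / ‖p‖ : ℝ) : ℂ)) P

lemma angular_smul_sphere (P : MvPolynomial (Fin 3) ℂ) {r : ℝ} (hr : 0 < r) {v : Mom}
    (hv : ‖v‖ = 1) : angular P (r • v) = polyVal P v := by
  unfold angular polyVal
  congr 2
  ext i
  simp [norm_smul, hv, abs_of_pos hr, hr.ne']

/-- Radial functions are orthogonal to the spherical harmonics of positive degree. -/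
lemma integral_radial_mul_angular_eq_zero {ℓ : ℕ} (hℓ : 1 ≤ ℓ) {P : MvPolynomial (Fin 3) ℂ}
    (hP : IsSolidHarmonic ℓ P) {g : ℝ → ℂ} {f : Mom → ℂ}
    (hf : ∀ᵐ p, f p = g ‖p‖ * angular P p) : ∫ p, f p = 0 := by
  obtain ⟨c, hc⟩ := exists_sphere_integral_eq ℓ
  have h0 : ∫ θ, polyVal P (θ : Mom) ∂sphereMeasure = 0 := by
    rw [hc P hP.1, gaussMoment_eq_zero hℓ hP, mul_zero]
  rw [integral_congr_ae hf, integral_polar]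
  calc _ = ∫ z : Metric.sphere (0 : Mom) 1 × Set.Ioi (0 : ℝ), polyVal P z.1 * g z.2
        ∂(sphereMeasure.prod radialMeasure) := by
        refine integral_congr_ae (ae_of_all _ fun z => ?_)
        have hz : ‖((z.2 : ℝ) • (z.1 : Mom))‖ = z.2 := by
          rw [norm_smul, norm_sphere, mul_one, Real.norm_of_nonneg z.2.2.le]
        simp only [hz, angular_smul_sphere P z.2.2 (norm_sphere _)]
        ring
    _ = 0 := by
        rw [integral_prod_mul (fun θ : Metric.sphere (0 : Mom) 1 => polyVal P θ)
          (fun r : Set.Ioi (0 : ℝ) => g r), h0, zero_mul]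

/-- The Funk–Hecke formula: an integral of a function in the sector of `P` against a kernel
depending on `|q|` and `⟨v, q⟩` is proportional to `P(v)`. -/
lemma funkHecke {ℓ : ℕ} {P : MvPolynomial (Fin 3) ℂ} (hP : IsSolidHarmonic ℓ P)
    {v w : Mom} (hv : ‖v‖ = 1) (hw : ‖w‖ = 1) {κ : ℝ → ℝ → ℝ}
    (hκ : ∀ s, 0 < s → ContinuousOn (κ s) (Set.Icc (-1) 1)) {g : ℝ → ℂ} {f : Mom → ℂ}
    (hf : ∀ᵐ p, f p = g ‖p‖ * angular P p)
    (hiv : Integrable fun q => (κ ‖q‖ (inner ℝ v q / ‖q‖) : ℂ) * f q)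
    (hiw : Integrable fun q => (κ ‖q‖ (inner ℝ w q / ‖q‖) : ℂ) * f q) :
    polyVal P w * ∫ q, (κ ‖q‖ (inner ℝ v q / ‖q‖) : ℂ) * f q =
      polyVal P v * ∫ q, (κ ‖q‖ (inner ℝ w q / ‖q‖) : ℂ) * f q := by
  set F : Mom → ℂ := fun q => (polyVal P w * (κ ‖q‖ (inner ℝ v q / ‖q‖) : ℂ) -
    polyVal P v * (κ ‖q‖ (inner ℝ w q / ‖q‖) : ℂ)) * (g ‖q‖ * angular P q) with hF
  have hFi : Integrable F := by
    refine ((hiv.const_mul (polyVal P w)).sub (hiw.const_mul (polyVal P v))).congr ?_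
    filter_upwards [hf] with q hq
    simp only [hF, hq, Pi.sub_apply]
    ring
  rw [← sub_eq_zero, ← integral_const_mul, ← integral_const_mul,
    ← integral_sub (hiv.const_mul _) (hiw.const_mul _)]
  calc _ = ∫ q, F q := by
        refine integral_congr_ae ?_
        filter_upwards [hf] with q hq
        simp only [hF, hq]
        ring
    _ = 0 := by
        rw [integral_polar, integral_prod_symm _ (integrable_polar hFi)]
        refine integral_eq_zero_of_ae (ae_of_all _ fun r => ?_)
        have hr : (0 : ℝ) < r := r.2
        have e : ∀ θ : Metric.sphere (0 : Mom) 1, F ((r : ℝ) • (θ : Mom)) =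
            g r * (polyVal P w * ((κ r (inner ℝ v (θ : Mom)) : ℂ) * polyVal P (θ : Mom)) -
              polyVal P v * ((κ r (inner ℝ w (θ : Mom)) : ℂ) * polyVal P (θ : Mom))) := by
          intro θ
          have hz : ‖((r : ℝ) • (θ : Mom))‖ = r := by
            rw [norm_smul, norm_sphere, mul_one, Real.norm_of_nonneg hr.le]
          simp only [hF, hz, angular_smul_sphere P hr (norm_sphere _), inner_smul_right,
            mul_div_cancel_left₀ _ hr.ne']
          ring
        have i1 := integrable_sphere (continuous_sphere_mul (hκ r hr) hv P)
        have i2 := integrable_sphere (continuous_sphere_mul (hκ r hr) hw P)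
        simp only [e, Pi.zero_apply]
        rw [integral_const_mul, integral_sub (i1.const_mul _) (i2.const_mul _),
          integral_const_mul, integral_const_mul, funkHecke_sphere hP hv hw (hκ r hr), sub_self,
          mul_zero]

/-! ### Weighted `L²` spaces and the Schur test -/

/-- The measure `τ` is `B(p) dp`, with `B` a strictly positive function. -/
structure HasWeight (τ : Measure Mom) (B : Mom → ℝ) : Prop where
  measurable : Measurable B
  pos : ∀ p, 0 < B p
  eq : τ = volume.withDensity fun p => ENNReal.ofReal (B p)

namespace HasWeight

variable {τ : Measure Mom} {B : Mom → ℝ}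

lemma ae_eq (h : HasWeight τ B) : ae τ = ae (volume : Measure Mom) := by
  have hm : Measurable fun p => ENNReal.ofReal (B p) := h.measurable.ennreal_ofReal
  rw [h.eq]
  exact le_antisymm (withDensity_absolutelyContinuous _ _).ae_le
    (withDensity_absolutelyContinuous' hm.aemeasurable
      (ae_of_all _ fun p => by simpa using h.pos p)).ae_le

lemma ae_iff (h : HasWeight τ B) {φ : Mom → Prop} : (∀ᵐ p ∂τ, φ p) ↔ ∀ᵐ p, φ p := by
  unfold Filter.Eventually
  rw [h.ae_eq]

lemma aestronglyMeasurable_iff (h : HasWeight τ B) {f : Mom → ℂ} :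
    AEStronglyMeasurable f τ ↔ AEStronglyMeasurable f volume :=
  ⟨fun ⟨g, hg, hfg⟩ => ⟨g, hg, h.ae_iff.1 hfg⟩, fun ⟨g, hg, hfg⟩ => ⟨g, hg, h.ae_iff.2 hfg⟩⟩

lemma eLpNorm_sq (h : HasWeight τ B) (f : Mom → ℂ) :
    eLpNorm f 2 τ ^ 2 = ∫⁻ p, ENNReal.ofReal (B p) * ‖f p‖ₑ ^ 2 := by
  have h2 : eLpNorm f 2 τ = (∫⁻ p, ‖f p‖ₑ ^ (2 : ℝ) ∂τ) ^ (1 / (2 : ℝ)) := by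
    rw [eLpNorm_eq_lintegral_rpow_enorm_toReal two_ne_zero ENNReal.ofNat_ne_top]
    simp
  rw [h2, ← ENNReal.rpow_natCast, ← ENNReal.rpow_mul, h.eq,
    lintegral_withDensity_eq_lintegral_mul_non_measurable _ h.measurable.ennreal_ofReal
      (ae_of_all _ fun p => ENNReal.ofReal_lt_top)]
  simp

lemma memLp_iff (h : HasWeight τ B) {f : Mom → ℂ} : MemLp f 2 τ ↔
    AEStronglyMeasurable f volume ∧ ∫⁻ p, ENNReal.ofReal (B p) * ‖f p‖ₑ ^ 2 < ∞ := by
  rw [← h.eLpNorm_sq, MemLp, h.aestronglyMeasurable_iff]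
  simp [ENNReal.pow_lt_top_iff]

lemma lintegral_lt_top (h : HasWeight τ B) (f : Lp ℂ 2 τ) :
    ∫⁻ p, ENNReal.ofReal (B p) * ‖f p‖ₑ ^ 2 < ∞ :=
  (h.memLp_iff.1 (Lp.memLp f)).2

lemma aemeasurable_enorm (h : HasWeight τ B) (f : Lp ℂ 2 τ) :
    AEMeasurable (fun p => ‖f p‖ₑ) (volume : Measure Mom) :=
  (h.memLp_iff.1 (Lp.memLp f)).1.enorm

lemma coeFn_toLp (h : HasWeight τ B) {f : Mom → ℂ} (hf : MemLp f 2 τ) :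
    ∀ᵐ p, hf.toLp f p = f p := h.ae_iff.1 hf.coeFn_toLp

lemma coeFn_add (h : HasWeight τ B) (f g : Lp ℂ 2 τ) : ∀ᵐ p, (f + g) p = f p + g p :=
  h.ae_iff.1 (Lp.coeFn_add f g)

lemma coeFn_sub (h : HasWeight τ B) (f g : Lp ℂ 2 τ) : ∀ᵐ p, (f - g) p = f p - g p :=
  h.ae_iff.1 (Lp.coeFn_sub f g)

lemma coeFn_smul (h : HasWeight τ B) (c : ℂ) (f : Lp ℂ 2 τ) : ∀ᵐ p, (c • f) p = c * f p :=
  h.ae_iff.1 (Lp.coeFn_smul c f)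

lemma coeFn_zero (h : HasWeight τ B) : ∀ᵐ p, (0 : Lp ℂ 2 τ) p = 0 :=
  h.ae_iff.1 (Lp.coeFn_zero ℂ 2 τ)

lemma ext (h : HasWeight τ B) {f g : Lp ℂ 2 τ} (hfg : ∀ᵐ p, f p = g p) : f = g :=
  Lp.ext (h.ae_iff.2 hfg)

end HasWeight

/-- The Cauchy–Schwarz inequality for lower Lebesgue integrals. -/
lemma lintegral_mul_sq_le {f g : Mom → ℝ≥0∞} (hf : AEMeasurable f) (hg : AEMeasurable g) :
    (∫⁻ p, f p * g p) ^ 2 ≤ (∫⁻ p, f p ^ 2) * ∫⁻ p, g p ^ 2 := by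
  have := ENNReal.lintegral_mul_norm_pow_le (μ := (volume : Measure Mom)) (hf.pow_const 2)
    (hg.pow_const 2) (p := 1 / 2) (q := 1 / 2) (by norm_num) (by norm_num) (by norm_num)
  have e : ∀ x : ℝ≥0∞, (x ^ 2) ^ (1 / 2 : ℝ) = x := fun x => by
    rw [← ENNReal.rpow_natCast, ← ENNReal.rpow_mul]; simp
  have e' : ∀ x : ℝ≥0∞, (x ^ (1 / 2 : ℝ)) ^ 2 = x := fun x => by
    rw [← ENNReal.rpow_natCast, ← ENNReal.rpow_mul]; simp
  simp only [e] at this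
  calc _ ≤ _ := pow_le_pow_left' this 2
    _ = _ := by rw [mul_pow, e', e']

/-- A function in `L²(B dp)` is integrable against `X` when `X² / B` is integrable. -/
lemma HasWeight.integrable_mul {τ : Measure Mom} {B : Mom → ℝ} (h : HasWeight τ B) {f : Mom → ℂ}
    (hf : MemLp f 2 τ) {X : Mom → ℝ} (hX : Measurable X)
    (hXB : Integrable fun q => X q ^ 2 / B q) : Integrable fun q => (X q : ℂ) * f q := by
  obtain ⟨h1, h2⟩ := h.memLp_iff.1 hf
  have hf2 : Integrable fun q => B q * ‖f q‖ ^ 2 := by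
    refine ⟨h.measurable.aestronglyMeasurable.mul (h1.norm.pow 2), ?_⟩
    refine lt_of_eq_of_lt (lintegral_congr fun q => ?_) h2
    rw [enorm_mul, Real.enorm_of_nonneg (h.pos q).le, enorm_pow, enorm_norm]
  refine (hf2.add hXB).mono' ((Complex.measurable_ofReal.comp hX).aestronglyMeasurable.mul h1)
    (ae_of_all _ fun q => ?_)
  have hB := h.pos q
  rw [norm_mul, Complex.norm_real, Real.norm_eq_abs]
  have e : X q ^ 2 / B q = B q * (|X q| / B q) ^ 2 := by
    rw [div_pow, sq_abs]; field_simp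
  have e' : |X q| * ‖f q‖ = B q * ((|X q| / B q) * ‖f q‖) := by field_simp
  simp only [Pi.add_apply]
  rw [e, e', ← mul_add]
  have : 0 ≤ |X q| / B q := by positivity
  gcongr
  nlinarith [sq_nonneg (‖f q‖ - |X q| / B q), norm_nonneg (f q), sq_nonneg (‖f q‖),
    sq_nonneg (|X q| / B q)]

/-- A real kernel defining a bounded operator from `L²(B dq)` to `L²(A dp)`, with bound `C`; the
integral is taken with respect to Lebesgue measure. -/
structure IsBoundedKernel (k : Mom → Mom → ℝ) (B A : Mom → ℝ) (C : ℝ) : Prop where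
  measurable : Measurable (Function.uncurry k)
  nonneg : 0 ≤ C
  bound : ∀ f : Mom → ℝ≥0∞, AEMeasurable f →
    ∫⁻ p, ENNReal.ofReal (A p) * (∫⁻ q, ENNReal.ofReal |k p q| * f q) ^ 2 ≤
      ENNReal.ofReal C ^ 2 * ∫⁻ q, ENNReal.ofReal (B q) * f q ^ 2

/-- The Schur test with comparison functions `h` and `h'`. -/
lemma isBoundedKernel_of_schur {k : Mom → Mom → ℝ} (hk : Measurable (Function.uncurry k))
    {A B h h' : Mom → ℝ} (hA : Measurable A) (hh : Measurable h) (hh' : Measurable h')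
    (hpos : ∀ q, 0 < h q) (hA0 : ∀ q, 0 ≤ A q) {C : ℝ} (hC : 0 ≤ C)
    (h1 : ∀ p, ∫⁻ q, ENNReal.ofReal (|k p q| * h q) ≤ ENNReal.ofReal (C * h' p))
    (h2 : ∀ q, ∫⁻ p, ENNReal.ofReal (|k p q| * (A p * h' p)) ≤ ENNReal.ofReal (C * (B q * h q))) :
    IsBoundedKernel k B A C := by
  refine ⟨hk, hC, fun f hf => ?_⟩
  set κ : Mom → Mom → ℝ≥0∞ := fun p q => ENNReal.ofReal |k p q| with hκ
  have hκm : Measurable (Function.uncurry κ) := by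
    exact (measurable_norm.comp hk).ennreal_ofReal
  have hκp : ∀ p, Measurable (κ p) := fun p => hκm.comp measurable_prodMk_left
  set H : Mom → ℝ≥0∞ := fun q => ENNReal.ofReal (h q) with hH
  have hHm : Measurable H := hh.ennreal_ofReal
  have hH0 : ∀ q, H q ≠ 0 := fun q => by simpa [hH] using hpos q
  have hHt : ∀ q, H q ≠ ∞ := fun q => ENNReal.ofReal_ne_top
  have hFm : ∀ p, AEMeasurable fun q => κ p q * (f q ^ 2 / H q) := fun p =>
    (hκp p).aemeasurable.mul ((hf.pow_const 2).div hHm.aemeasurable)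
  have cs : ∀ p, (∫⁻ q, κ p q * f q) ^ 2 ≤
      ENNReal.ofReal (C * h' p) * ∫⁻ q, κ p q * (f q ^ 2 / H q) := by
    intro p
    have hs : ∀ x : ℝ≥0∞, (x ^ (1 / 2 : ℝ)) ^ 2 = x := fun x => by
      rw [← ENNReal.rpow_natCast, ← ENNReal.rpow_mul]; simp
    have hs' : ∀ x : ℝ≥0∞, (x ^ 2) ^ (1 / 2 : ℝ) = x := fun x => by
      rw [← ENNReal.rpow_natCast, ← ENNReal.rpow_mul]; simp
    have := lintegral_mul_sq_le (f := fun q => (κ p q * H q) ^ (1 / 2 : ℝ))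
      (g := fun q => (κ p q * (f q ^ 2 / H q)) ^ (1 / 2 : ℝ))
      (((hκp p).mul hHm).pow_const _).aemeasurable
      ((hFm p).pow_const _)
    simp only [hs] at this
    refine (le_of_eq ?_).trans (this.trans ?_)
    · congr 1
      refine lintegral_congr fun q => ?_
      rw [← ENNReal.mul_rpow_of_nonneg _ _ (by norm_num)]
      have : κ p q * H q * (κ p q * (f q ^ 2 / H q)) = (κ p q * f q) ^ 2 := by
        calc _ = (κ p q * f q) ^ 2 * (H q * (H q)⁻¹) := by rw [div_eq_mul_inv]; ring
          _ = _ := by rw [ENNReal.mul_inv_cancel (hH0 q) (hHt q), mul_one]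
      rw [this, hs']
    · gcongr
      refine (le_of_eq (lintegral_congr fun q => ?_)).trans (h1 p)
      rw [← ENNReal.ofReal_mul (abs_nonneg _)]
  calc ∫⁻ p, ENNReal.ofReal (A p) * (∫⁻ q, κ p q * f q) ^ 2
      ≤ ∫⁻ p, ENNReal.ofReal (A p) *
          (ENNReal.ofReal (C * h' p) * ∫⁻ q, κ p q * (f q ^ 2 / H q)) := by
        gcongr with p
        exact cs p
    _ = ∫⁻ p, ∫⁻ q, ENNReal.ofReal C *
          (ENNReal.ofReal (|k p q| * (A p * h' p)) * (f q ^ 2 / H q)) := by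
        refine lintegral_congr fun p => ?_
        rw [← lintegral_const_mul'' _ (hFm p), ← lintegral_const_mul'' _ ((hFm p).const_mul _)]
        refine lintegral_congr fun q => ?_
        rw [ENNReal.ofReal_mul hC, ENNReal.ofReal_mul (abs_nonneg _), ENNReal.ofReal_mul (hA0 p)]
        ring
    _ = ∫⁻ q, ∫⁻ p, ENNReal.ofReal C *
          (ENNReal.ofReal (|k p q| * (A p * h' p)) * (f q ^ 2 / H q)) := by
        refine lintegral_lintegral_swap ?_
        have m1 : Measurable fun z : Mom × Mom => ENNReal.ofReal (|k z.1 z.2| * (A z.1 * h' z.1)) :=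
          ((measurable_norm.comp hk).mul ((hA.mul hh').comp measurable_fst)).ennreal_ofReal
        have m2 : AEMeasurable (fun z : Mom × Mom => f z.2 ^ 2 / H z.2) (volume.prod volume) :=
          ((hf.pow_const 2).div hHm.aemeasurable).comp_snd
        exact (m1.aemeasurable.mul m2).const_mul _
    _ ≤ ∫⁻ q, ENNReal.ofReal C * (ENNReal.ofReal (C * (B q * h q)) * (f q ^ 2 / H q)) := by
        refine lintegral_mono fun q => ?_
        have m1 : Measurable fun p : Mom => ENNReal.ofReal (|k p q| * (A p * h' p)) :=
          ((measurable_norm.comp (hk.comp measurable_prodMk_right)).mul (hA.mul hh')).ennreal_ofReal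
        rw [lintegral_const_mul _ (m1.mul_const _), lintegral_mul_const _ m1]
        gcongr
        exact h2 q
    _ = ∫⁻ q, ENNReal.ofReal C ^ 2 * (ENNReal.ofReal (B q) * f q ^ 2) := by
        refine lintegral_congr fun q => ?_
        rw [ENNReal.ofReal_mul hC, mul_comm (B q), ENNReal.ofReal_mul (hpos q).le]
        calc _ = ENNReal.ofReal C ^ 2 * (ENNReal.ofReal (B q) * f q ^ 2) * (H q * (H q)⁻¹) := by
              rw [div_eq_mul_inv]; ring
          _ = _ := by rw [ENNReal.mul_inv_cancel (hH0 q) (hHt q), mul_one]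
    _ = _ := lintegral_const_mul' _ _ (by finiteness)

/-- The function `p ↦ ∫ k(p, q) f(q) dq`. -/
def kernelInt (k : Mom → Mom → ℝ) (f : Mom → ℂ) (p : Mom) : ℂ := ∫ q, (k p q : ℂ) * f q

/-- An operator between weighted spaces given by an almost everywhere defined linear expression
together with a bound. -/
lemma exists_clm_of_bound {τ υ : Measure Mom} {A B : Mom → ℝ} (hτ : HasWeight τ B)
    (hυ : HasWeight υ A) (T : (Mom → ℂ) → Mom → ℂ) (C : ℝ) (hC : 0 ≤ C)
    (hmeas : ∀ f : Lp ℂ 2 τ, AEStronglyMeasurable (T f) volume)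
    (hcongr : ∀ f g : Mom → ℂ, (∀ᵐ p, f p = g p) → ∀ᵐ p, T f p = T g p)
    (hadd : ∀ f g : Lp ℂ 2 τ, ∀ᵐ p, T (fun p => f p + g p) p = T f p + T g p)
    (hsmul : ∀ (c : ℂ) (f : Mom → ℂ), ∀ᵐ p, T (fun p => c * f p) p = c * T f p)
    (hbd : ∀ f : Lp ℂ 2 τ, ∫⁻ p, ENNReal.ofReal (A p) * ‖T f p‖ₑ ^ 2 ≤
      ENNReal.ofReal C ^ 2 * ∫⁻ q, ENNReal.ofReal (B q) * ‖f q‖ₑ ^ 2) :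
    ∃ K : Lp ℂ 2 τ →L[ℂ] Lp ℂ 2 υ, (∀ f, ∀ᵐ p, K f p = T f p) ∧ ‖K‖ ≤ C := by
  have hmem : ∀ f : Lp ℂ 2 τ, MemLp (T f) 2 υ := fun f => hυ.memLp_iff.2
    ⟨hmeas f, (hbd f).trans_lt (ENNReal.mul_lt_top (by finiteness) (hτ.lintegral_lt_top f))⟩
  let K : Lp ℂ 2 τ →ₗ[ℂ] Lp ℂ 2 υ :=
    { toFun := fun f => (hmem f).toLp (T f)
      map_add' := fun f g => by
        refine hυ.ext ?_
        filter_upwards [hυ.coeFn_toLp (hmem f), hυ.coeFn_toLp (hmem g),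
          hυ.coeFn_toLp (hmem (f + g)),
          hυ.coeFn_add ((hmem f).toLp (T f)) ((hmem g).toLp (T g)), hadd f g,
          hcongr _ _ (hτ.coeFn_add f g)] with p h1 h2 h3 h4 h5 h6
        rw [h3, h4, h1, h2, h6, h5]
      map_smul' := fun c f => by
        refine hυ.ext ?_
        filter_upwards [hυ.coeFn_toLp (hmem f), hυ.coeFn_toLp (hmem (c • f)),
          hυ.coeFn_smul c ((hmem f).toLp (T f)), hsmul c f,
          hcongr _ _ (hτ.coeFn_smul c f)] with p h1 h2 h3 h4 h5
        rw [h2, RingHom.id_apply, h3, h1, h5, h4] }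
  have hK : ∀ f, ‖K f‖ ≤ C * ‖f‖ := by
    intro f
    change ‖(hmem f).toLp (T f)‖ ≤ _
    rw [Lp.norm_toLp, Lp.norm_def, ← ENNReal.toReal_ofReal hC, ← ENNReal.toReal_mul]
    refine ENNReal.toReal_mono (ENNReal.mul_ne_top (by finiteness) (Lp.eLpNorm_ne_top f)) ?_
    rw [← ENNReal.pow_le_pow_left_iff two_ne_zero, mul_pow, hυ.eLpNorm_sq, hτ.eLpNorm_sq]
    exact hbd f
  exact ⟨K.mkContinuous C hK, fun f => hυ.coeFn_toLp (hmem f), K.mkContinuous_norm_le hC hK⟩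

namespace IsBoundedKernel

variable {k : Mom → Mom → ℝ} {A B : Mom → ℝ} {C : ℝ} {τ υ : Measure Mom}

lemma lintegral_lt_top (hk : IsBoundedKernel k B A C) (hτ : HasWeight τ B) (f : Lp ℂ 2 τ) :
    ∫⁻ p, ENNReal.ofReal (A p) * (∫⁻ q, ENNReal.ofReal |k p q| * ‖f q‖ₑ) ^ 2 < ∞ :=
  (hk.bound _ (hτ.aemeasurable_enorm f)).trans_lt
    (ENNReal.mul_lt_top (by finiteness) (hτ.lintegral_lt_top f))

lemma aemeasurable_lintegral (hk : IsBoundedKernel k B A C) {f : Mom → ℝ≥0∞} (hf : AEMeasurable f) :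
    AEMeasurable fun p => ∫⁻ q, ENNReal.ofReal |k p q| * f q := by
  have m1 : Measurable fun z : Mom × Mom => ENNReal.ofReal |k z.1 z.2| :=
    (measurable_norm.comp hk.measurable).ennreal_ofReal
  exact (m1.aemeasurable.mul hf.comp_snd).lintegral_prod_right'

lemma aestronglyMeasurable_mul (hk : IsBoundedKernel k B A C) (hτ : HasWeight τ B) (f : Lp ℂ 2 τ)
    (p : Mom) : AEStronglyMeasurable (fun q => (k p q : ℂ) * f q) volume :=
  (Complex.measurable_ofReal.comp
    (hk.measurable.comp measurable_prodMk_left)).aestronglyMeasurable.mul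
    (hτ.aestronglyMeasurable_iff.1 (Lp.aestronglyMeasurable f))

lemma ae_integrable (hk : IsBoundedKernel k B A C) (hτ : HasWeight τ B) (hυ : HasWeight υ A)
    (f : Lp ℂ 2 τ) : ∀ᵐ p, Integrable fun q => (k p q : ℂ) * f q := by
  have hm := hk.aemeasurable_lintegral (hτ.aemeasurable_enorm f)
  have := ae_lt_top' ((hυ.measurable.ennreal_ofReal.aemeasurable).mul (hm.pow_const 2))
    (hk.lintegral_lt_top hτ f).ne
  filter_upwards [this] with p hp
  refine ⟨hk.aestronglyMeasurable_mul hτ f p, ?_⟩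
  have hA : ENNReal.ofReal (A p) ≠ 0 := by simpa using hυ.pos p
  have h2 : (∫⁻ q, ENNReal.ofReal |k p q| * ‖f q‖ₑ) ^ 2 < ∞ := by
    by_contra hcon
    rw [not_lt, top_le_iff] at hcon
    simp only [Pi.mul_apply] at hp
    rw [hcon, ENNReal.mul_top hA] at hp
    exact lt_irrefl _ hp
  have h3 : ∫⁻ q, ENNReal.ofReal |k p q| * ‖f q‖ₑ < ∞ := by
    simpa [ENNReal.pow_lt_top_iff] using h2
  refine lt_of_eq_of_lt (lintegral_congr fun q => ?_) h3
  rw [enorm_mul, ← Real.norm_eq_abs, ofReal_norm, ← ofReal_norm (k p q),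
    ← ofReal_norm (k p q : ℂ), Complex.norm_real]

/-- The bounded operator defined by a kernel. -/
lemma exists_clm (hk : IsBoundedKernel k B A C) (hτ : HasWeight τ B) (hυ : HasWeight υ A) :
    ∃ K : Lp ℂ 2 τ →L[ℂ] Lp ℂ 2 υ, (∀ f, ∀ᵐ p, K f p = kernelInt k f p) ∧ ‖K‖ ≤ C := by
  refine exists_clm_of_bound hτ hυ (kernelInt k) C hk.nonneg ?_ ?_ ?_ ?_ ?_
  · intro f
    have h1 : AEStronglyMeasurable (fun z : Mom × Mom => (k z.1 z.2 : ℂ) * f z.2)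
        (volume.prod volume) :=
      (Complex.measurable_ofReal.comp hk.measurable).aestronglyMeasurable.mul
        (hτ.aestronglyMeasurable_iff.1 (Lp.aestronglyMeasurable f)).comp_snd
    exact h1.integral_prod_right'
  · intro f g hfg
    refine ae_of_all _ fun p => integral_congr_ae ?_
    filter_upwards [hfg] with q hq
    rw [hq]
  · intro f g
    filter_upwards [hk.ae_integrable hτ hυ f, hk.ae_integrable hτ hυ g] with p h1 h2
    unfold kernelInt
    rw [← integral_add h1 h2]
    simp only [mul_add]
  · intro c f
    refine ae_of_all _ fun p => ?_
    unfold kernelInt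
    rw [← integral_const_mul]
    exact integral_congr_ae (ae_of_all _ fun q => by ring)
  · intro f
    refine le_trans (lintegral_mono fun p => ?_) (hk.bound _ (hτ.aemeasurable_enorm f))
    gcongr
    refine (enorm_integral_le_lintegral_enorm _).trans (le_of_eq (lintegral_congr fun q => ?_))
    rw [enorm_mul, ← ofReal_norm (k p q : ℂ), Complex.norm_real, Real.norm_eq_abs]

end IsBoundedKernel

/-- Multiplication by a real function as a bounded operator between weighted spaces. -/
lemma exists_mul_clm {τ υ : Measure Mom} {A B : Mom → ℝ} (hτ : HasWeight τ B) (hυ : HasWeight υ A)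
    {φ : Mom → ℝ} (hφ : Measurable φ) {C : ℝ} (hC : 0 ≤ C)
    (h : ∀ p, A p * φ p ^ 2 ≤ C ^ 2 * B p) :
    ∃ K : Lp ℂ 2 τ →L[ℂ] Lp ℂ 2 υ, (∀ f, ∀ᵐ p, K f p = (φ p : ℂ) * f p) ∧ ‖K‖ ≤ C := by
  refine exists_clm_of_bound hτ hυ (fun f p => (φ p : ℂ) * f p) C hC ?_ ?_ ?_ ?_ ?_
  · intro f
    exact (Complex.measurable_ofReal.comp hφ).aestronglyMeasurable.mul
      (hτ.aestronglyMeasurable_iff.1 (Lp.aestronglyMeasurable f))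
  · intro f g hfg
    filter_upwards [hfg] with p hp
    rw [hp]
  · exact fun f g => ae_of_all _ fun p => by ring
  · exact fun c f => ae_of_all _ fun p => by ring
  · intro f
    rw [← lintegral_const_mul' _ _ (by finiteness)]
    refine lintegral_mono fun p => ?_
    rw [enorm_mul, mul_pow, ← mul_assoc, ← mul_assoc]
    refine mul_le_mul' ?_ le_rfl
    rw [← ofReal_norm, Complex.norm_real, Real.norm_eq_abs, ← ENNReal.ofReal_pow (abs_nonneg _),
      sq_abs, ← ENNReal.ofReal_pow hC, ← ENNReal.ofReal_mul (hυ.pos p).le,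
      ← ENNReal.ofReal_mul (by positivity)]
    exact ENNReal.ofReal_le_ofReal (h p)

/-! ### Angular sectors -/

section AngularSpace

variable {τ υ : Measure Mom} {A B : Mom → ℝ}

/-- The functions `g(|p|) P(p/|p|)` in a weighted space, for a fixed polynomial `P`. -/
def angularSpace (h : HasWeight τ B) (P : MvPolynomial (Fin 3) ℂ) : Submodule ℂ (Lp ℂ 2 τ) where
  carrier := {f | ∃ g : ℝ → ℂ, Measurable g ∧ ∀ᵐ p : Mom, f p = g ‖p‖ * angular P p}
  add_mem' := by
    rintro f f' ⟨g, hg, hf⟩ ⟨g', hg', hf'⟩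
    refine ⟨g + g', hg.add hg', ?_⟩
    filter_upwards [hf, hf', h.coeFn_add f f'] with p h1 h2 h3
    rw [h3, h1, h2, Pi.add_apply, add_mul]
  zero_mem' := by
    refine ⟨0, measurable_const, ?_⟩
    filter_upwards [h.coeFn_zero] with p h1
    rw [h1, Pi.zero_apply, zero_mul]
  smul_mem' := by
    rintro c f ⟨g, hg, hf⟩
    refine ⟨fun r => c * g r, hg.const_mul c, ?_⟩
    filter_upwards [hf, h.coeFn_smul c f] with p h1 h2
    rw [h2, h1, mul_assoc]

lemma isClosed_angularSpace (h : HasWeight τ B) (P : MvPolynomial (Fin 3) ℂ) :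
    IsClosed (angularSpace h P : Set (Lp ℂ 2 τ)) := by
  refine IsSeqClosed.isClosed fun u f hu huf => ?_
  obtain ⟨ns, -, hns⟩ := (tendstoInMeasure_of_tendsto_Lp huf).exists_seq_tendsto_ae
  choose g hg hgu using hu
  refine ⟨fun r => limUnder atTop fun i => g (ns i) r,
    (StronglyMeasurable.limUnder fun i => (hg (ns i)).stronglyMeasurable).measurable, ?_⟩
  filter_upwards [h.ae_iff.1 hns, ae_all_iff.2 hgu] with p h1 h2
  simp only [h2] at h1
  -- where the angular factor vanishes, the limit of the radial parts may be a junk value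
  by_cases h0 : angular P p = 0
  · simp only [h0, mul_zero] at h1 ⊢
    exact tendsto_nhds_unique h1 tendsto_const_nhds
  · have h3 : Tendsto (fun i => g (ns i) ‖p‖) atTop (𝓝 (f p / angular P p)) := by
      simpa [h0] using h1.div_const (angular P p)
    rw [h3.limUnder_eq, div_mul_cancel₀ _ h0]

/-- Multiplication by a radial function preserves the angular dependence. -/
lemma mul_mem_angularSpace (h : HasWeight τ B) (h' : HasWeight υ A)
    {P : MvPolynomial (Fin 3) ℂ} {φ : Mom → ℝ} {w : ℝ → ℝ} (hw : Measurable w)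
    (hφ : ∀ p, φ p = w ‖p‖) {f : Lp ℂ 2 τ} (hf : f ∈ angularSpace h P) {f' : Lp ℂ 2 υ}
    (hff' : ∀ᵐ p, f' p = (φ p : ℂ) * f p) :
    f' ∈ angularSpace h' P := by
  obtain ⟨g, hg, hfg⟩ := hf
  refine ⟨fun r => (w r : ℂ) * g r, (Complex.measurable_ofReal.comp hw).mul hg, ?_⟩
  filter_upwards [hfg, hff'] with p h1 h2
  rw [h2, h1, hφ, mul_assoc]

/-- The kernel is a function of `|p|`, `|q|` and `⟨p, q⟩`, continuous in the last variable. -/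
def IsZonal (k : Mom → Mom → ℝ) : Prop :=
  ∃ F : ℝ → ℝ → ℝ → ℝ,
    (∀ r s, 0 < r → 0 < s → ContinuousOn (F r s) (Set.Icc (-(r * s)) (r * s))) ∧
    ∀ p q, k p q = F ‖p‖ ‖q‖ (inner ℝ p q)

/-- Integral operators with a zonal kernel preserve the angular dependence, by the Funk–Hecke
formula. -/
lemma kernelInt_mem_angularSpace (h : HasWeight τ B) (h' : HasWeight υ A)
    {k : Mom → Mom → ℝ} (hkm : Measurable (Function.uncurry k)) (hk : IsZonal k)
    (hint : ∀ (f : Lp ℂ 2 τ) p, Integrable fun q => (k p q : ℂ) * f q)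
    {ℓ : ℕ} {P : MvPolynomial (Fin 3) ℂ} (hP : IsSolidHarmonic ℓ P) {f : Lp ℂ 2 τ}
    (hf : f ∈ angularSpace h P) {f' : Lp ℂ 2 υ} (hff' : ∀ᵐ p, f' p = kernelInt k f p) :
    f' ∈ angularSpace h' P := by
  obtain ⟨g, hg, hfg⟩ := hf
  have hae : ∀ᵐ p : Mom, p ≠ 0 := by
    simp [ae_iff, measure_singleton]
  have hpol : ∀ p : Mom, p ≠ 0 → angular P p = polyVal P (‖p‖⁻¹ • p) ∧ ‖‖p‖⁻¹ • p‖ = 1 := by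
    intro p hp
    have hn : 0 < ‖p‖ := norm_pos_iff.2 hp
    have h1 : ‖‖p‖⁻¹ • p‖ = 1 := by rw [norm_smul, norm_inv, norm_norm, inv_mul_cancel₀ hn.ne']
    refine ⟨?_, h1⟩
    have := angular_smul_sphere P hn h1
    rwa [smul_smul, mul_inv_cancel₀ hn.ne', one_smul] at this
  by_cases hex : ∃ w : Mom, ‖w‖ = 1 ∧ polyVal P w ≠ 0
  · obtain ⟨w, hw, hPw⟩ := hex
    have hKm : StronglyMeasurable (kernelInt k f) := by
      have : StronglyMeasurable fun z : Mom × Mom => (k z.1 z.2 : ℂ) * f z.2 :=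
        (Complex.measurable_ofReal.comp hkm).stronglyMeasurable.mul
          ((Lp.stronglyMeasurable f).comp_measurable measurable_snd)
      exact this.integral_prod_right'
    refine ⟨fun r => kernelInt k f (r • w) / polyVal P w,
      (hKm.measurable.comp (by fun_prop)).div_const _, ?_⟩
    filter_upwards [hff', hae] with p h1 hp
    obtain ⟨F, hF, hkF⟩ := hk
    obtain ⟨hang, hv⟩ := hpol p hp
    have hn : 0 < ‖p‖ := norm_pos_iff.2 hp
    set v := ‖p‖⁻¹ • p with hvdef
    have hpv : ‖p‖ • v = p := by rw [hvdef, smul_smul, mul_inv_cancel₀ hn.ne', one_smul]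
    set κ : ℝ → ℝ → ℝ := fun s t => F ‖p‖ s (‖p‖ * s * t) with hκ
    have hκc : ∀ s, 0 < s → ContinuousOn (κ s) (Set.Icc (-1) 1) := by
      intro s hs
      refine (hF ‖p‖ s hn hs).comp (by fun_prop) fun t ht => ?_
      have : 0 < ‖p‖ * s := by positivity
      constructor <;> nlinarith [ht.1, ht.2]
    have hkκ : ∀ u : Mom, ‖u‖ = 1 → ∀ q, k (‖p‖ • u) q = κ ‖q‖ (inner ℝ u q / ‖q‖) := by
      intro u hu q
      rw [hkF, hκ, norm_smul, hu, mul_one, norm_norm, inner_smul_left]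
      by_cases hq : q = 0
      · simp [hq]
      · have : ‖q‖ ≠ 0 := norm_ne_zero_iff.2 hq
        simp only [conj_trivial]
        congr 1
        field_simp
    have e1 : ∀ u : Mom, ‖u‖ = 1 →
        (fun q => (κ ‖q‖ (inner ℝ u q / ‖q‖) : ℂ) * f q) = fun q => (k (‖p‖ • u) q : ℂ) * f q := by
      intro u hu
      ext q
      rw [hkκ u hu]
    have key := funkHecke hP hv hw hκc hfg (by rw [e1 v hv]; exact hint f _)
      (by rw [e1 w hw]; exact hint f _)
    rw [e1 v hv, e1 w hw, hpv] at key
    rw [h1, hang, div_mul_eq_mul_div, eq_div_iff hPw, mul_comm]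
    exact key.trans (mul_comm _ _)
  · push Not at hex
    refine ⟨0, measurable_const, ?_⟩
    have hf0 : ∀ᵐ q, f q = 0 := by
      filter_upwards [hfg, hae] with q h1 hq
      rw [h1, (hpol q hq).1, hex _ (hpol q hq).2, mul_zero]
    filter_upwards [hff'] with p h1
    rw [h1]
    have : kernelInt k f p = 0 := by
      refine integral_eq_zero_of_ae ?_
      filter_upwards [hf0] with q hq
      simp [hq]
    simp [this]

end AngularSpace

/-- The weight `(1 + p²)^s` of the Sobolev space `H^s`. -/
def bracket (s : ℝ) (p : Mom) : ℝ := (1 + ‖p‖ ^ 2) ^ s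

lemma one_le_bracket_base (p : Mom) : 1 ≤ 1 + ‖p‖ ^ 2 := by
  have : 0 ≤ ‖p‖ ^ 2 := by positivity
  linarith

lemma continuous_bracket (s : ℝ) : Continuous (bracket s) := by
  unfold bracket
  refine Continuous.rpow_const (by fun_prop) fun p => Or.inl ?_
  have := one_le_bracket_base p
  linarith

lemma bracket_pos (s : ℝ) (p : Mom) : 0 < bracket s p :=
  Real.rpow_pos_of_pos (by have := one_le_bracket_base p; linarith) s

lemma hasWeight_sob (s : ℝ) : HasWeight (sobolevMeasure s) (bracket s) :=
  ⟨(continuous_bracket s).measurable, bracket_pos s, rfl⟩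

lemma bracket_add (s t : ℝ) (p : Mom) : bracket (s + t) p = bracket s p * bracket t p :=
  Real.rpow_add (by have := one_le_bracket_base p; linarith) s t

lemma bracket_neg (s : ℝ) (p : Mom) : bracket (-s) p = (bracket s p)⁻¹ :=
  Real.rpow_neg (by have := one_le_bracket_base p; linarith) s

lemma integrable_bracket {s : ℝ} (hs : s < -3 / 2) : Integrable (bracket s) := by
  have := integrable_rpow_neg_one_add_norm_sq (E := Mom) (μ := volume) (r := -2 * s)
    (by simp; linarith)
  refine this.congr (ae_of_all _ fun p => ?_)
  simp only [bracket]
  congr 1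
  ring

section Sector

variable {ℓ : ℕ} {s t : ℝ}

lemma angularSpace_le_sector {P : MvPolynomial (Fin 3) ℂ} (hP : IsSolidHarmonic ℓ P) :
    angularSpace (hasWeight_sob s) P ≤ sector ℓ s := by
  rintro f ⟨g, hg, hf⟩
  exact Submodule.subset_span ⟨g, P, hg, hP, hf⟩

/-- Reduction of a statement about a sector to a single spherical harmonic. -/
lemma sector_induction {motive : Sob s → Prop}
    (mem : ∀ P, IsSolidHarmonic ℓ P → ∀ f ∈ angularSpace (hasWeight_sob s) P, motive f)
    (zero : motive 0) (add : ∀ f g, motive f → motive g → motive (f + g))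
    (smul : ∀ (c : ℂ) f, motive f → motive (c • f)) {f : Sob s} (hf : f ∈ sector ℓ s) :
    motive f := by
  induction hf using Submodule.span_induction with
  | mem f hf =>
    obtain ⟨g, P, hg, hP, hf⟩ := hf
    exact mem P hP f ⟨g, hg, hf⟩
  | zero => exact zero
  | add f g _ _ hf hg => exact add f g hf hg
  | smul c f _ hf => exact smul c f hf

lemma map_mem_sector {K : Sob s →L[ℂ] Sob t}
    (hK : ∀ P, IsSolidHarmonic ℓ P → ∀ f ∈ angularSpace (hasWeight_sob s) P,
      K f ∈ angularSpace (hasWeight_sob t) P) {f : Sob s} (hf : f ∈ sector ℓ s) :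
    K f ∈ sector ℓ t := by
  refine sector_induction (motive := fun f => K f ∈ sector ℓ t)
    (fun P hP f hf => angularSpace_le_sector hP (hK P hP f hf)) ?_ ?_ ?_ hf
  · simp
  · intro f g hf hg
    rw [map_add]
    exact add_mem hf hg
  · intro c f hf
    rw [map_smul]
    exact Submodule.smul_mem _ _ hf

/-- Elements of a sector of positive degree are orthogonal to all radial functions. -/
lemma integral_radial_mul_sector_eq_zero (hℓ : 1 ≤ ℓ) {f : Sob s} (hf : f ∈ sector ℓ s)
    {w : ℝ → ℝ} (hw : Measurable w) (hwf : Integrable fun q : Mom => (w ‖q‖ : ℂ) * f q) :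
    ∫ q : Mom, (w ‖q‖ : ℂ) * f q = 0 := by
  -- radial functions integrable against all of `H^s`
  have h1 : ∀ w : ℝ → ℝ, Measurable w →
      (∀ f : Sob s, Integrable fun q : Mom => (w ‖q‖ : ℂ) * f q) →
      ∫ q : Mom, (w ‖q‖ : ℂ) * f q = 0 := by
    intro w hw hint
    refine sector_induction (motive := fun f : Sob s => ∫ q : Mom, (w ‖q‖ : ℂ) * f q = 0)
      ?_ ?_ ?_ ?_ hf
    · rintro P hP f ⟨g, hg, hf⟩
      refine integral_radial_mul_angular_eq_zero hℓ hP (g := fun r => (w r : ℂ) * g r) ?_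
      filter_upwards [hf] with p hp
      rw [hp, mul_assoc]
    · refine integral_eq_zero_of_ae ?_
      filter_upwards [(hasWeight_sob s).coeFn_zero] with q hq
      rw [hq, mul_zero, Pi.zero_apply]
    · intro f g hf hg
      rw [← add_zero (0 : ℂ)]
      nth_rewrite 1 [← hf]
      rw [← hg, ← integral_add (hint f) (hint g)]
      refine integral_congr_ae ?_
      filter_upwards [(hasWeight_sob s).coeFn_add f g] with q hq
      rw [hq, mul_add]
    · intro c f hf
      rw [← mul_zero c, ← hf, ← integral_const_mul]
      refine integral_congr_ae ?_
      filter_upwards [(hasWeight_sob s).coeFn_smul c f] with q hq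
      rw [hq]
      ring
  -- the general case follows by truncation
  set S : ℕ → Set ℝ := fun n => {r | |r| ≤ n ∧ |w r| ≤ n} with hS
  have hSm : ∀ n, MeasurableSet (S n) := fun n =>
    (measurableSet_le continuous_abs.measurable measurable_const).inter
      (measurableSet_le (continuous_abs.measurable.comp hw) measurable_const)
  set W : ℕ → ℝ → ℝ := fun n => (S n).indicator w with hW
  have hWm : ∀ n, Measurable (W n) := fun n => hw.indicator (hSm n)
  have hWle : ∀ n r, |W n r| ≤ |w r| := by
    intro n r
    simp only [hW]
    by_cases h : r ∈ S n
    · rw [Set.indicator_of_mem h]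
    · rw [Set.indicator_of_notMem h, abs_zero]; exact abs_nonneg _
  have h2 : ∀ n, ∫ q : Mom, (W n ‖q‖ : ℂ) * f q = 0 := by
    intro n
    refine h1 (W n) (hWm n) fun f => ?_
    refine (hasWeight_sob s).integrable_mul (Lp.memLp f) (X := fun q => W n ‖q‖)
      ((hWm n).comp measurable_norm) ?_
    have hc : IntegrableOn (fun q : Mom => (n : ℝ) ^ 2 * bracket (-s) q)
        (Metric.closedBall 0 n) :=
      ((continuous_const.mul (continuous_bracket (-s))).continuousOn).integrableOn_compact
        (isCompact_closedBall 0 (n : ℝ))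
    rw [← integrable_indicator_iff measurableSet_closedBall] at hc
    refine hc.mono' ((((hWm n).comp measurable_norm).pow_const 2).div
      (continuous_bracket s).measurable).aestronglyMeasurable (ae_of_all _ fun q => ?_)
    have hb := bracket_pos s q
    by_cases h : ‖q‖ ∈ S n
    · have hq : q ∈ Metric.closedBall (0 : Mom) n := by simpa using h.1
      rw [Set.indicator_of_mem hq, bracket_neg, ← div_eq_mul_inv, norm_div,
        Real.norm_of_nonneg hb.le]
      simp only [hW, Set.indicator_of_mem h]
      rw [norm_pow]
      gcongr
      exact h.2
    · simp only [hW, Set.indicator_of_notMem h]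
      rw [zero_pow two_ne_zero, zero_div, norm_zero]
      exact Set.indicator_nonneg (fun x _ => by have := bracket_pos (-s) x; positivity) _
  have h3 : Tendsto (fun n => ∫ q : Mom, (W n ‖q‖ : ℂ) * f q) atTop
      (𝓝 (∫ q : Mom, (w ‖q‖ : ℂ) * f q)) := by
    refine tendsto_integral_of_dominated_convergence (fun q : Mom => ‖(w ‖q‖ : ℂ) * f q‖) ?_
      hwf.norm ?_ ?_
    · intro n
      exact (Complex.measurable_ofReal.comp
        ((hWm n).comp measurable_norm)).aestronglyMeasurable.mul
        ((hasWeight_sob s).aestronglyMeasurable_iff.1 (Lp.aestronglyMeasurable f))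
    · refine fun n => ae_of_all _ fun q => ?_
      rw [norm_mul, norm_mul, Complex.norm_real, Complex.norm_real]
      exact mul_le_mul_of_nonneg_right (hWle n _) (norm_nonneg _)
    · refine ae_of_all _ fun q => ?_
      refine tendsto_const_nhds.congr' ?_
      filter_upwards [eventually_ge_atTop ⌈max ‖q‖ |w ‖q‖|⌉₊] with n hn
      have hn' : max ‖q‖ |w ‖q‖| ≤ n := (Nat.le_ceil _).trans (by exact_mod_cast hn)
      have : ‖q‖ ∈ S n := ⟨by rw [abs_norm]; exact (le_max_left _ _).trans hn',
        (le_max_right _ _).trans hn'⟩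
      simp only [hW, Set.indicator_of_mem this]
  simp only [h2] at h3
  exact tendsto_nhds_unique tendsto_const_nhds h3 |>.symm

end Sector

/-! ### Radial integrals -/

lemma integral_radial (f : ℝ → ℝ) :
    ∫ x : Mom, f ‖x‖ = 4 * Real.pi * ∫ r in Set.Ioi (0 : ℝ), r ^ 2 * f r := by
  rw [integral_fun_norm_addHaar (volume : Measure Mom) f, Measure.real,
    EuclideanSpace.volume_ball_fin_three]
  have hpi : 0 ≤ Real.pi * 4 / 3 := by positivity
  simp [ENNReal.toReal_ofReal hpi]
  ring

lemma hasDerivAt_arctan_div {A : ℝ} (hA : 0 < A) (r : ℝ) :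
    HasDerivAt (fun r => Real.arctan (r / A) / A) (1 / (r ^ 2 + A ^ 2)) r := by
  have h1 := (((hasDerivAt_id r).div_const A).arctan).div_const A
  convert! h1 using 1
  simp only [id]
  field_simp
  ring

lemma tendsto_arctan_div {A : ℝ} (hA : 0 < A) :
    Tendsto (fun r => Real.arctan (r / A) / A) atTop (𝓝 (Real.pi / 2 / A)) :=
  ((Real.tendsto_arctan_atTop.mono_right nhdsWithin_le_nhds).comp
    (tendsto_id.atTop_div_const hA)).div_const A

/-- `∫ (q² + A²)⁻² dq = π² / A`. -/
lemma integral_inv_sq_add_sq {A : ℝ} (hA : 0 < A) :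
    Integrable (fun q : Mom => 1 / (‖q‖ ^ 2 + A ^ 2) ^ 2) ∧
      ∫ q : Mom, 1 / (‖q‖ ^ 2 + A ^ 2) ^ 2 = Real.pi ^ 2 / A := by
  set F : ℝ → ℝ := fun r => Real.arctan (r / A) / A / 2 - r / (r ^ 2 + A ^ 2) / 2 with hF
  have hd : ∀ r, HasDerivAt F (r ^ 2 * (1 / (r ^ 2 + A ^ 2) ^ 2)) r := by
    intro r
    have hne : r ^ 2 + A ^ 2 ≠ 0 := by positivity
    have h2 : HasDerivAt (fun r : ℝ => r / (r ^ 2 + A ^ 2))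
        ((1 * (r ^ 2 + A ^ 2) - r * (2 * r)) / (r ^ 2 + A ^ 2) ^ 2) r := by
      have := (hasDerivAt_id r).div (((hasDerivAt_id r).pow 2).add_const (A ^ 2)) hne
      convert! this using 1
      simp
    have := ((hasDerivAt_arctan_div hA r).div_const 2).sub (h2.div_const 2)
    convert! this using 1
    field_simp
    ring
  have ht : Tendsto F atTop (𝓝 (Real.pi / 2 / A / 2)) := by
    have h2 : Tendsto (fun r : ℝ => r / (r ^ 2 + A ^ 2)) atTop (𝓝 0) := by
      refine squeeze_zero' ?_ ?_ tendsto_inv_atTop_zero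
      · filter_upwards [eventually_ge_atTop 0] with r hr
        positivity
      · filter_upwards [eventually_gt_atTop 0] with r hr
        rw [inv_eq_one_div, div_le_div_iff₀ (by positivity) hr]
        nlinarith [sq_nonneg A]
    simpa using ((tendsto_arctan_div hA).div_const 2).sub (h2.div_const 2)
  have hnn : ∀ r ∈ Set.Ioi (0 : ℝ), 0 ≤ r ^ 2 * (1 / (r ^ 2 + A ^ 2) ^ 2) := fun r _ => by
    positivity
  have hI := integral_Ioi_of_hasDerivAt_of_nonneg' (a := 0) (fun r _ => hd r) hnn ht
  have hInt := integrableOn_Ioi_deriv_of_nonneg' (a := 0) (fun r _ => hd r) hnn ht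
  constructor
  · rw [integrable_fun_norm_addHaar (volume : Measure Mom) (f := fun r => 1 / (r ^ 2 + A ^ 2) ^ 2)]
    simpa using hInt
  · rw [integral_radial (fun r => 1 / (r ^ 2 + A ^ 2) ^ 2), hI]
    simp only [hF, zero_div, Real.arctan_zero, sub_zero]
    field_simp
    ring

/-- `∫ (1 + q²)⁻¹ (q² + A²)⁻² dq` decays like `A⁻³`. -/
lemma integral_inv_mul_inv_sq_add_sq_le {A : ℝ} (hA : 0 < A) :
    Integrable (fun q : Mom => 1 / ((1 + ‖q‖ ^ 2) * (‖q‖ ^ 2 + A ^ 2) ^ 2)) ∧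
      ∫ q : Mom, 1 / ((1 + ‖q‖ ^ 2) * (‖q‖ ^ 2 + A ^ 2) ^ 2) ≤ 2 * Real.pi ^ 2 / A ^ 3 := by
  have hnn : ∀ r ∈ Set.Ioi (0 : ℝ), 0 ≤ 1 / (r ^ 2 + A ^ 2) := fun r _ => by positivity
  have hI := integral_Ioi_of_hasDerivAt_of_nonneg' (a := 0) (fun r _ => hasDerivAt_arctan_div hA r)
    hnn (tendsto_arctan_div hA)
  have hInt := integrableOn_Ioi_deriv_of_nonneg' (a := 0) (fun r _ => hasDerivAt_arctan_div hA r)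
    hnn (tendsto_arctan_div hA)
  have hle : ∀ r : ℝ, r ^ 2 * (1 / ((1 + r ^ 2) * (r ^ 2 + A ^ 2) ^ 2)) ≤
      1 / A ^ 2 * (1 / (r ^ 2 + A ^ 2)) := by
    intro r
    rw [mul_one_div, div_mul_div_comm, one_mul, div_le_div_iff₀ (by positivity) (by positivity)]
    have h1 : r ^ 2 * A ^ 2 ≤ (1 + r ^ 2) * (r ^ 2 + A ^ 2) := by
      nlinarith [sq_nonneg r, sq_nonneg A]
    have h2 : 0 ≤ r ^ 2 + A ^ 2 := by positivity
    calc _ = r ^ 2 * A ^ 2 * (r ^ 2 + A ^ 2) := by ring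
      _ ≤ (1 + r ^ 2) * (r ^ 2 + A ^ 2) * (r ^ 2 + A ^ 2) := by gcongr
      _ = _ := by ring
  have hInt2 : IntegrableOn (fun r : ℝ => r ^ 2 * (1 / ((1 + r ^ 2) * (r ^ 2 + A ^ 2) ^ 2)))
      (Set.Ioi 0) := by
    refine (hInt.const_mul (1 / A ^ 2)).mono' ?_ (ae_of_all _ fun r => ?_)
    · have hm : Measurable fun r : ℝ => r ^ 2 * (1 / ((1 + r ^ 2) * (r ^ 2 + A ^ 2) ^ 2)) := by
        fun_prop
      exact hm.aestronglyMeasurable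
    · rw [Real.norm_of_nonneg (by positivity)]
      exact hle r
  constructor
  · rw [integrable_fun_norm_addHaar (volume : Measure Mom)
      (f := fun r => 1 / ((1 + r ^ 2) * (r ^ 2 + A ^ 2) ^ 2))]
    simpa using hInt2
  · rw [integral_radial (fun r => 1 / ((1 + r ^ 2) * (r ^ 2 + A ^ 2) ^ 2))]
    calc _ ≤ 4 * Real.pi * ∫ r in Set.Ioi (0 : ℝ), 1 / A ^ 2 * (1 / (r ^ 2 + A ^ 2)) := by
          exact mul_le_mul_of_nonneg_left (integral_mono hInt2 (hInt.const_mul _) hle)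
            (by positivity)
      _ = _ := by
          rw [integral_const_mul, hI]
          simp only [zero_div, Real.arctan_zero, sub_zero]
          field_simp
          ring

/-! ### The kernels of `T_λ` and `W_λ` on sectors of positive degree -/

/-- The Japanese bracket `(1 + p²)^{1/2}`. -/
def jap (p : Mom) : ℝ := Real.sqrt (1 + ‖p‖ ^ 2)

lemma jap_sq (p : Mom) : jap p ^ 2 = 1 + ‖p‖ ^ 2 :=
  Real.sq_sqrt (by positivity)

lemma jap_pos (p : Mom) : 0 < jap p := Real.sqrt_pos.2 (by positivity)

lemma one_le_jap (p : Mom) : 1 ≤ jap p := by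
  rw [jap, Real.one_le_sqrt]
  exact one_le_bracket_base p

lemma norm_le_jap (p : Mom) : ‖p‖ ≤ jap p := by
  refine Real.le_sqrt_of_sq_le ?_
  linarith

lemma continuous_jap : Continuous jap := by
  unfold jap
  fun_prop

lemma bracket_half_natCast (n : ℕ) (p : Mom) : bracket (n / 2) p = jap p ^ n := by
  rw [bracket, jap, Real.sqrt_eq_rpow, ← Real.rpow_natCast _ n,
    ← Real.rpow_mul (by positivity)]
  congr 1
  ring

lemma bracket_one_half (p : Mom) : bracket (1 / 2) p = jap p := by
  simpa using bracket_half_natCast 1 p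

lemma bracket_neg_one_half (p : Mom) : bracket (-1 / 2) p = (jap p)⁻¹ := by
  rw [neg_div, bracket_neg, bracket_one_half]

lemma bracket_three_halves (p : Mom) : bracket (3 / 2) p = jap p ^ 3 := by
  simpa using bracket_half_natCast 3 p

lemma bracket_neg_three_halves (p : Mom) : bracket (-3 / 2) p = (jap p ^ 3)⁻¹ := by
  rw [neg_div, bracket_neg, bracket_three_halves]

section Kernels

variable {m lam : ℝ}

lemma mu_pos (hm : 0 < m) : 0 < mu m := by
  unfold mu
  positivity

lemma mu_lt_two (hm : 0 < m) : mu m < 2 := by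
  unfold mu
  rw [div_lt_iff₀ (by linarith)]
  linarith

lemma nu_pos (hm : 0 < m) : 0 < nu m := by
  unfold nu
  nlinarith [mu_pos hm, mu_lt_two hm]

lemma nu_le_one : nu m ≤ 1 := by
  unfold nu
  nlinarith [sq_nonneg (mu m)]

/-- The symbol `(ν p² + λ)^{1/2}`. -/
def sym (m lam : ℝ) (p : Mom) : ℝ := Real.sqrt (nu m * ‖p‖ ^ 2 + lam)

lemma sym_sq (hm : 0 < m) (hlam : 0 < lam) (p : Mom) : sym m lam p ^ 2 = nu m * ‖p‖ ^ 2 + lam :=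
  Real.sq_sqrt (by have := nu_pos hm; positivity)

lemma sym_pos (hm : 0 < m) (hlam : 0 < lam) (p : Mom) : 0 < sym m lam p :=
  Real.sqrt_pos.2 (by have := nu_pos hm; positivity)

lemma continuous_sym : Continuous (sym m lam) := by
  unfold sym
  fun_prop

lemma exists_sym_le :
    ∃ C : ℝ, 0 < C ∧ ∀ p, sym m lam p ≤ C * jap p := by
  refine ⟨Real.sqrt (max 1 lam), Real.sqrt_pos.2 (by positivity), fun p => ?_⟩
  rw [jap, ← Real.sqrt_mul (by positivity)]
  refine Real.sqrt_le_sqrt ?_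
  have h1 := le_max_left 1 lam
  have h2 := le_max_right 1 lam
  have h3 : nu m ≤ max 1 lam := nu_le_one.trans h1
  nlinarith [mul_le_mul_of_nonneg_right h3 (sq_nonneg ‖p‖)]

lemma exists_le_sym (hm : 0 < m) (hlam : 0 < lam) :
    ∃ c : ℝ, 0 < c ∧ ∀ p, c * jap p ≤ sym m lam p := by
  have hν := nu_pos hm
  refine ⟨Real.sqrt (min (nu m) lam), Real.sqrt_pos.2 (by positivity), fun p => ?_⟩
  rw [jap, ← Real.sqrt_mul (by positivity)]
  refine Real.sqrt_le_sqrt ?_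
  nlinarith [min_le_right (nu m) lam, mul_le_mul_of_nonneg_right (min_le_left (nu m) lam)
    (sq_nonneg ‖p‖)]

/-- `p² + q² + λ`, the radial part of the denominator. -/
def rad (lam : ℝ) (p q : Mom) : ℝ := ‖p‖ ^ 2 + ‖q‖ ^ 2 + lam

lemma rad_pos (hlam : 0 < lam) (p q : Mom) : 0 < rad lam p q := by
  unfold rad
  positivity

lemma den_comm (p q : Mom) : den m lam p q = den m lam q p := by
  unfold den
  rw [real_inner_comm]
  ring

lemma rad_comm (p q : Mom) : rad lam p q = rad lam q p := by
  unfold rad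
  ring

lemma abs_inner_le_half (p q : Mom) : |inner ℝ p q| ≤ (‖p‖ ^ 2 + ‖q‖ ^ 2) / 2 := by
  have := abs_real_inner_le_norm p q
  nlinarith [sq_nonneg (‖p‖ - ‖q‖)]

lemma le_den (hm : 0 < m) (hlam : 0 < lam) (p q : Mom) :
    (1 - mu m / 2) * rad lam p q ≤ den m lam p q := by
  have h1 := neg_le_of_abs_le (abs_inner_le_half p q)
  have h2 := mul_le_mul_of_nonneg_left h1 (mu_pos hm).le
  have h3 := mul_pos (mu_pos hm) hlam
  unfold den rad
  nlinarith

lemma den_le (hm : 0 < m) (hlam : 0 < lam) (p q : Mom) :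
    den m lam p q ≤ (1 + mu m / 2) * rad lam p q := by
  have h1 := le_of_abs_le (abs_inner_le_half p q)
  have h2 := mul_le_mul_of_nonneg_left h1 (mu_pos hm).le
  have h3 := mul_pos (mu_pos hm) hlam
  unfold den rad
  nlinarith

lemma den_pos (hm : 0 < m) (hlam : 0 < lam) (p q : Mom) : 0 < den m lam p q :=
  (mul_pos (by linarith [mu_lt_two hm]) (rad_pos hlam p q)).trans_le (le_den hm hlam p q)

/-- Completing the square in the denominator. -/
lemma den_eq (hm : 0 < m) (hlam : 0 < lam) (p q : Mom) :
    den m lam p q = ‖q + (mu m / 2) • p‖ ^ 2 + sym m lam p ^ 2 := by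
  rw [sym_sq hm hlam, norm_add_sq_real, norm_smul, inner_smul_right, real_inner_comm, den, nu,
    mul_pow, Real.norm_eq_abs, sq_abs]
  ring

lemma exists_mul_le_rad (hlam : 0 < lam) :
    ∃ c : ℝ, 0 < c ∧ ∀ p q : Mom, c * (‖q‖ ^ 2 + jap p ^ 2) ≤ rad lam p q := by
  refine ⟨min 1 lam, by positivity, fun p q => ?_⟩
  rw [jap_sq, rad]
  nlinarith [min_le_right 1 lam, mul_le_mul_of_nonneg_right (min_le_left 1 lam)
    (add_nonneg (sq_nonneg ‖p‖) (sq_nonneg ‖q‖))]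

lemma continuous_den : Continuous (Function.uncurry (den m lam)) := by
  unfold den Function.uncurry
  fun_prop

lemma continuous_rad : Continuous (Function.uncurry (rad lam)) := by
  unfold rad Function.uncurry
  fun_prop

/-- The kernel of `T_λ` with its radial part `1 / (p² + q² + λ)` removed; on sectors of positive
degree it defines the same operator, and it decays faster. -/
def kerT (m lam : ℝ) (p q : Mom) : ℝ := 1 / den m lam p q - 1 / rad lam p q

/-- The kernel of `W_λ` minus the largest multiple of the radial kernel `1 / (p² + q² + λ)²` that
leaves it nonnegative. -/
def kerW (m lam : ℝ) (p q : Mom) : ℝ :=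
  1 / den m lam p q ^ 2 - 1 / (1 + mu m / 2) ^ 2 / rad lam p q ^ 2

lemma kerT_comm (p q : Mom) : kerT m lam p q = kerT m lam q p := by
  rw [kerT, kerT, den_comm, rad_comm]

lemma kerW_comm (p q : Mom) : kerW m lam p q = kerW m lam q p := by
  rw [kerW, kerW, den_comm, rad_comm]

lemma measurable_kerT : Measurable (Function.uncurry (kerT m lam)) :=
  (measurable_const.div continuous_den.measurable).sub
    (measurable_const.div continuous_rad.measurable)

lemma measurable_kerW : Measurable (Function.uncurry (kerW m lam)) :=
  (measurable_const.div (continuous_den.measurable.pow_const 2)).sub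
    (measurable_const.div (continuous_rad.measurable.pow_const 2))

lemma kerW_nonneg (hm : 0 < m) (hlam : 0 < lam) (p q : Mom) : 0 ≤ kerW m lam p q := by
  have h1 := den_pos hm hlam p q
  have h2 := den_le hm hlam p q
  have h3 := rad_pos hlam p q
  have h4 := mu_pos hm
  rw [kerW, div_div, ← mul_pow, sub_nonneg]
  gcongr

/-- Decay of the reduced kernel of `T_λ`. -/
lemma exists_abs_kerT_le (hm : 0 < m) (hlam : 0 < lam) :
    ∃ C : ℝ, 0 < C ∧ ∀ p q, |kerT m lam p q| ≤ C * (jap p * jap q / (‖q‖ ^ 2 + jap p ^ 2) ^ 2) := by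
  obtain ⟨c, hc, hcr⟩ := exists_mul_le_rad hlam
  have hμ := mu_pos hm
  have hμ2 : 0 < 1 - mu m / 2 := by linarith [mu_lt_two hm]
  refine ⟨mu m / ((1 - mu m / 2) * c ^ 2), by positivity, fun p q => ?_⟩
  have h1 := den_pos hm hlam p q
  have h3 := rad_pos hlam p q
  have hj := jap_pos p
  have hj' := jap_pos q
  have h4 : 0 < ‖q‖ ^ 2 + jap p ^ 2 := by positivity
  have e : kerT m lam p q = -(mu m * inner ℝ p q) / (den m lam p q * rad lam p q) := by
    rw [kerT, div_sub_div _ _ h1.ne' h3.ne']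
    congr 1
    rw [rad, den]
    ring
  rw [e, abs_div, abs_neg, abs_mul, abs_of_pos hμ, abs_of_pos (mul_pos h1 h3)]
  have h5 : |inner ℝ p q| ≤ jap p * jap q := (abs_real_inner_le_norm p q).trans
    (mul_le_mul (norm_le_jap p) (norm_le_jap q) (norm_nonneg _) hj.le)
  have h6 : (1 - mu m / 2) * (c * (‖q‖ ^ 2 + jap p ^ 2)) * (c * (‖q‖ ^ 2 + jap p ^ 2)) ≤
      den m lam p q * rad lam p q := by
    have := le_den hm hlam p q
    have := hcr p q
    gcongr
    refine le_trans ?_ (le_den hm hlam p q)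
    gcongr
  calc _ ≤ mu m * (jap p * jap q) /
        ((1 - mu m / 2) * (c * (‖q‖ ^ 2 + jap p ^ 2)) * (c * (‖q‖ ^ 2 + jap p ^ 2))) := by
        gcongr
    _ = _ := by
        field_simp

lemma exists_one_div_den_sq_le (hm : 0 < m) (hlam : 0 < lam) :
    ∃ C : ℝ, 0 < C ∧ ∀ p q, 1 / den m lam p q ^ 2 ≤ C * (1 / (‖q‖ ^ 2 + jap p ^ 2) ^ 2) := by
  obtain ⟨c, hc, hcr⟩ := exists_mul_le_rad hlam
  have hμ2 : 0 < 1 - mu m / 2 := by linarith [mu_lt_two hm]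
  refine ⟨1 / ((1 - mu m / 2) * c) ^ 2, by positivity, fun p q => ?_⟩
  have hj := jap_pos p
  have h4 : 0 < ‖q‖ ^ 2 + jap p ^ 2 := by positivity
  rw [div_mul_div_comm, one_mul, ← mul_pow]
  gcongr
  refine le_trans ?_ (le_den hm hlam p q)
  rw [mul_assoc]
  gcongr
  exact hcr p q

lemma abs_kerW_le (hm : 0 < m) (hlam : 0 < lam) (p q : Mom) :
    |kerW m lam p q| ≤ 1 / den m lam p q ^ 2 := by
  rw [abs_of_nonneg (kerW_nonneg hm hlam p q), kerW]
  have : 0 ≤ 1 / (1 + mu m / 2) ^ 2 / rad lam p q ^ 2 := by positivity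
  linarith

lemma isZonal_kerT (hm : 0 < m) (hlam : 0 < lam) : IsZonal (kerT m lam) := by
  refine ⟨fun r s t => 1 / (r ^ 2 + s ^ 2 + mu m * t + lam) - 1 / (r ^ 2 + s ^ 2 + lam), ?_,
    fun p q => rfl⟩
  intro r s hr hs
  refine ContinuousOn.sub (ContinuousOn.div continuousOn_const (by fun_prop) fun t ht => ?_)
    continuousOn_const
  have := mul_le_mul_of_nonneg_left ht.1 (mu_pos hm).le
  have h2 : mu m * (r * s) ≤ 2 * (r * s) := by
    have := mu_lt_two hm
    gcongr
  nlinarith [sq_nonneg (r - s)]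

lemma isZonal_mul_kerW (hm : 0 < m) (hlam : 0 < lam) (w : ℝ → ℝ) :
    IsZonal fun p q => w ‖p‖ * kerW m lam p q := by
  refine ⟨fun r s t => w r * (1 / (r ^ 2 + s ^ 2 + mu m * t + lam) ^ 2 -
    1 / (1 + mu m / 2) ^ 2 / (r ^ 2 + s ^ 2 + lam) ^ 2), ?_, fun p q => rfl⟩
  intro r s hr hs
  refine continuousOn_const.mul (ContinuousOn.sub
    (ContinuousOn.div continuousOn_const (by fun_prop) fun t ht => ?_) continuousOn_const)
  have := mul_le_mul_of_nonneg_left ht.1 (mu_pos hm).le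
  have h2 : mu m * (r * s) ≤ 2 * (r * s) := by
    have := mu_lt_two hm
    gcongr
  have : 0 < r ^ 2 + s ^ 2 + mu m * t + lam := by nlinarith [sq_nonneg (r - s)]
  positivity

end Kernels

/-! ### Bounds for the kernels -/

lemma lintegral_ofReal_le {f g : Mom → ℝ} {c : ℝ} (hfg : ∀ q, f q ≤ g q) (hg : Integrable g)
    (hg0 : ∀ q, 0 ≤ g q) (hc : ∫ q, g q ≤ c) :
    ∫⁻ q, ENNReal.ofReal (f q) ≤ ENNReal.ofReal c := by
  calc _ ≤ ∫⁻ q, ENNReal.ofReal (g q) :=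
        lintegral_mono fun q => ENNReal.ofReal_le_ofReal (hfg q)
    _ = ENNReal.ofReal (∫ q, g q) := (ofReal_integral_eq_lintegral_ofReal hg (ae_of_all _ hg0)).symm
    _ ≤ _ := ENNReal.ofReal_le_ofReal hc

section Kernels

variable {m lam : ℝ}

/-- The operator with kernel `kerT` is bounded from `H^{3/2}` to `H^{1/2}`. -/
lemma exists_isBoundedKernel_kerT_high (hm : 0 < m) (hlam : 0 < lam) :
    ∃ C, IsBoundedKernel (kerT m lam) (bracket (3 / 2)) (bracket (1 / 2)) C := by
  obtain ⟨c, hc, hk⟩ := exists_abs_kerT_le hm hlam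
  have hjm : Measurable jap := continuous_jap.measurable
  refine ⟨c * (2 * Real.pi ^ 2), isBoundedKernel_of_schur measurable_kerT
    (continuous_bracket _).measurable (h := fun q => (jap q ^ 3)⁻¹) (h' := fun p => (jap p ^ 2)⁻¹)
    (by fun_prop) (by fun_prop) (fun q => by have := jap_pos q; positivity)
    (fun q => (bracket_pos _ q).le) (by positivity) (fun p => ?_) (fun q => ?_)⟩
  · have hj := jap_pos p
    obtain ⟨hi, hI⟩ := integral_inv_mul_inv_sq_add_sq_le hj
    refine lintegral_ofReal_le
      (g := fun q => c * jap p * (1 / ((1 + ‖q‖ ^ 2) * (‖q‖ ^ 2 + jap p ^ 2) ^ 2)))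
      (fun q => ?_) (hi.const_mul _) (fun q => by positivity) ?_
    · have hjq := jap_pos q
      calc _ ≤ c * (jap p * jap q / (‖q‖ ^ 2 + jap p ^ 2) ^ 2) * (jap q ^ 3)⁻¹ :=
            mul_le_mul_of_nonneg_right (hk p q) (by positivity)
        _ = _ := by
            rw [← jap_sq]
            have : 0 < ‖q‖ ^ 2 + jap p ^ 2 := by positivity
            field_simp
    · rw [integral_const_mul]
      calc _ ≤ c * jap p * (2 * Real.pi ^ 2 / jap p ^ 3) := by gcongr
        _ = _ := by field_simp
  · have hj := jap_pos q
    obtain ⟨hi, hI⟩ := integral_inv_sq_add_sq hj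
    refine lintegral_ofReal_le (g := fun p => c * jap q * (1 / (‖p‖ ^ 2 + jap q ^ 2) ^ 2))
      (fun p => ?_) (hi.const_mul _) (fun p => by positivity) ?_
    · have hjp := jap_pos p
      rw [bracket_one_half, kerT_comm]
      calc _ ≤ c * (jap q * jap p / (‖p‖ ^ 2 + jap q ^ 2) ^ 2) * (jap p * (jap p ^ 2)⁻¹) :=
            mul_le_mul_of_nonneg_right (hk q p) (by positivity)
        _ = _ := by
            have : 0 < ‖p‖ ^ 2 + jap q ^ 2 := by positivity
            field_simp
    · rw [integral_const_mul, hI, bracket_three_halves, mul_inv_cancel₀ (by positivity), mul_one]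
      calc _ = c * Real.pi ^ 2 := by field_simp
        _ ≤ _ := by nlinarith [mul_pos hc (pow_pos Real.pi_pos 2)]

/-- The operator with kernel `kerT` is bounded from `H^{-1/2}` to `H^{-3/2}`. -/
lemma exists_isBoundedKernel_kerT_low (hm : 0 < m) (hlam : 0 < lam) :
    ∃ C, IsBoundedKernel (kerT m lam) (bracket (-1 / 2)) (bracket (-3 / 2)) C := by
  obtain ⟨c, hc, hk⟩ := exists_abs_kerT_le hm hlam
  have hjm : Measurable jap := continuous_jap.measurable
  refine ⟨c * (2 * Real.pi ^ 2), isBoundedKernel_of_schur measurable_kerT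
    (continuous_bracket _).measurable (h := fun q => (jap q)⁻¹) (h' := fun _ => 1)
    (by fun_prop) (by fun_prop) (fun q => by have := jap_pos q; positivity)
    (fun q => (bracket_pos _ q).le) (by positivity) (fun p => ?_) (fun q => ?_)⟩
  · have hj := jap_pos p
    obtain ⟨hi, hI⟩ := integral_inv_sq_add_sq hj
    refine lintegral_ofReal_le (g := fun q => c * jap p * (1 / (‖q‖ ^ 2 + jap p ^ 2) ^ 2))
      (fun q => ?_) (hi.const_mul _) (fun q => by positivity) ?_
    · have hjq := jap_pos q
      calc _ ≤ c * (jap p * jap q / (‖q‖ ^ 2 + jap p ^ 2) ^ 2) * (jap q)⁻¹ :=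
            mul_le_mul_of_nonneg_right (hk p q) (by positivity)
        _ = _ := by
            have : 0 < ‖q‖ ^ 2 + jap p ^ 2 := by positivity
            field_simp
    · rw [integral_const_mul, hI]
      calc _ = c * Real.pi ^ 2 := by field_simp
        _ ≤ _ := by nlinarith [mul_pos hc (pow_pos Real.pi_pos 2)]
  · have hj := jap_pos q
    obtain ⟨hi, hI⟩ := integral_inv_mul_inv_sq_add_sq_le hj
    refine lintegral_ofReal_le
      (g := fun p => c * jap q * (1 / ((1 + ‖p‖ ^ 2) * (‖p‖ ^ 2 + jap q ^ 2) ^ 2)))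
      (fun p => ?_) (hi.const_mul _) (fun p => by positivity) ?_
    · have hjp := jap_pos p
      rw [bracket_neg_three_halves, kerT_comm]
      calc _ ≤ c * (jap q * jap p / (‖p‖ ^ 2 + jap q ^ 2) ^ 2) * ((jap p ^ 3)⁻¹ * 1) :=
            mul_le_mul_of_nonneg_right (hk q p) (by positivity)
        _ = _ := by
            rw [← jap_sq]
            have : 0 < ‖p‖ ^ 2 + jap q ^ 2 := by positivity
            field_simp
    · rw [integral_const_mul, bracket_neg_one_half]
      calc _ ≤ c * jap q * (2 * Real.pi ^ 2 / jap q ^ 3) := by gcongr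
        _ = _ := by field_simp

/-- Row integrals of the kernel of `W_λ`. -/
lemma integral_one_div_den_sq (hm : 0 < m) (hlam : 0 < lam) (p : Mom) :
    Integrable (fun q => 1 / den m lam p q ^ 2) ∧
      ∫ q, 1 / den m lam p q ^ 2 = Real.pi ^ 2 / sym m lam p := by
  obtain ⟨hi, hI⟩ := integral_inv_sq_add_sq (sym_pos hm hlam p)
  simp only [den_eq hm hlam]
  refine ⟨hi.comp_add_right ((mu m / 2) • p), ?_⟩
  rw [← hI]
  exact integral_add_right_eq_self (fun q : Mom => 1 / (‖q‖ ^ 2 + sym m lam p ^ 2) ^ 2)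
    ((mu m / 2) • p)

/-- The contraction constant of the integral part of `W_λ`. -/
def contr (m : ℝ) : ℝ := 1 - Real.sqrt (nu m) / (1 + mu m / 2) ^ 2

lemma contr_lt_one (hm : 0 < m) : contr m < 1 := by
  have h1 := Real.sqrt_pos.2 (nu_pos hm)
  have h2 := mu_pos hm
  have : 0 < Real.sqrt (nu m) / (1 + mu m / 2) ^ 2 := by positivity
  unfold contr
  linarith

lemma contr_nonneg (hm : 0 < m) : 0 ≤ contr m := by
  have h1 : Real.sqrt (nu m) ≤ 1 := Real.sqrt_le_one.2 nu_le_one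
  have h2 := mu_pos hm
  unfold contr
  rw [sub_nonneg, div_le_one (by positivity)]
  nlinarith

lemma integral_kerW_le (hm : 0 < m) (hlam : 0 < lam) (p : Mom) :
    Integrable (kerW m lam p) ∧
      ∫ q, kerW m lam p q ≤ contr m * (Real.pi ^ 2 / sym m lam p) := by
  obtain ⟨hi, hI⟩ := integral_one_div_den_sq hm hlam p
  set b := Real.sqrt (‖p‖ ^ 2 + lam) with hb
  have hb2 : b ^ 2 = ‖p‖ ^ 2 + lam := Real.sq_sqrt (by positivity)
  have hb0 : 0 < b := Real.sqrt_pos.2 (by positivity)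
  have hs := sym_pos hm hlam p
  have hμ := mu_pos hm
  obtain ⟨hi', hI'⟩ := integral_inv_sq_add_sq hb0
  have e : ∀ q, kerW m lam p q = 1 / den m lam p q ^ 2 -
      1 / (1 + mu m / 2) ^ 2 * (1 / (‖q‖ ^ 2 + b ^ 2) ^ 2) := by
    intro q
    rw [kerW, rad, hb2, ← mul_one_div]
    ring_nf
  have e' : kerW m lam p = fun q => 1 / den m lam p q ^ 2 -
      1 / (1 + mu m / 2) ^ 2 * (1 / (‖q‖ ^ 2 + b ^ 2) ^ 2) := funext e
  refine ⟨by rw [e']; exact hi.sub (hi'.const_mul _), ?_⟩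
  rw [e', integral_sub hi (hi'.const_mul _), integral_const_mul, hI, hI', contr]
  have h1 : Real.sqrt (nu m) * b ≤ sym m lam p := by
    rw [hb, ← Real.sqrt_mul (nu_pos hm).le, sym]
    refine Real.sqrt_le_sqrt ?_
    nlinarith [nu_le_one (m := m)]
  have h2 : Real.sqrt (nu m) * (Real.pi ^ 2 / sym m lam p) ≤ Real.pi ^ 2 / b := by
    rw [mul_div_assoc', div_le_div_iff₀ hs hb0]
    nlinarith [pow_pos Real.pi_pos 2]
  have h3 := mul_le_mul_of_nonneg_left h2 (by positivity : 0 ≤ 1 / (1 + mu m / 2) ^ 2)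
  calc _ ≤ Real.pi ^ 2 / sym m lam p -
        1 / (1 + mu m / 2) ^ 2 * (Real.sqrt (nu m) * (Real.pi ^ 2 / sym m lam p)) := by linarith
    _ = _ := by ring

/-- The kernel of the integral part of `W_λ`, normalised so that
`W_λ = 2π² (ν p² + λ)^{-1/2} (1 - M)` on sectors of positive degree. -/
def kerM (m lam : ℝ) (p q : Mom) : ℝ :=
  Real.sqrt (nu m * ‖p‖ ^ 2 + lam) / Real.pi ^ 2 * kerW m lam p q

lemma kerM_eq (p q : Mom) : kerM m lam p q = sym m lam p / Real.pi ^ 2 * kerW m lam p q := rfl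

lemma measurable_kerM : Measurable (Function.uncurry (kerM m lam)) :=
  ((continuous_sym.measurable.div_const _).comp measurable_fst).mul measurable_kerW

lemma isZonal_kerM (hm : 0 < m) (hlam : 0 < lam) : IsZonal (kerM m lam) :=
  isZonal_mul_kerW hm hlam fun r => Real.sqrt (nu m * r ^ 2 + lam) / Real.pi ^ 2

/-- The integral part of `W_λ` is a contraction: by the Schur test, since removing a multiple of
the radial kernel makes the row integrals strictly smaller than those of the diagonal part. -/
lemma isBoundedKernel_kerM (hm : 0 < m) (hlam : 0 < lam) :
    IsBoundedKernel (kerM m lam) (fun p => (sym m lam p)⁻¹) (fun p => (sym m lam p)⁻¹)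
      (contr m) := by
  have hsm : Measurable (sym m lam) := continuous_sym.measurable
  refine isBoundedKernel_of_schur (A := fun p => (sym m lam p)⁻¹) measurable_kerM hsm.inv
    (h := fun _ => 1) (h' := fun _ => 1) measurable_const measurable_const (fun _ => one_pos)
    (fun q => by have := sym_pos hm hlam q; positivity) (contr_nonneg hm) (fun p => ?_)
    (fun q => ?_)
  · obtain ⟨hi, hI⟩ := integral_kerW_le hm hlam p
    have hs := sym_pos hm hlam p
    refine lintegral_ofReal_le (g := fun q => sym m lam p / Real.pi ^ 2 * kerW m lam p q)
      (fun q => ?_) (hi.const_mul _)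
      (fun q => mul_nonneg (by positivity) (kerW_nonneg hm hlam p q)) ?_
    · rw [kerM_eq, mul_one, abs_of_nonneg (mul_nonneg (by positivity) (kerW_nonneg hm hlam p q))]
    · rw [integral_const_mul]
      calc _ ≤ sym m lam p / Real.pi ^ 2 * (contr m * (Real.pi ^ 2 / sym m lam p)) := by gcongr
        _ = _ := by field_simp
  · obtain ⟨hi, hI⟩ := integral_kerW_le hm hlam q
    have hs := sym_pos hm hlam q
    refine lintegral_ofReal_le (g := fun p => 1 / Real.pi ^ 2 * kerW m lam q p)
      (fun p => ?_) (hi.const_mul _)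
      (fun p => mul_nonneg (by positivity) (kerW_nonneg hm hlam q p)) ?_
    · have hsp := sym_pos hm hlam p
      rw [kerM_eq, kerW_comm p q,
        abs_of_nonneg (mul_nonneg (by positivity) (kerW_nonneg hm hlam q p))]
      refine le_of_eq ?_
      field_simp
    · rw [integral_const_mul]
      calc _ ≤ 1 / Real.pi ^ 2 * (contr m * (Real.pi ^ 2 / sym m lam q)) := by gcongr
        _ = _ := by field_simp

lemma hasWeight_inv_sym (hm : 0 < m) (hlam : 0 < lam) :
    HasWeight (volume.withDensity fun p => ENNReal.ofReal (sym m lam p)⁻¹)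
      fun p => (sym m lam p)⁻¹ :=
  ⟨continuous_sym.measurable.inv, fun p => inv_pos.2 (sym_pos hm hlam p), rfl⟩

end Kernels

/-! ### Absolute convergence of the integrals -/

lemma jap_sq_le (p q : Mom) : jap q ^ 2 ≤ ‖q‖ ^ 2 + jap p ^ 2 := by
  rw [jap_sq, jap_sq]
  nlinarith [sq_nonneg ‖p‖]

/-- Functions decaying like `⟨q⟩⁻³` are integrable against all of `H^{-1/2}`. -/
lemma HasWeight.integrable_mul_of_decay {τ : Measure Mom} {B : Mom → ℝ} (h : HasWeight τ B) {c : ℝ}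
    (hc : 0 < c) (hB : ∀ q, c * (jap q)⁻¹ ≤ B q) {f : Mom → ℂ} (hf : MemLp f 2 τ) {X : Mom → ℝ}
    (hX : Measurable X) {C : ℝ} (hXC : ∀ q, |X q| ≤ C * (jap q ^ 3)⁻¹) :
    Integrable fun q => (X q : ℂ) * f q := by
  refine h.integrable_mul hf hX ?_
  have hi : Integrable fun q : Mom => C ^ 2 / c * bracket (-5 / 2) q :=
    (integrable_bracket (by norm_num)).const_mul _
  refine hi.mono' ((hX.pow_const 2).div h.measurable).aestronglyMeasurable (ae_of_all _ fun q => ?_)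
  have hj := jap_pos q
  have hBq := h.pos q
  have e : bracket (-5 / 2) q = (jap q ^ 5)⁻¹ := by
    rw [neg_div, bracket_neg]
    congr 1
    simpa using bracket_half_natCast 5 q
  rw [Real.norm_of_nonneg (by positivity), e]
  have h1 : X q ^ 2 ≤ (C * (jap q ^ 3)⁻¹) ^ 2 := by
    rw [← sq_abs]
    exact pow_le_pow_left₀ (abs_nonneg _) (hXC q) 2
  calc X q ^ 2 / B q ≤ (C * (jap q ^ 3)⁻¹) ^ 2 / (c * (jap q)⁻¹) := by
        gcongr
        exact hB q
    _ = _ := by field_simp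

section Kernels

variable {m lam : ℝ}

lemma exists_abs_kerT_le_decay (hm : 0 < m) (hlam : 0 < lam) (p : Mom) :
    ∃ C, ∀ q, |kerT m lam p q| ≤ C * (jap q ^ 3)⁻¹ := by
  obtain ⟨c, hc, hk⟩ := exists_abs_kerT_le hm hlam
  refine ⟨c * jap p, fun q => (hk p q).trans ?_⟩
  have hj := jap_pos p
  have hjq := jap_pos q
  calc _ ≤ c * (jap p * jap q / (jap q ^ 2) ^ 2) := by
        gcongr
        exact jap_sq_le p q
    _ = _ := by field_simp

lemma exists_one_div_den_sq_le_decay (hm : 0 < m) (hlam : 0 < lam) (p : Mom) :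
    ∃ C, ∀ q, |1 / den m lam p q ^ 2| ≤ C * (jap q ^ 3)⁻¹ := by
  obtain ⟨c, hc, hk⟩ := exists_one_div_den_sq_le hm hlam
  refine ⟨c, fun q => ?_⟩
  have hd := den_pos hm hlam p q
  rw [abs_of_nonneg (by positivity)]
  refine (hk p q).trans ?_
  have hj := jap_pos p
  have hjq := one_le_jap q
  rw [← one_div]
  gcongr
  calc jap q ^ 3 ≤ jap q ^ 4 := pow_le_pow_right₀ hjq (by norm_num)
    _ = (jap q ^ 2) ^ 2 := by ring
    _ ≤ _ := by
      gcongr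
      exact jap_sq_le p q

lemma exists_abs_kerM_le_decay (hm : 0 < m) (hlam : 0 < lam) (p : Mom) :
    ∃ C, ∀ q, |kerM m lam p q| ≤ C * (jap q ^ 3)⁻¹ := by
  obtain ⟨C, hC⟩ := exists_one_div_den_sq_le_decay hm hlam p
  have hs := sym_pos hm hlam p
  refine ⟨sym m lam p / Real.pi ^ 2 * C, fun q => ?_⟩
  rw [kerM_eq, abs_mul, abs_of_pos (by positivity : 0 < sym m lam p / Real.pi ^ 2), mul_assoc]
  gcongr
  exact (abs_kerW_le hm hlam p q).trans ((le_abs_self _).trans (hC q))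

/-- Functions decaying like `⟨q⟩⁻²` are integrable against `H^s` for `s > -1/2`. -/
lemma integrable_mul_of_memLp_sob {s : ℝ} (hs : -1 / 2 < s) {f : Mom → ℂ}
    (hf : MemLp f 2 (sobolevMeasure s)) {X : Mom → ℝ} (hX : Measurable X) {C : ℝ}
    (hXC : ∀ q, |X q| ≤ C * (jap q ^ 2)⁻¹) : Integrable fun q => (X q : ℂ) * f q := by
  refine (hasWeight_sob s).integrable_mul hf hX ?_
  have hi : Integrable fun q : Mom => C ^ 2 * bracket (-2 + -s) q :=
    (integrable_bracket (by linarith)).const_mul _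
  refine hi.mono' ((hX.pow_const 2).div (continuous_bracket s).measurable).aestronglyMeasurable
    (ae_of_all _ fun q => ?_)
  have hj := jap_pos q
  have hb := bracket_pos s q
  have e : bracket (-2) q = (jap q ^ 4)⁻¹ := by
    rw [bracket_neg]
    congr 1
    have := bracket_half_natCast 4 q
    norm_num at this
    exact this
  rw [Real.norm_of_nonneg (by positivity), bracket_add, bracket_neg s, e]
  have h1 : X q ^ 2 ≤ (C * (jap q ^ 2)⁻¹) ^ 2 := by
    rw [← sq_abs]
    exact pow_le_pow_left₀ (abs_nonneg _) (hXC q) 2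
  calc X q ^ 2 / bracket s q ≤ (C * (jap q ^ 2)⁻¹) ^ 2 / bracket s q := by gcongr
    _ = _ := by field_simp

lemma exists_one_div_rad_le_decay (hlam : 0 < lam) (p : Mom) :
    ∃ C, ∀ q, |1 / rad lam p q| ≤ C * (jap q ^ 2)⁻¹ := by
  obtain ⟨c, hc, hcr⟩ := exists_mul_le_rad hlam
  refine ⟨1 / c, fun q => ?_⟩
  have hr := rad_pos hlam p q
  have hj := jap_pos q
  rw [abs_of_nonneg (by positivity), ← one_div, div_mul_div_comm, one_mul]
  gcongr
  refine le_trans ?_ (hcr p q)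
  gcongr
  exact jap_sq_le p q

end Kernels

/-! ### The operator `2 W_λ⁻¹ (T_λ + α)` -/

section Action

variable {m lam α : ℝ} {ℓ : ℕ}

lemma kernelInt_congr {k : Mom → Mom → ℝ} {f g : Mom → ℂ} (h : ∀ᵐ q, f q = g q) (p : Mom) :
    kernelInt k f p = kernelInt k g p := by
  refine integral_congr_ae ?_
  filter_upwards [h] with q hq
  rw [hq]

lemma measurable_kerT_right (p : Mom) : Measurable (kerT m lam p) :=
  measurable_kerT.of_uncurry_left

lemma integrable_kerT_mul (hm : 0 < m) (hlam : 0 < lam) {τ : Measure Mom} {B : Mom → ℝ}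
    (h : HasWeight τ B) {c : ℝ} (hc : 0 < c) (hB : ∀ q, c * (jap q)⁻¹ ≤ B q) (f : Lp ℂ 2 τ)
    (p : Mom) : Integrable fun q => (kerT m lam p q : ℂ) * f q := by
  obtain ⟨C, hC⟩ := exists_abs_kerT_le_decay hm hlam p
  exact h.integrable_mul_of_decay hc hB (Lp.memLp f) (measurable_kerT_right p) hC

lemma integrable_kerT_mul_low (hm : 0 < m) (hlam : 0 < lam) (f : Sob (-1 / 2)) (p : Mom) :
    Integrable fun q => (kerT m lam p q : ℂ) * f q :=
  integrable_kerT_mul hm hlam (hasWeight_sob _) one_pos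
    (fun q => by rw [bracket_neg_one_half, one_mul]) f p

lemma integrable_kerT_mul_high (hm : 0 < m) (hlam : 0 < lam) (f : Sob (3 / 2)) (p : Mom) :
    Integrable fun q => (kerT m lam p q : ℂ) * f q := by
  refine integrable_kerT_mul hm hlam (hasWeight_sob _) one_pos (fun q => ?_) f p
  have h1 := one_le_jap q
  rw [bracket_three_halves, one_mul]
  exact (inv_le_one_of_one_le₀ h1).trans (one_le_pow₀ h1)

/-- On a sector of positive degree the radial part of the kernel of `T_λ` does not contribute. -/
lemma formT_eq (hm : 0 < m) (hlam : 0 < lam) (hℓ : 1 ≤ ℓ) {s : ℝ} {f : Sob s}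
    (hf : f ∈ sector ℓ s) {p : Mom} (h1 : Integrable fun q => (kerT m lam p q : ℂ) * f q)
    (h2 : Integrable fun q => ((1 / rad lam p q : ℝ) : ℂ) * f q) :
    formT m lam f p =
      ((2 * Real.pi ^ 2 * sym m lam p : ℝ) : ℂ) * f p + kernelInt (kerT m lam) f p := by
  have h3 : ∫ q, ((1 / rad lam p q : ℝ) : ℂ) * f q = 0 :=
    integral_radial_mul_sector_eq_zero hℓ hf (w := fun r => 1 / (‖p‖ ^ 2 + r ^ 2 + lam))
      (by fun_prop) h2
  rw [formT, sym, kernelInt]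
  congr 1
  rw [← add_zero (∫ q, (kerT m lam p q : ℂ) * f q), ← h3, ← integral_add h1 h2]
  refine integral_congr_ae (ae_of_all _ fun q => ?_)
  have := den_pos hm hlam p q
  simp only [kerT]
  push_cast
  ring

/-- `T_λ` on `H^{3/2}_ℓ`. -/
lemma formT_eq_of_mem_sector_high (hm : 0 < m) (hlam : 0 < lam) (hℓ : 1 ≤ ℓ) {f : Sob (3 / 2)}
    (hf : f ∈ sector ℓ (3 / 2)) (p : Mom) :
    formT m lam f p =
      ((2 * Real.pi ^ 2 * sym m lam p : ℝ) : ℂ) * f p + kernelInt (kerT m lam) f p := by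
  obtain ⟨C, hC⟩ := exists_one_div_rad_le_decay hlam p
  refine formT_eq hm hlam hℓ hf (integrable_kerT_mul_high hm hlam f p)
    (integrable_mul_of_memLp_sob (by norm_num) (Lp.memLp f) ?_ hC)
  exact measurable_const.div continuous_rad.measurable.of_uncurry_left

/-- `W_λ` on `H^{-1/2}_ℓ`. -/
lemma formW_eq (hm : 0 < m) (hlam : 0 < lam) (hℓ : 1 ≤ ℓ) {f : Sob (-1 / 2)}
    (hf : f ∈ sector ℓ (-1 / 2)) (p : Mom) :
    formW m lam f p =
      ((2 * Real.pi ^ 2 / sym m lam p : ℝ) : ℂ) * (f p - kernelInt (kerM m lam) f p) := by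
  have hdm : Measurable fun q => den m lam p q :=
    continuous_den.measurable.of_uncurry_left
  have hkm : Measurable fun q => kerW m lam p q := measurable_kerW.of_uncurry_left
  have hB : ∀ q, 1 * (jap q)⁻¹ ≤ bracket (-1 / 2) q := fun q => by
    rw [bracket_neg_one_half, one_mul]
  obtain ⟨C, hC⟩ := exists_one_div_den_sq_le_decay hm hlam p
  have h1 : Integrable fun q => ((1 / den m lam p q ^ 2 : ℝ) : ℂ) * f q :=
    (hasWeight_sob _).integrable_mul_of_decay one_pos hB (Lp.memLp f) (by fun_prop) hC
  have h2 : Integrable fun q => (kerW m lam p q : ℂ) * f q :=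
    (hasWeight_sob _).integrable_mul_of_decay one_pos hB (Lp.memLp f) hkm fun q =>
      (abs_kerW_le hm hlam p q).trans ((le_abs_self _).trans (hC q))
  have h3 : ∫ q, ((1 / (1 + mu m / 2) ^ 2 / rad lam p q ^ 2 : ℝ) : ℂ) * f q = 0 := by
    refine integral_radial_mul_sector_eq_zero hℓ hf
      (w := fun r => 1 / (1 + mu m / 2) ^ 2 / (‖p‖ ^ 2 + r ^ 2 + lam) ^ 2) (by fun_prop) ?_
    refine (h1.sub h2).congr (ae_of_all _ fun q => ?_)
    simp only [Pi.sub_apply, kerW, rad]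
    push_cast
    ring
  have h4 : ∫ q, f q / (den m lam p q : ℂ) ^ 2 = ∫ q, (kerW m lam p q : ℂ) * f q := by
    rw [← sub_zero (∫ q, f q / (den m lam p q : ℂ) ^ 2), ← h3, ← integral_sub]
    · refine integral_congr_ae (ae_of_all _ fun q => ?_)
      simp only [kerW]
      push_cast
      ring
    · refine h1.congr (ae_of_all _ fun q => ?_)
      push_cast
      ring
    · refine (h1.sub h2).congr (ae_of_all _ fun q => ?_)
      simp only [Pi.sub_apply, kerW]
      push_cast
      ring
  have h5 : kernelInt (kerM m lam) f p =
      ((sym m lam p / Real.pi ^ 2 : ℝ) : ℂ) * ∫ q, (kerW m lam p q : ℂ) * f q := by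
    rw [kernelInt, ← integral_const_mul]
    refine integral_congr_ae (ae_of_all _ fun q => ?_)
    simp only [kerM_eq]
    push_cast
    ring
  have hs : (sym m lam p : ℂ) ≠ 0 := by exact_mod_cast (sym_pos hm hlam p).ne'
  have hpi : (Real.pi : ℂ) ≠ 0 := by exact_mod_cast Real.pi_ne_zero
  rw [formW, h4, h5]
  change ((2 * Real.pi ^ 2 / sym m lam p : ℝ) : ℂ) * f p - _ = _
  push_cast
  field_simp

/-- The Neumann series inside an invariant closed subspace. -/
lemma exists_sub_map_eq {E : Type*} [NormedAddCommGroup E] [NormedSpace ℂ E] [CompleteSpace E]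
    (M : E →L[ℂ] E) (hM : ‖M‖ < 1) {V : Submodule ℂ E} (hV : IsClosed (V : Set E))
    (hMV : ∀ f ∈ V, M f ∈ V) {η : E} (hη : η ∈ V) : ∃ ζ ∈ V, ζ - M ζ = η := by
  have hsum := summable_geometric_of_norm_lt_one hM
  refine ⟨(∑' i, M ^ i) η, ?_, ?_⟩
  · have hpow : ∀ i : ℕ, (M ^ i) η ∈ V := by
      intro i
      induction i with
      | zero => simpa using hη
      | succ i ih =>
        rw [pow_succ']
        exact hMV _ ih
    exact hV.mem_of_tendsto (hsum.hasSum.mapL (ContinuousLinearMap.apply ℂ E η))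
      (Eventually.of_forall fun s => sum_mem fun i _ => hpow i)
  · have := mul_neg_geom_series M hM
    have := congrArg (fun T : E →L[ℂ] E => T η) this
    simpa using this

/-- `W_λ ζ = 2 (T_λ + α) ξ` has exactly one solution `ζ` in the sector of `ξ`. -/
theorem existsUnique_isAction (hm : 0 < m) (hlam : 0 < lam) (hℓ : 1 ≤ ℓ) {ξ : Sob (3 / 2)}
    (hξ : ξ ∈ sector ℓ (3 / 2)) :
    ∃! ζ : Sob (-1 / 2), ζ ∈ sector ℓ (-1 / 2) ∧ IsAction m lam α ξ ζ := by
  have hW := hasWeight_inv_sym hm hlam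
  set τ : Measure Mom := volume.withDensity fun p => ENNReal.ofReal (sym m lam p)⁻¹ with hτ
  have hlow := hasWeight_sob (-1 / 2)
  have hmid := hasWeight_sob (1 / 2)
  have hhigh := hasWeight_sob (3 / 2)
  have hsm : Measurable (sym m lam) := continuous_sym.measurable
  obtain ⟨c₁, hc₁, hle⟩ := exists_le_sym hm hlam
  obtain ⟨c₂, hc₂, hge⟩ := exists_sym_le (m := m) (lam := lam)
  have hlow_sym : ∀ q, 1 / c₂ * (jap q)⁻¹ ≤ (sym m lam q)⁻¹ := fun q => by
    have h1 := jap_pos q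
    have h2 := sym_pos hm hlam q
    rw [← one_div (jap q), div_mul_div_comm, one_mul, ← one_div]
    exact one_div_le_one_div_of_le h2 (hge q)
  obtain ⟨M, hM, hMn⟩ := (isBoundedKernel_kerM hm hlam).exists_clm hW hW
  obtain ⟨J, hJ, -⟩ := exists_mul_clm hlow hW (φ := fun _ => 1) measurable_const
    (C := Real.sqrt (1 / c₁)) (Real.sqrt_nonneg _) (fun p => by
      have h1 := jap_pos p
      rw [Real.sq_sqrt (by positivity), bracket_neg_one_half, one_pow, mul_one, ← one_div (jap p),
        div_mul_div_comm, one_mul, ← one_div]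
      exact one_div_le_one_div_of_le (by positivity) (hle p))
  obtain ⟨J', hJ', -⟩ := exists_mul_clm hW hlow (φ := fun _ => 1) measurable_const
    (C := Real.sqrt c₂) (Real.sqrt_nonneg _) (fun p => by
      have h1 := jap_pos p
      have h2 := sym_pos hm hlam p
      rw [Real.sq_sqrt hc₂.le, bracket_neg_one_half, one_pow, mul_one, ← div_eq_mul_inv,
        ← one_div, div_le_div_iff₀ h1 h2]
      linarith [hge p])
  obtain ⟨CT, hCT⟩ := exists_isBoundedKernel_kerT_high hm hlam
  obtain ⟨K, hK, -⟩ := hCT.exists_clm hhigh hmid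
  obtain ⟨D₁, hD₁, -⟩ := exists_mul_clm hmid hW (φ := fun p => sym m lam p / Real.pi ^ 2)
    (hsm.div_const _) (C := Real.sqrt c₂ / Real.pi ^ 2) (by positivity) (fun p => by
      have h1 := jap_pos p
      have h2 := sym_pos hm hlam p
      rw [div_pow, div_pow, Real.sq_sqrt hc₂.le, bracket_one_half]
      calc _ = sym m lam p / (Real.pi ^ 2) ^ 2 := by field_simp
        _ ≤ c₂ * jap p / (Real.pi ^ 2) ^ 2 := by gcongr; exact hge p
        _ = _ := by ring)
  obtain ⟨D₂, hD₂, -⟩ := exists_mul_clm hhigh hW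
    (φ := fun p => 2 * sym m lam p ^ 2 + α * (sym m lam p / Real.pi ^ 2))
    (((hsm.pow_const 2).const_mul 2).add ((hsm.div_const _).const_mul α))
    (C := Real.sqrt c₂ * (2 * c₂ + |α| / Real.pi ^ 2)) (by positivity) (fun p => by
      have h1 := one_le_jap p
      have h2 := sym_pos hm hlam p
      rw [mul_pow, Real.sq_sqrt hc₂.le, bracket_three_halves]
      have h3 : |2 * sym m lam p + α / Real.pi ^ 2| ≤ (2 * c₂ + |α| / Real.pi ^ 2) * jap p := by
        refine (abs_add_le _ _).trans ?_
        rw [abs_of_pos (by positivity : 0 < 2 * sym m lam p), abs_div,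
          abs_of_pos (by positivity : 0 < Real.pi ^ 2), add_mul]
        have h4 : |α| / Real.pi ^ 2 * 1 ≤ |α| / Real.pi ^ 2 * jap p := by gcongr
        linarith [hge p]
      calc _ = sym m lam p * |2 * sym m lam p + α / Real.pi ^ 2| ^ 2 := by
            rw [sq_abs]
            field_simp
        _ ≤ c₂ * jap p * ((2 * c₂ + |α| / Real.pi ^ 2) * jap p) ^ 2 := by
            gcongr
            exact hge p
        _ = _ := by ring)
  set R : Sob (3 / 2) →L[ℂ] Lp ℂ 2 τ := D₂ + D₁ ∘L K with hR
  -- the equation in the form `(1 - M) ζ = R ξ`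
  have hiff : ∀ ξ ∈ sector ℓ (3 / 2), ∀ ζ ∈ sector ℓ (-1 / 2),
      IsAction m lam α ξ ζ ↔ J ζ - M (J ζ) = R ξ := by
    intro ξ hξ ζ hζ
    have hJζ : ∀ᵐ p, J ζ p = ζ p := by
      filter_upwards [hJ ζ] with p hp
      simpa using hp
    have hl : ∀ᵐ p, (J ζ - M (J ζ)) p =
        ((sym m lam p / (2 * Real.pi ^ 2) : ℝ) : ℂ) * formW m lam ζ p := by
      filter_upwards [hW.coeFn_sub (J ζ) (M (J ζ)), hM (J ζ), hJζ] with p h1 h2 h3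
      rw [h1, h2, kernelInt_congr hJζ, h3, formW_eq hm hlam hℓ hζ, ← mul_assoc,
        ← Complex.ofReal_mul]
      have : sym m lam p / (2 * Real.pi ^ 2) * (2 * Real.pi ^ 2 / sym m lam p) = 1 := by
        have := sym_pos hm hlam p
        field_simp
      rw [this, Complex.ofReal_one, one_mul]
    have hr : ∀ᵐ p, R ξ p = ((sym m lam p / (2 * Real.pi ^ 2) : ℝ) : ℂ) *
        (2 * (formT m lam ξ p + (α : ℂ) * ξ p)) := by
      filter_upwards [hW.coeFn_add (D₂ ξ) (D₁ (K ξ)), hD₂ ξ, hD₁ (K ξ), hK ξ] with p h1 h2 h3 h4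
      have e : R ξ = D₂ ξ + D₁ (K ξ) := rfl
      have hpi : (Real.pi : ℂ) ≠ 0 := by exact_mod_cast Real.pi_ne_zero
      rw [e, h1, h2, h3, h4, formT_eq_of_mem_sector_high hm hlam hℓ hξ]
      push_cast
      field_simp
      ring
    constructor
    · intro h
      refine hW.ext ?_
      filter_upwards [hl, hr, h] with p h1 h2 h3
      rw [h1, h2, h3]
    · intro h
      filter_upwards [hl, hr] with p h1 h2
      rw [h, h2] at h1
      have : ((sym m lam p / (2 * Real.pi ^ 2) : ℝ) : ℂ) ≠ 0 := by
        have := sym_pos hm hlam p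
        exact_mod_cast (by positivity : sym m lam p / (2 * Real.pi ^ 2) ≠ 0)
      exact (mul_left_cancel₀ this h1).symm
  have hex : ∃ ζ ∈ sector ℓ (-1 / 2), J ζ - M (J ζ) = R ξ := by
    refine sector_induction
      (motive := fun ξ : Sob (3 / 2) => ∃ ζ ∈ sector ℓ (-1 / 2), J ζ - M (J ζ) = R ξ)
      ?_ ?_ ?_ ?_ hξ
    · intro P hP ξ hξ
      have hRξ : R ξ ∈ angularSpace hW P := by
        have e : R ξ = D₂ ξ + D₁ (K ξ) := rfl
        rw [e]
        refine add_mem ?_ ?_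
        · exact mul_mem_angularSpace hhigh hW
            (w := fun r => 2 * Real.sqrt (nu m * r ^ 2 + lam) ^ 2 +
              α * (Real.sqrt (nu m * r ^ 2 + lam) / Real.pi ^ 2)) (by fun_prop)
            (fun p => rfl) hξ (hD₂ ξ)
        · exact mul_mem_angularSpace hmid hW
            (w := fun r => Real.sqrt (nu m * r ^ 2 + lam) / Real.pi ^ 2) (by fun_prop)
            (fun p => rfl)
            (kernelInt_mem_angularSpace hhigh hmid measurable_kerT (isZonal_kerT hm hlam)
              (integrable_kerT_mul_high hm hlam) hP hξ (hK ξ)) (hD₁ (K ξ))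
      have hint : ∀ (f : Lp ℂ 2 τ) p, Integrable fun q => (kerM m lam p q : ℂ) * f q := by
        intro f p
        obtain ⟨C, hC⟩ := exists_abs_kerM_le_decay hm hlam p
        exact hW.integrable_mul_of_decay (by positivity) hlow_sym (Lp.memLp f)
          measurable_kerM.of_uncurry_left hC
      obtain ⟨ζ', hζ', hζ'eq⟩ := exists_sub_map_eq M (hMn.trans_lt (contr_lt_one hm))
        (isClosed_angularSpace hW P) (fun f hf => kernelInt_mem_angularSpace hW hW measurable_kerM
          (isZonal_kerM hm hlam) hint hP hf (hM f)) hRξ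
      refine ⟨J' ζ', angularSpace_le_sector hP
        (mul_mem_angularSpace hW hlow (w := fun _ => 1) measurable_const (fun _ => rfl) hζ'
          (hJ' ζ')), ?_⟩
      have : J (J' ζ') = ζ' := by
        refine hW.ext ?_
        filter_upwards [hJ (J' ζ'), hJ' ζ'] with p h1 h2
        rw [h1, h2]
        simp
      rw [this, hζ'eq]
    · exact ⟨0, zero_mem _, by simp⟩
    · rintro f g ⟨ζ, hζ, h1⟩ ⟨ζ', hζ', h2⟩
      refine ⟨ζ + ζ', add_mem hζ hζ', ?_⟩
      rw [map_add, map_add, map_add, ← h1, ← h2]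
      abel
    · rintro c f ⟨ζ, hζ, h1⟩
      refine ⟨c • ζ, Submodule.smul_mem _ _ hζ, ?_⟩
      rw [map_smul, map_smul, map_smul, ← h1, smul_sub]
  obtain ⟨ζ, hζ, hζeq⟩ := hex
  refine ⟨ζ, ⟨hζ, (hiff ξ hξ ζ hζ).2 hζeq⟩, ?_⟩
  rintro ζ' ⟨hζ', hact⟩
  have h1 := (hiff ξ hξ ζ' hζ').1 hact
  set d := J ζ' - J ζ with hd
  have h2 : d = M d := by
    rw [hd, map_sub, ← sub_eq_zero, show J ζ' - J ζ - (M (J ζ') - M (J ζ)) =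
      (J ζ' - M (J ζ')) - (J ζ - M (J ζ)) by abel, h1, hζeq, sub_self]
  have h3 : ‖d‖ ≤ contr m * ‖d‖ := by
    nth_rewrite 1 [h2]
    exact (M.le_opNorm d).trans (by gcongr)
  have h4 : d = 0 := by
    rw [← norm_eq_zero]
    nlinarith [norm_nonneg d, contr_lt_one hm]
  have h5 : J ζ' = J ζ := sub_eq_zero.1 h4
  refine hlow.ext ?_
  filter_upwards [hJ ζ, hJ ζ'] with p h6 h7
  rw [h5, h6] at h7
  simpa using h7.symm

end Action

/-! ### The extension of `T_λ` to `H^{-1/2}_ℓ` -/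

section Extension

variable {m lam α : ℝ} {ℓ : ℕ}

/-- The reduced form of `T_λ` is a bounded operator from `H^{-1/2}` to `H^{-3/2}`. -/
lemma exists_extension (hm : 0 < m) (hlam : 0 < lam) :
    ∃ S : Sob (-1 / 2) →L[ℂ] Sob (-3 / 2), ∀ f, ∀ᵐ p, S f p =
      ((2 * Real.pi ^ 2 * sym m lam p : ℝ) : ℂ) * f p + kernelInt (kerT m lam) f p := by
  have hlow := hasWeight_sob (-1 / 2)
  have hmin := hasWeight_sob (-3 / 2)
  obtain ⟨c₂, hc₂, hge⟩ := exists_sym_le (m := m) (lam := lam)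
  obtain ⟨C, hC⟩ := exists_isBoundedKernel_kerT_low hm hlam
  obtain ⟨K, hK, -⟩ := hC.exists_clm hlow hmin
  obtain ⟨D, hD, -⟩ := exists_mul_clm hlow hmin (φ := fun p => 2 * Real.pi ^ 2 * sym m lam p)
    (continuous_sym.measurable.const_mul _) (C := 2 * Real.pi ^ 2 * c₂) (by positivity)
    (fun p => by
      have h1 := jap_pos p
      have h2 := sym_pos hm hlam p
      rw [bracket_neg_three_halves, bracket_neg_one_half]
      calc _ ≤ (jap p ^ 3)⁻¹ * (2 * Real.pi ^ 2 * (c₂ * jap p)) ^ 2 := by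
            gcongr
            exact hge p
        _ = _ := by field_simp)
  refine ⟨D + K, fun f => ?_⟩
  filter_upwards [hmin.coeFn_add (D f) (K f), hD f, hK f] with p h1 h2 h3
  have e : (D + K) f = D f + K f := rfl
  rw [e, h1, h2, h3]

/-- The restriction of a charge to a ball is a bounded operator. -/
lemma exists_cutoff (s R : ℝ) :
    ∃ χ : Sob s →L[ℂ] Sob s, ∀ f, ∀ᵐ p, χ f p = (Metric.ball (0 : Mom) R).indicator f p := by
  classical
  obtain ⟨χ, hχ, -⟩ := exists_mul_clm (hasWeight_sob s) (hasWeight_sob s)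
    (φ := (Metric.ball (0 : Mom) R).indicator fun _ => 1)
    (measurable_const.indicator measurableSet_ball) (C := 1) zero_le_one (fun p => by
      have := bracket_pos s p
      by_cases hp : p ∈ Metric.ball (0 : Mom) R
      · rw [Set.indicator_of_mem hp]
        linarith
      · rw [Set.indicator_of_notMem hp]
        linarith)
  refine ⟨χ, fun f => ?_⟩
  filter_upwards [hχ f] with p hp
  rw [hp]
  by_cases hp : p ∈ Metric.ball (0 : Mom) R
  · simp [Set.indicator_of_mem hp]
  · simp [Set.indicator_of_notMem hp]

lemma cutoff_mem_sector {s R : ℝ} {χ : Sob s →L[ℂ] Sob s}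
    (hχ : ∀ f, ∀ᵐ p, χ f p = (Metric.ball (0 : Mom) R).indicator f p) {f : Sob s}
    (hf : f ∈ sector ℓ s) : χ f ∈ sector ℓ s := by
  refine map_mem_sector (fun P hP f hf => ?_) hf
  refine mul_mem_angularSpace (hasWeight_sob s) (hasWeight_sob s)
    (φ := (Metric.ball (0 : Mom) R).indicator fun _ => 1)
    (w := (Set.Iio R).indicator fun _ => 1) (measurable_const.indicator measurableSet_Iio)
    (fun p => ?_) hf ?_
  · simp only [Set.indicator, mem_ball_zero_iff, Set.mem_Iio]
  · filter_upwards [hχ f] with p hp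
    rw [hp]
    by_cases hp : p ∈ Metric.ball (0 : Mom) R
    · simp [Set.indicator_of_mem hp]
    · simp [Set.indicator_of_notMem hp]

/-- Charges supported in a ball are dense. -/
lemma tendsto_cutoff {s : ℝ} {χ : ℕ → Sob s →L[ℂ] Sob s}
    (hχ : ∀ n f, ∀ᵐ p, χ n f p = (Metric.ball (0 : Mom) n).indicator f p) (f : Sob s) :
    Tendsto (fun n => χ n f) atTop (𝓝 f) := by
  have hw := hasWeight_sob s
  rw [Lp.tendsto_Lp_iff_tendsto_eLpNorm']
  have h1 : ∀ n, eLpNorm (χ n f - f : Mom → ℂ) 2 (sobolevMeasure s) ^ 2 =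
      ∫⁻ p, ENNReal.ofReal (bracket s p) * ‖(Metric.ball (0 : Mom) n)ᶜ.indicator f p‖ₑ ^ 2 := by
    intro n
    rw [hw.eLpNorm_sq]
    refine lintegral_congr_ae ?_
    filter_upwards [hχ n f] with p hp
    simp only [Pi.sub_apply, hp]
    by_cases hp : p ∈ Metric.ball (0 : Mom) n
    · rw [Set.indicator_of_mem hp, Set.indicator_of_notMem (by simpa using hp), sub_self]
    · rw [Set.indicator_of_notMem hp, Set.indicator_of_mem (by simpa using hp), zero_sub,
        enorm_neg]
  have h2 : Tendsto (fun n : ℕ => ∫⁻ p, ENNReal.ofReal (bracket s p) *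
      ‖(Metric.ball (0 : Mom) n)ᶜ.indicator f p‖ₑ ^ 2) atTop (𝓝 (∫⁻ _ : Mom, 0)) := by
    refine tendsto_lintegral_of_dominated_convergence'
      (fun p => ENNReal.ofReal (bracket s p) * ‖f p‖ₑ ^ 2) (fun n => ?_) (fun n => ?_)
      (hw.lintegral_lt_top f).ne (ae_of_all _ fun p => ?_)
    · have hfm := hw.aestronglyMeasurable_iff.1 (Lp.aestronglyMeasurable f)
      exact hw.measurable.ennreal_ofReal.aemeasurable.mul
        ((hfm.indicator measurableSet_ball.compl).enorm.pow_const 2)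
    · refine ae_of_all _ fun p => ?_
      exact mul_le_mul' le_rfl (pow_le_pow_left' (enorm_indicator_le_enorm_self _ _) 2)
    · refine tendsto_const_nhds.congr' ?_
      filter_upwards [eventually_gt_atTop ⌈‖p‖⌉₊] with n hn
      have hp : p ∈ Metric.ball (0 : Mom) n := by
        rw [mem_ball_zero_iff]
        exact (Nat.le_ceil _).trans_lt (by exact_mod_cast hn)
      rw [Set.indicator_of_notMem (by simpa using hp)]
      simp
  rw [lintegral_zero] at h2
  have h3 := (ENNReal.continuous_rpow_const (y := 1 / 2)).tendsto 0 |>.comp h2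
  simp only [← h1] at h3
  convert h3 using 1
  · ext n
    simp only [Function.comp_apply]
    rw [← ENNReal.rpow_natCast, ← ENNReal.rpow_mul]
    simp
  · simp

/-- A charge supported in a ball belongs to `L²`. -/
lemma memLp_of_cutoff {s R : ℝ} {f g : Sob s}
    (hg : ∀ᵐ p, g p = (Metric.ball (0 : Mom) R).indicator f p) :
    MemLp g 2 (sobolevMeasure 0) := by
  have hw := hasWeight_sob s
  refine (hasWeight_sob 0).memLp_iff.2
    ⟨hw.aestronglyMeasurable_iff.1 (Lp.aestronglyMeasurable g), ?_⟩
  obtain ⟨C, hC⟩ := (isCompact_closedBall (0 : Mom) R).exists_bound_of_continuousOn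
    (continuous_bracket (-s)).continuousOn
  refine lt_of_le_of_lt ?_ (ENNReal.mul_lt_top (ENNReal.ofReal_lt_top (r := C))
    (hw.lintegral_lt_top f))
  rw [← lintegral_const_mul' _ _ ENNReal.ofReal_ne_top]
  refine lintegral_mono_ae ?_
  filter_upwards [hg] with p hp
  rw [hp]
  by_cases h : p ∈ Metric.ball (0 : Mom) R
  · rw [Set.indicator_of_mem h, ← mul_assoc]
    have h1 := hC p (Metric.ball_subset_closedBall h)
    have h2 := bracket_pos (-s) p
    have h3 := bracket_pos s p
    rw [Real.norm_of_nonneg h2.le] at h1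
    rw [← ENNReal.ofReal_mul (h2.le.trans h1)]
    gcongr
    calc bracket 0 p = bracket (-s) p * bracket s p := by rw [← bracket_add]; simp
      _ ≤ _ := by gcongr
  · rw [Set.indicator_of_notMem h]
    simp

/-- `T_λ` is determined on `H^{-1/2}_ℓ` by its values on more regular charges. -/
lemma isTOperator_unique {S S' : sector ℓ (-1 / 2) →L[ℂ] Sob (-3 / 2)}
    (hS : IsTOperator m lam ℓ S) (hS' : IsTOperator m lam ℓ S') : S' = S := by
  choose χ hχ using fun n : ℕ => exists_cutoff (-1 / 2) n
  refine ContinuousLinearMap.ext fun Ξ => ?_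
  set u : ℕ → sector ℓ (-1 / 2) := fun n => ⟨χ n Ξ, cutoff_mem_sector (hχ n) Ξ.2⟩ with hu
  have hlim : Tendsto u atTop (𝓝 Ξ) := by
    rw [tendsto_subtype_rng]
    exact tendsto_cutoff hχ Ξ
  have heq : ∀ n, S' (u n) = S (u n) := by
    intro n
    have hreg : ∃ s : ℝ, -1 / 2 < s ∧ MemLp (u n : Sob (-1 / 2)) 2 (sobolevMeasure s) :=
      ⟨0, by norm_num, memLp_of_cutoff (hχ n Ξ)⟩
    refine (hasWeight_sob _).ext ?_
    filter_upwards [hS (u n) hreg, hS' (u n) hreg] with p h1 h2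
    rw [h1, h2]
  have h1 := (S'.continuous.tendsto Ξ).comp hlim
  have h2 := (S.continuous.tendsto Ξ).comp hlim
  refine tendsto_nhds_unique h1 (h2.congr fun n => ?_)
  exact (heq n).symm

/-- The reduced form of `T_λ` agrees with the explicit expression on more regular charges. -/
lemma isTOperator_of_extension (hm : 0 < m) (hlam : 0 < lam) (hℓ : 1 ≤ ℓ)
    {S : Sob (-1 / 2) →L[ℂ] Sob (-3 / 2)} (hS : ∀ f, ∀ᵐ p, S f p =
      ((2 * Real.pi ^ 2 * sym m lam p : ℝ) : ℂ) * f p + kernelInt (kerT m lam) f p) :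
    IsTOperator m lam ℓ (S ∘L (sector ℓ (-1 / 2)).subtypeL) := by
  rintro Ξ ⟨s, hs, hΞ⟩
  filter_upwards [hS Ξ] with p hp
  obtain ⟨C, hC⟩ := exists_one_div_rad_le_decay hlam p
  rw [formT_eq hm hlam hℓ Ξ.2 (integrable_kerT_mul_low hm hlam Ξ p)
    (integrable_mul_of_memLp_sob hs hΞ (measurable_const.div
      continuous_rad.measurable.of_uncurry_left) hC), ← hp]
  rfl

lemma extension_mem_sector (hm : 0 < m) (hlam : 0 < lam)
    {S : Sob (-1 / 2) →L[ℂ] Sob (-3 / 2)} (hS : ∀ f, ∀ᵐ p, S f p =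
      ((2 * Real.pi ^ 2 * sym m lam p : ℝ) : ℂ) * f p + kernelInt (kerT m lam) f p)
    {f : Sob (-1 / 2)} (hf : f ∈ sector ℓ (-1 / 2)) : S f ∈ sector ℓ (-3 / 2) := by
  refine map_mem_sector (fun P hP f hf => ?_) hf
  have hlow := hasWeight_sob (-1 / 2)
  have hmin := hasWeight_sob (-3 / 2)
  obtain ⟨C, hC⟩ := exists_isBoundedKernel_kerT_low hm hlam
  obtain ⟨K, hK, -⟩ := hC.exists_clm hlow hmin
  have h1 := kernelInt_mem_angularSpace hlow hmin measurable_kerT (isZonal_kerT hm hlam)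
    (integrable_kerT_mul_low hm hlam) hP hf (hK f)
  have h2 : S f - K f ∈ angularSpace hmin P := by
    refine mul_mem_angularSpace hlow hmin (φ := fun p => 2 * Real.pi ^ 2 * sym m lam p)
      (w := fun r => 2 * Real.pi ^ 2 * Real.sqrt (nu m * r ^ 2 + lam)) (by fun_prop)
      (fun p => rfl) hf ?_
    filter_upwards [hmin.coeFn_sub (S f) (K f), hS f, hK f] with p h3 h4 h5
    rw [h3, h4, h5, add_sub_cancel_right]
  have := add_mem h2 h1
  rwa [sub_add_cancel] at this

end Extension

/-! ### Duality -/

section Duality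

variable {m lam α : ℝ} {ℓ : ℕ}

lemma conj_mul_integrable {s t : ℝ} (hst : t = -s) {f g : Mom → ℂ}
    (hf : MemLp f 2 (sobolevMeasure s)) (hg : MemLp g 2 (sobolevMeasure t)) :
    Integrable fun p => conj (f p) * g p := by
  subst hst
  obtain ⟨f1, f2⟩ := (hasWeight_sob s).memLp_iff.1 hf
  obtain ⟨g1, g2⟩ := (hasWeight_sob (-s)).memLp_iff.1 hg
  refine ⟨(Complex.continuous_conj.comp_aestronglyMeasurable f1).mul g1, ?_⟩
  refine lt_of_le_of_lt (lintegral_mono fun p => ?_) ((lintegral_add_left'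
    ((((hasWeight_sob s).measurable.ennreal_ofReal).aemeasurable.mul (f1.enorm.pow_const 2))) _
    ).le.trans_lt (ENNReal.add_lt_top.2 ⟨f2, g2⟩))
  have hb := bracket_pos s p
  simp only [Pi.mul_apply]
  rw [enorm_mul, RCLike.enorm_conj, ← ofReal_norm (f p), ← ofReal_norm (g p),
    ← ENNReal.ofReal_pow (norm_nonneg _), ← ENNReal.ofReal_pow (norm_nonneg _),
    ← ENNReal.ofReal_mul (norm_nonneg _), ← ENNReal.ofReal_mul hb.le,
    ← ENNReal.ofReal_mul (bracket_pos _ p).le, ← ENNReal.ofReal_add (by positivity)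
      (mul_nonneg (bracket_pos _ p).le (by positivity))]
  refine ENNReal.ofReal_le_ofReal ?_
  rw [bracket_neg]
  have e : ‖f p‖ * ‖g p‖ = bracket s p * (‖f p‖ * ((bracket s p)⁻¹ * ‖g p‖)) := by field_simp
  have e' : (bracket s p)⁻¹ * ‖g p‖ ^ 2 = bracket s p * ((bracket s p)⁻¹ * ‖g p‖) ^ 2 := by
    field_simp
  rw [e, e', ← mul_add]
  gcongr
  have : 0 ≤ (bracket s p)⁻¹ * ‖g p‖ := by positivity
  nlinarith [sq_nonneg (‖f p‖ - (bracket s p)⁻¹ * ‖g p‖), norm_nonneg (f p),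
    sq_nonneg ‖f p‖, sq_nonneg ((bracket s p)⁻¹ * ‖g p‖)]

/-- The kernel of `T_λ` is integrable against a charge in `H^{-1/2}` and one in `H^{3/2}`. -/
lemma integrable_conj_kerT (hm : 0 < m) (hlam : 0 < lam) (Ξ : Sob (-1 / 2)) (ξ : Sob (3 / 2)) :
    Integrable (fun z : Mom × Mom => conj (Ξ z.1) * ((kerT m lam z.1 z.2 : ℂ) * ξ z.2))
      (volume.prod volume) := by
  have hlow := hasWeight_sob (-1 / 2)
  have hhigh := hasWeight_sob (3 / 2)
  obtain ⟨C, hC⟩ := exists_isBoundedKernel_kerT_high hm hlam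
  have hm1 := hlow.aestronglyMeasurable_iff.1 (Lp.aestronglyMeasurable Ξ)
  have hm2 := hhigh.aestronglyMeasurable_iff.1 (Lp.aestronglyMeasurable ξ)
  have hms : AEStronglyMeasurable
      (fun z : Mom × Mom => conj (Ξ z.1) * ((kerT m lam z.1 z.2 : ℂ) * ξ z.2))
      (volume.prod volume) :=
    (Complex.continuous_conj.comp_aestronglyMeasurable hm1).comp_fst.mul
      ((Complex.measurable_ofReal.comp measurable_kerT).aestronglyMeasurable.mul hm2.comp_snd)
  refine ⟨hms, ?_⟩
  set Φ : Mom → ℝ≥0∞ := fun p => ∫⁻ q, ENNReal.ofReal |kerT m lam p q| * ‖ξ q‖ₑ with hΦ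
  have hΦm : AEMeasurable Φ := hC.aemeasurable_lintegral (hhigh.aemeasurable_enorm ξ)
  have hΦ2 : ∫⁻ p, ENNReal.ofReal (bracket (1 / 2) p) * Φ p ^ 2 < ∞ := hC.lintegral_lt_top hhigh ξ
  have hsum : ∫⁻ p, (ENNReal.ofReal (bracket (-1 / 2) p) * ‖Ξ p‖ₑ ^ 2 +
      ENNReal.ofReal (bracket (1 / 2) p) * Φ p ^ 2) < ∞ := by
    have hmΞ : AEMeasurable fun p => ENNReal.ofReal (bracket (-1 / 2) p) * ‖Ξ p‖ₑ ^ 2 :=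
      hlow.measurable.ennreal_ofReal.aemeasurable.mul ((hlow.aemeasurable_enorm Ξ).pow_const 2)
    rw [lintegral_add_left' hmΞ]
    exact ENNReal.add_lt_top.2 ⟨hlow.lintegral_lt_top Ξ, hΦ2⟩
  rw [HasFiniteIntegral, lintegral_prod _ hms.enorm]
  refine lt_of_le_of_lt (lintegral_mono fun p => ?_) hsum
  have e : ∫⁻ q, ‖conj (Ξ p) * ((kerT m lam p q : ℂ) * ξ q)‖ₑ = ‖Ξ p‖ₑ * Φ p := by
    rw [hΦ, ← lintegral_const_mul' _ _ enorm_ne_top]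
    refine lintegral_congr fun q => ?_
    rw [enorm_mul, enorm_mul, RCLike.enorm_conj, ← ofReal_norm (kerT m lam p q : ℂ),
      Complex.norm_real, Real.norm_eq_abs]
  simp only
  rw [e, bracket_neg_one_half, bracket_one_half]
  have hj := jap_pos p
  set w := ENNReal.ofReal (jap p) with hw
  have hw0 : w ≠ 0 := by simpa [hw] using hj
  have hwt : w ≠ ∞ := ENNReal.ofReal_ne_top
  rw [ENNReal.ofReal_inv_of_pos hj]
  -- Young's inequality with weight `w`
  rcases le_total ‖Ξ p‖ₑ (w * Φ p) with h | h
  · calc ‖Ξ p‖ₑ * Φ p ≤ w * Φ p * Φ p := by gcongr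
      _ = w * Φ p ^ 2 := by ring
      _ ≤ _ := le_add_self
  · have h' : Φ p ≤ w⁻¹ * ‖Ξ p‖ₑ := by
      rw [mul_comm, ← div_eq_mul_inv, ENNReal.le_div_iff_mul_le (Or.inl hw0) (Or.inl hwt), mul_comm]
      exact h
    calc ‖Ξ p‖ₑ * Φ p ≤ ‖Ξ p‖ₑ * (w⁻¹ * ‖Ξ p‖ₑ) := by gcongr
      _ = w⁻¹ * ‖Ξ p‖ₑ ^ 2 := by ring
      _ ≤ _ := le_self_add

/-- The symmetry of `T_λ + α`, with one argument in `H^{-1/2}_ℓ` and the other in `H^{3/2}_ℓ`. -/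
lemma integral_conj_mul_formT (hm : 0 < m) (hlam : 0 < lam) (hℓ : 1 ≤ ℓ)
    {S : Sob (-1 / 2) →L[ℂ] Sob (-3 / 2)} (hS : ∀ f, ∀ᵐ p, S f p =
      ((2 * Real.pi ^ 2 * sym m lam p : ℝ) : ℂ) * f p + kernelInt (kerT m lam) f p)
    (Ξ : Sob (-1 / 2)) {ξ : Sob (3 / 2)} (hξ : ξ ∈ sector ℓ (3 / 2)) :
    ∫ p, conj (Ξ p) * (formT m lam ξ p + (α : ℂ) * ξ p) =
      ∫ p, conj (S Ξ p + (α : ℂ) * Ξ p) * ξ p := by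
  have hint := integrable_conj_kerT hm hlam Ξ ξ
  have hswap := integral_integral_swap
    (f := fun p q => conj (Ξ p) * ((kerT m lam p q : ℂ) * ξ q)) hint
  have e1 : ∀ p, ∫ q, conj (Ξ p) * ((kerT m lam p q : ℂ) * ξ q) =
      conj (Ξ p) * kernelInt (kerT m lam) ξ p := fun p =>
    integral_const_mul (L := ℂ) _ _
  have hi1 : Integrable fun p => conj (Ξ p) * kernelInt (kerT m lam) ξ p :=
    hint.integral_prod_left.congr (ae_of_all _ e1)
  have e2 : ∀ q, ∫ p, conj (Ξ p) * ((kerT m lam p q : ℂ) * ξ q) =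
      conj (kernelInt (kerT m lam) Ξ q) * ξ q := by
    intro q
    rw [kernelInt, ← integral_conj, ← integral_mul_const]
    refine integral_congr_ae (ae_of_all _ fun p => ?_)
    simp only [map_mul, Complex.conj_ofReal, kerT_comm q p]
    ring
  have hi2 : Integrable fun q => conj (kernelInt (kerT m lam) Ξ q) * ξ q := by
    refine hint.integral_prod_right.congr (ae_of_all _ fun q => ?_)
    exact e2 q
  simp only [e1, e2] at hswap
  obtain ⟨c₂, hc₂, hge⟩ := exists_sym_le (m := m) (lam := lam)
  have hd : Integrable fun p =>
      conj (Ξ p) * (((2 * Real.pi ^ 2 * sym m lam p + α : ℝ) : ℂ) * ξ p) := by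
    obtain ⟨D, hD, -⟩ := exists_mul_clm (hasWeight_sob (3 / 2)) (hasWeight_sob (1 / 2))
      (φ := fun p => 2 * Real.pi ^ 2 * sym m lam p + α)
      ((continuous_sym.measurable.const_mul _).add_const _)
      (C := 2 * Real.pi ^ 2 * c₂ + |α|) (by positivity)
      (fun p => by
        have h1 := one_le_jap p
        have h2 := sym_pos hm hlam p
        rw [bracket_three_halves, bracket_one_half, ← sq_abs (_ + α)]
        have h3 : |2 * Real.pi ^ 2 * sym m lam p + α| ≤ (2 * Real.pi ^ 2 * c₂ + |α|) * jap p := by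
          refine (abs_add_le _ _).trans ?_
          rw [abs_of_pos (by positivity : 0 < 2 * Real.pi ^ 2 * sym m lam p), add_mul,
            mul_assoc _ c₂]
          have h4 : |α| * 1 ≤ |α| * jap p := by gcongr
          have h5 : 2 * Real.pi ^ 2 * sym m lam p ≤ 2 * Real.pi ^ 2 * (c₂ * jap p) := by
            gcongr
            exact hge p
          linarith
        calc _ ≤ jap p * ((2 * Real.pi ^ 2 * c₂ + |α|) * jap p) ^ 2 := by gcongr
          _ = _ := by ring)
    refine (conj_mul_integrable (by norm_num) (Lp.memLp Ξ) (Lp.memLp (D ξ))).congr ?_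
    filter_upwards [hD ξ] with p hp
    rw [hp]
  calc ∫ p, conj (Ξ p) * (formT m lam ξ p + (α : ℂ) * ξ p)
      = ∫ p, (conj (Ξ p) * (((2 * Real.pi ^ 2 * sym m lam p + α : ℝ) : ℂ) * ξ p) +
          conj (Ξ p) * kernelInt (kerT m lam) ξ p) := by
        refine integral_congr_ae (ae_of_all _ fun p => ?_)
        simp only [formT_eq_of_mem_sector_high hm hlam hℓ hξ]
        push_cast
        ring
    _ = ∫ p, (conj (Ξ p) * (((2 * Real.pi ^ 2 * sym m lam p + α : ℝ) : ℂ) * ξ p) +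
          conj (kernelInt (kerT m lam) Ξ p) * ξ p) := by
        rw [integral_add hd hi1, integral_add hd hi2, hswap]
    _ = _ := by
        refine integral_congr_ae ?_
        filter_upwards [hS Ξ] with p hp
        rw [hp]
        simp only [map_add, map_mul, Complex.conj_ofReal]
        push_cast
        ring

/-- A charge in a sector of `H^{-3/2}` annihilating that sector of `H^{3/2}` vanishes. -/
lemma eq_zero_of_forall_integral_eq_zero {G : Sob (-3 / 2)} (hG : G ∈ sector ℓ (-3 / 2))
    (h : ∀ ξ ∈ sector ℓ (3 / 2), ∫ p, conj (G p) * (ξ : Sob (3 / 2)) p = 0) : G = 0 := by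
  have hmin := hasWeight_sob (-3 / 2)
  have hhigh := hasWeight_sob (3 / 2)
  obtain ⟨D, hD, -⟩ := exists_mul_clm hmin hhigh (φ := fun p => (jap p ^ 3)⁻¹)
    (continuous_jap.measurable.pow_const 3).inv (C := 1) zero_le_one (fun p => by
      have := jap_pos p
      rw [bracket_three_halves, bracket_neg_three_halves]
      refine le_of_eq ?_
      field_simp)
  have hDG : D G ∈ sector ℓ (3 / 2) := map_mem_sector (fun P hP f hf =>
    mul_mem_angularSpace hmin hhigh (w := fun r => (Real.sqrt (1 + r ^ 2) ^ 3)⁻¹) (by fun_prop)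
      (fun p => rfl) hf (hD f)) hG
  have h1 := h _ hDG
  have hint := conj_mul_integrable (s := -3 / 2) (t := 3 / 2) (by norm_num) (Lp.memLp G)
    (Lp.memLp (D G))
  have e : ∀ᵐ p, conj (G p) * D G p = (((jap p ^ 3)⁻¹ * ‖G p‖ ^ 2 : ℝ) : ℂ) := by
    filter_upwards [hD G] with p hp
    rw [hp, mul_left_comm, Complex.conj_mul']
    push_cast
    ring
  rw [integral_congr_ae e, integral_complex_ofReal, Complex.ofReal_eq_zero,
    integral_eq_zero_iff_of_nonneg (fun p => by have := jap_pos p; positivity)] at h1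
  · refine hmin.ext ?_
    filter_upwards [h1, hmin.coeFn_zero] with p h2 h3
    rw [h3]
    have := jap_pos p
    simpa [this.ne'] using h2
  · have := (hint.congr e).re
    exact this.congr (ae_of_all _ fun p => Complex.ofReal_re _)

end Duality

/-! ### The kernel of the adjoint -/

section AdjointKernel

variable {m lam : ℝ} {ℓ : ℕ}

lemma coeFn_sobIncl {s t : ℝ} (h : s ≤ t) (f : Sob t) : ∀ᵐ p, sobIncl h f p = f p :=
  (hasWeight_sob s).coeFn_toLp _

lemma extension_add_smul_apply (α : ℝ) {S : Sob (-1 / 2) →L[ℂ] Sob (-3 / 2)}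
    (hS : ∀ f, ∀ᵐ p, S f p =
      ((2 * Real.pi ^ 2 * sym m lam p : ℝ) : ℂ) * f p + kernelInt (kerT m lam) f p)
    (Ξ : Sob (-1 / 2)) :
    ∀ᵐ p, (S Ξ + (α : ℂ) • sobIncl (by norm_num : (-3 / 2 : ℝ) ≤ -1 / 2) Ξ) p =
      ((2 * Real.pi ^ 2 * sym m lam p : ℝ) : ℂ) * Ξ p + kernelInt (kerT m lam) Ξ p +
        (α : ℂ) * Ξ p := by
  have hmin := hasWeight_sob (-3 / 2)
  filter_upwards [hS Ξ, hmin.coeFn_add (S Ξ) ((α : ℂ) • sobIncl (by norm_num) Ξ),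
    hmin.coeFn_smul α (sobIncl (by norm_num) Ξ),
    coeFn_sobIncl (by norm_num : (-3 / 2 : ℝ) ≤ -1 / 2) Ξ] with p h1 h2 h3 h4
  rw [h2, h3, h4, h1]

lemma sobIncl_mem_sector {s t : ℝ} (h : s ≤ t) {f : Sob t} (hf : f ∈ sector ℓ t) :
    sobIncl h f ∈ sector ℓ s := by
  obtain ⟨D, hD, -⟩ := exists_mul_clm (hasWeight_sob t) (hasWeight_sob s) (φ := fun _ => 1)
    measurable_const (C := 1) zero_le_one (fun p => by
      rw [one_pow, mul_one, one_mul]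
      exact Real.rpow_le_rpow_of_exponent_le (one_le_bracket_base p) h)
  have e : sobIncl h f = D f := by
    refine (hasWeight_sob s).ext ?_
    filter_upwards [coeFn_sobIncl h f, hD f] with p h1 h2
    rw [h1, h2]
    simp
  rw [e]
  exact map_mem_sector (fun P _ f hf => mul_mem_angularSpace (hasWeight_sob t) (hasWeight_sob s)
    (w := fun _ => 1) measurable_const (fun _ => rfl) hf (hD f)) hf

/-- The kernel of the adjoint consists of the solutions of `(T_λ + α) Ξ = 0`: the factor `W_λ` of
the scalar product cancels the inverse in the operator, and `T_λ + α` is symmetric. -/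
theorem auxAdjointKer_eq {α : ℝ} (hm : 0 < m) (hlam : 0 < lam) (hℓ : 1 ≤ ℓ)
    {S : Sob (-1 / 2) →L[ℂ] Sob (-3 / 2)} (hS : ∀ f, ∀ᵐ p, S f p =
      ((2 * Real.pi ^ 2 * sym m lam p : ℝ) : ℂ) * f p + kernelInt (kerT m lam) f p)
    (hW : ∀ ξ ∈ sector ℓ (3 / 2), ∃! ζ : Sob (-1 / 2),
      ζ ∈ sector ℓ (-1 / 2) ∧ IsAction m lam α ξ ζ) :
    auxAdjointKer m lam α ℓ =
      {Ξ | ∃ _ : Ξ ∈ sector ℓ (-1 / 2),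
        S Ξ + (α : ℂ) • sobIncl (by norm_num : (-3 / 2 : ℝ) ≤ -1 / 2) Ξ = 0} := by
  have hmin := hasWeight_sob (-3 / 2)
  have hzero : ∀ x : Sob (-1 / 2), innerW m lam 0 x = 0 := by
    intro x
    refine integral_eq_zero_of_ae ?_
    filter_upwards [(hasWeight_sob (-1 / 2)).coeFn_zero] with p hp
    rw [hp, map_zero, zero_mul, Pi.zero_apply]
  -- the pairing with an element of the range of the operator
  have hpair : ∀ (Ξ : Sob (-1 / 2)), ∀ ξ ∈ sector ℓ (3 / 2), ∀ ζ, IsAction m lam α ξ ζ →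
      innerW m lam Ξ ζ = 2 * ∫ p, conj ((S Ξ +
        (α : ℂ) • sobIncl (by norm_num : (-3 / 2 : ℝ) ≤ -1 / 2) Ξ) p) * ξ p := by
    intro Ξ ξ hξ ζ hζ
    have h1 : innerW m lam Ξ ζ =
        2 * ∫ p, conj (Ξ p) * (formT m lam ξ p + (α : ℂ) * ξ p) := by
      rw [innerW, ← integral_const_mul]
      refine integral_congr_ae ?_
      filter_upwards [hζ] with p hp
      rw [hp]
      ring
    rw [h1, integral_conj_mul_formT hm hlam hℓ hS Ξ hξ]
    congr 1
    refine integral_congr_ae ?_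
    filter_upwards [extension_add_smul_apply α hS Ξ, hS Ξ] with p h2 h3
    rw [h2, h3]
  ext Ξ
  constructor
  · rintro ⟨hΞ, -, h⟩
    refine ⟨hΞ, eq_zero_of_forall_integral_eq_zero (ℓ := ℓ) (add_mem
      (extension_mem_sector hm hlam hS hΞ)
      (Submodule.smul_mem _ _ (sobIncl_mem_sector _ hΞ))) fun ξ hξ => ?_⟩
    obtain ⟨ζ, ⟨hζ, hact⟩, -⟩ := hW ξ hξ
    have h1 := h (sobIncl (by norm_num) ξ, ζ) ⟨⟨ξ, hξ, rfl, hact⟩, hζ⟩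
    rw [hzero, hpair Ξ ξ hξ ζ hact] at h1
    simpa using h1
  · rintro ⟨hΞ, h0⟩
    refine ⟨hΞ, zero_mem _, ?_⟩
    rintro ⟨x, ζ⟩ ⟨⟨ξ, hξ, -, hact⟩, -⟩
    rw [hzero, hpair Ξ ξ hξ ζ hact, h0]
    refine mul_eq_zero_of_right _ (integral_eq_zero_of_ae ?_)
    filter_upwards [hmin.coeFn_zero] with p hp
    rw [hp, map_zero, zero_mul, Pi.zero_apply]

end AdjointKernel

/-! ### The equation at almost every momentum -/

/-- The integrals over balls converge to the reduced form of `T_λ`, because the radial part of the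
kernel contributes nothing on any ball. -/
lemma tendsto_integral_ball {m lam : ℝ} {ℓ : ℕ} (hm : 0 < m) (hlam : 0 < lam) (hℓ : 1 ≤ ℓ)
    {Ξ : Sob (-1 / 2)} (hΞ : Ξ ∈ sector ℓ (-1 / 2)) (p : Mom) :
    Tendsto (fun R : ℝ => ∫ q in Metric.ball (0 : Mom) R, Ξ q / (den m lam p q : ℂ)) atTop
      (𝓝 (kernelInt (kerT m lam) Ξ p)) := by
  have hk := integrable_kerT_mul_low hm hlam Ξ p
  have h1 : Tendsto (fun R : ℝ => ∫ q in Metric.ball (0 : Mom) R, (kerT m lam p q : ℂ) * Ξ q) atTop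
      (𝓝 (kernelInt (kerT m lam) Ξ p)) :=
    (aecover_ball tendsto_id).integral_tendsto_of_countably_generated hk
  refine h1.congr fun R => ?_
  set w : ℝ → ℝ := (Set.Iio R).indicator fun r => 1 / (‖p‖ ^ 2 + r ^ 2 + lam) with hw
  have hwm : Measurable w := Measurable.indicator (by fun_prop) measurableSet_Iio
  have hwq : ∀ q : Mom, (w ‖q‖ : ℂ) * Ξ q =
      (Metric.ball (0 : Mom) R).indicator (fun q => ((1 / rad lam p q : ℝ) : ℂ) * Ξ q) q := by
    intro q
    by_cases hq : ‖q‖ < R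
    · rw [Set.indicator_of_mem (by simpa using hq), hw, Set.indicator_of_mem (by simpa using hq),
        rad]
    · rw [Set.indicator_of_notMem (by simpa using hq), hw,
        Set.indicator_of_notMem (by simpa using hq)]
      simp
  have hwi : Integrable fun q : Mom => (w ‖q‖ : ℂ) * Ξ q := by
    refine (hasWeight_sob (-1 / 2)).integrable_mul_of_decay (c := 1) one_pos
      (fun q => by rw [bracket_neg_one_half, one_mul]) (Lp.memLp Ξ) (X := fun q => w ‖q‖)
      (hwm.comp measurable_norm) (C := 1 / lam * Real.sqrt (1 + R ^ 2) ^ 3) fun q => ?_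
    have hj := jap_pos q
    by_cases hq : ‖q‖ < R
    · have h2 : jap q ≤ Real.sqrt (1 + R ^ 2) := by
        refine Real.sqrt_le_sqrt ?_
        have := norm_nonneg q
        gcongr
      rw [hw, Set.indicator_of_mem (by simpa using hq), abs_of_nonneg (by positivity), mul_assoc]
      have h3 : 1 ≤ Real.sqrt (1 + R ^ 2) ^ 3 * (jap q ^ 3)⁻¹ := by
        rw [← div_eq_mul_inv, one_le_div (by positivity)]
        gcongr
      calc 1 / (‖p‖ ^ 2 + ‖q‖ ^ 2 + lam) ≤ 1 / lam * 1 := by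
            rw [mul_one]
            refine one_div_le_one_div_of_le hlam ?_
            nlinarith [sq_nonneg ‖p‖, sq_nonneg ‖q‖]
        _ ≤ _ := by gcongr
    · rw [hw, Set.indicator_of_notMem (by simpa using hq), abs_zero]
      positivity
  have h0 := integral_radial_mul_sector_eq_zero hℓ hΞ hwm hwi
  simp only [hwq] at h0 hwi
  rw [integral_indicator measurableSet_ball] at h0
  rw [integrable_indicator_iff measurableSet_ball] at hwi
  rw [← add_zero (∫ q in Metric.ball (0 : Mom) R, (kerT m lam p q : ℂ) * Ξ q), ← h0,
    ← integral_add hk.integrableOn hwi]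
  refine integral_congr_ae (ae_of_all _ fun q => ?_)
  simp only [kerT]
  push_cast
  ring

end TMS

end

open TMS
theorem mainTheorem3 (mstar m lam α : ℝ) (ℓ : ℕ)
    (hmstar_pos : 0 < mstar) (hmstar : efimov mstar = 1) (hm : mstar < m)
    (hℓ : 1 ≤ ℓ) (hlam : 0 < lam) (hbottom : HasPositiveBottom m lam α ℓ) :
    -- the operator `2 W_λ⁻¹ (T_λ + α)` is well defined on the whole of `H^{3/2}_ℓ`
    (∀ ξ ∈ sector ℓ (3 / 2), ∃! ζ : Sob (-1 / 2),
      ζ ∈ sector ℓ (-1 / 2) ∧ IsAction m lam α ξ ζ) ∧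
    -- the operator `T_λ : H^{-1/2}_ℓ → H^{-3/2}` is well defined, and with it the kernel is
    -- characterised
    ∃ S : sector ℓ (-1 / 2) →L[ℂ] Sob (-3 / 2),
      IsTOperator m lam ℓ S ∧
      (∀ S' : sector ℓ (-1 / 2) →L[ℂ] Sob (-3 / 2), IsTOperator m lam ℓ S' → S' = S) ∧
      auxAdjointKer m lam α ℓ =
        {Ξ | ∃ h : Ξ ∈ sector ℓ (-1 / 2),
          S ⟨Ξ, h⟩ + (α : ℂ) • sobIncl (by norm_num : (-3 / 2 : ℝ) ≤ -1 / 2) Ξ = 0} ∧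
      ∀ Ξ ∈ auxAdjointKer m lam α ℓ, ∀ᵐ p : Mom, SolvesAt m lam α Ξ p := by
  have hm0 : 0 < m := hmstar_pos.trans hm
  have hW : ∀ ξ ∈ sector ℓ (3 / 2), ∃! ζ : Sob (-1 / 2),
      ζ ∈ sector ℓ (-1 / 2) ∧ IsAction m lam α ξ ζ :=
    fun ξ hξ => existsUnique_isAction hm0 hlam hℓ hξ
  obtain ⟨S, hS⟩ := exists_extension hm0 hlam
  have hT := isTOperator_of_extension hm0 hlam hℓ hS
  have hker : auxAdjointKer m lam α ℓ =
      {Ξ | ∃ h : Ξ ∈ sector ℓ (-1 / 2), (S ∘L (sector ℓ (-1 / 2)).subtypeL) ⟨Ξ, h⟩ +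
        (α : ℂ) • sobIncl (by norm_num : (-3 / 2 : ℝ) ≤ -1 / 2) Ξ = 0} :=
    auxAdjointKer_eq hm0 hlam hℓ hS hW
  refine ⟨hW, S ∘L (sector ℓ (-1 / 2)).subtypeL, hT, fun S' hS' => isTOperator_unique hT hS',
    hker, fun Ξ hΞ => ?_⟩
  rw [hker] at hΞ
  obtain ⟨hmem, h0⟩ := hΞ
  filter_upwards [extension_add_smul_apply α hS Ξ, (hasWeight_sob (-3 / 2)).coeFn_zero] with p h1 h2
  have h3 : S Ξ + (α : ℂ) • sobIncl (by norm_num : (-3 / 2 : ℝ) ≤ -1 / 2) Ξ = 0 := h0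
  rw [h3, h2] at h1
  have := ((tendsto_integral_ball hm0 hlam hℓ hmem p).const_add
    (((2 * Real.pi ^ 2 * sym m lam p : ℝ) : ℂ) * Ξ p)).add_const ((α : ℂ) * Ξ p)
  rwa [← h1] at this
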